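/- **Theorem 2.3 (Regularity at infinity).** Let $\mathbb T^2=\mathbb R^2/\mathbb Z^2$, let $V\in C^\infty(\mathbb T^2;\mathbb R)$, and let $\varepsilon_\hbar$, $\tau_\hbar$ be positive and such that, as $\hbar\to0^+$, $\varepsilon_\hbar\to0$, $\hbar/\varepsilon_\hbar\to0$ and $\tau_\hbar\to+\infty$. Let $\Lambda\subset\mathbb Z^2$ be a primitive sublattice of rank $1$ (its real span $\langle\Lambda\rangle$ is a line and $\langle\Lambda\rangle\cap\mathbb Z^2=\Lambda$), let $\mathfrak e_\Lambda$ be a generator of $\Lambda$, let $H_\Lambda(\xi)=\langle\xi,\mathfrak e_\Lambda\rangle/\|\mathfrak e_\Lambda\|$ and $\Lambda^\perp=\{\xi\in\mathbb R^2:\langle\xi,\mathfrak e_\Lambda\rangle=0\}$. Let $\widehat{\mathbb R}=\mathbb R\cup\{\pm\infty\}=[-\infty,+\infty]$, viewed as a compact interval with the charts $s\mapsto\pm1/s$, $s\ge0$, at $\pm\infty$, and let $\mathcal B=C_0(\mathbb R^2\times\widehat{\mathbb R};C^3(\mathbb T^2))$. Given normalized $u_\hbar\in L^2(\mathbb T^2)$,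 let $v_\hbar\in C(\mathbb R;L^2(\mathbb T^2))$ be the solution of $$i\hbar\,\partial_tv_\hbar=\Big(-\frac{\hbar^2\Delta}{2}+\varepsilon_\hbar^2V\Big)v_\hbar,\qquad v_\hbar|_{t=0}=u_\hbar,$$ and, for $a\in C_c^\infty(T^*\mathbb T^2\times\widehat{\mathbb R})$, put $$\langle w_{\Lambda,\hbar}(t),a\rangle=\Big\langle v_\hbar(t),\operatorname{Op}_\hbar^w\big(a(x,\xi,H_\Lambda(\xi)/\varepsilon_\hbar)\big)v_\hbar(t)\Big\rangle_{L^2(\mathbb T^2)},$$ where $\operatorname{Op}_\hbar^w(b)u(x)=(2\pi\hbar)^{-2}\iint_{\mathbb R^2\times\mathbb R^2}e^{\frac i\hbar\langle x-y,\xi\rangle}b(\tfrac{x+y}2,\xi)u(y)\,d\xi\,dy$ is the Weyl quantization acting on $\mathbb Z^2$-periodic functions. Let $\mathcal M_\Lambda(\tau,\varepsilon)$ be the set of all $\mu_\Lambda\in L^1(\mathbb R,\mathcal B)'$, $\mu_\Lambda:t\mapsto\mu_\Lambda(t)\in\mathcal B'$, such that for some sequence $\hbar_n\to0^+$ and some normalized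 initial data $u_{\hbar_n}$ satisfying $$\lim_{R\to+\infty}\limsup_{n\to\infty}\big\|\mathbf 1_{[R,\infty)}(-\hbar_n^2\Delta)u_{\hbar_n}\big\|_{L^2}=0,\qquad \lim_{\delta\to0^+}\limsup_{n\to\infty}\big\|\mathbf 1_{[0,\delta]}(-\hbar_n^2\Delta)u_{\hbar_n}\big\|_{L^2}=0,$$ one has, for all $\theta\in L^1(\mathbb R)$ and $a\in C_c^\infty(T^*\mathbb T^2\times\widehat{\mathbb R})$, $$\lim_{n\to\infty}\int_{\mathbb R}\theta(t)\,\langle w_{\Lambda,\hbar_n}(t\tau_{\hbar_n}),a\rangle\,dt=\int_{\mathbb R}\theta(t)\,\langle\mu_\Lambda(t),a\rangle\,dt.$$ Let $\mu_\Lambda\in\mathcal M_\Lambda(\tau,\varepsilon)$ and suppose that $\tau_\hbar\varepsilon_\hbar\ge1$ for all small $\hbar>0$. Then, for a.e. $t\in\mathbb R$, $\mu_\Lambda(t)$ is (represented by) a finite positive measure on $T^*\mathbb T^2\times\widehat{\mathbb R}$ and, denoting by $\tilde\mu^\Lambda(t)$ the restriction of this measure to $T^*\mathbb T^2\times\{\pm\infty\}$,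 one has, for every $k\in\Lambda\setminus\{0\}$, every $a\in C_c^\infty(\mathbb R^2\times\widehat{\mathbb R})$ and a.e. $t\in\mathbb R$, $$\big\langle\tilde\mu^\Lambda(t),a(\xi,\eta)e^{-2i\pi k\cdot x}\big\rangle=0 .$$ In particular, for a.e. $t\in\mathbb R$, the restriction of $\tilde\mu^\Lambda(t)$ to $\mathbb T^2\times\Lambda^\perp\times\widehat{\mathbb R}$ is constant in $x$: it is the product of Lebesgue measure $dx$ on $\mathbb T^2$ and of a measure on $\Lambda^\perp\times\widehat{\mathbb R}$. -/

import Mathlib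

open MeasureTheory Filter Topology
open scoped ContDiff Laplacian

namespace TwoMicrolocal

noncomputable section

/-- The plane `ℝ²` with its Euclidean structure. -/
abbrev Plane : Type := EuclideanSpace ℝ (Fin 2)

/-- The torus `𝕋² = ℝ²/ℤ²`. -/
abbrev Torus : Type := UnitAddTorus (Fin 2)

/-- The extended phase space `T*𝕋² × ℝ̂ = 𝕋² × ℝ² × [-∞, +∞]`, with points `(x, ξ, η)`. -/
abbrev Phase : Type := Torus × Plane × EReal

/-- The canonical projection `ℝ² → 𝕋²`. -/
def proj (y : Plane) : Torus := fun i => (y i : UnitAddCircle)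

/-- The inclusion `ℤ² → ℝ²`. -/
def latticeVec (k : Fin 2 → ℤ) : Plane := WithLp.toLp 2 fun i => (k i : ℝ)

/-- Lebesgue measure on `𝕋²`, of total mass one. -/
abbrev torusMeasure : Measure Torus := Measure.pi fun _ => AddCircle.haarAddCircle

/-- The Hilbert space `L²(𝕋²)`. -/
abbrev L2 : Type := Lp ℂ 2 torusMeasure

/-- The exponential `e_k(x) = e^{2iπ k·x}` as an element of `L²(𝕋²)`. -/
def expMode (k : Fin 2 → ℤ) : L2 := ContinuousMap.toLp 2 torusMeasure ℂ (UnitAddTorus.mFourier k)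

/-- A function on the torus is smooth when its periodic lift to the plane is `C^∞`. -/
def TorusSmooth {F : Type} [NormedAddCommGroup F] [NormedSpace ℝ F] (f : Torus → F) : Prop :=
  ContDiff ℝ ∞ (fun y : Plane => f (proj y))

/-- The Laplacian `Δ = ∂₁² + ∂₂²` of a function on the torus, computed at `x` in the flat chart
`y ↦ x + y` around `x`. -/
def torusLaplacian (f : Torus → ℂ) (x : Torus) : ℂ :=
  (Δ (fun y : Plane => f (x + proj y))) 0

/-! ### The Schrödinger equation -/

/-- `v ∈ C(ℝ; L²(𝕋²))` solves `iħ ∂ₜ v = (-ħ²Δ/2 + ε² V) v`, `v|ₜ₌₀ = u`, the equation holding in the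
sense of distributions on `𝕋²` at each time `t`. -/
structure IsSchrodingerSolution (V : Torus → ℝ) (ħ ε : ℝ) (u : L2) (v : ℝ → L2) : Prop where
  continuous : Continuous v
  initial : v 0 = u
  equation : ∀ φ : Torus → ℂ, TorusSmooth φ → ∀ t : ℝ,
    HasDerivAt
      (fun s : ℝ => Complex.I * (ħ : ℂ) * ∫ x, v s x * starRingEnd ℂ (φ x) ∂torusMeasure)
      (∫ x, v t x * starRingEnd ℂ
        (-((ħ : ℂ) ^ 2 / 2) * torusLaplacian φ x + (ε : ℂ) ^ 2 * (V x : ℂ) * φ x) ∂torusMeasure) t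

/-- The spectral cutoff `𝟏_I(-ħ²Δ) u` of `u ∈ L²(𝕋²)`: recall that `-ħ²Δ e_k = 4π²ħ²|k|² e_k`. -/
def spectralCutoff (I : Set ℝ) (ħ : ℝ) (u : L2) : L2 :=
  ∑' k : Fin 2 → ℤ,
    Set.indicator {k | 4 * Real.pi ^ 2 * ħ ^ 2 * ‖latticeVec k‖ ^ 2 ∈ I}
      (fun k => (inner ℂ (expMode k) u : ℂ) • expMode k) k

/-- The data `u_n` oscillate at frequencies at most of order `1 / ħ_n`. -/
def NoHighFrequency (ħ : ℕ → ℝ) (u : ℕ → L2) : Prop :=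
  Tendsto (fun R : ℝ => limsup (fun n => ‖spectralCutoff (Set.Ici R) (ħ n) (u n)‖) atTop)
    atTop (𝓝 0)

/-- The data `u_n` oscillate at frequencies at least of order `1 / ħ_n`. -/
def NoLowFrequency (ħ : ℕ → ℝ) (u : ℕ → L2) : Prop :=
  Tendsto (fun δ : ℝ => limsup (fun n => ‖spectralCutoff (Set.Icc 0 δ) (ħ n) (u n)‖) atTop)
    (𝓝[>] 0) (𝓝 0)

/-! ### Weyl quantization on the torus -/

/-- The Weyl quantization `Op_ħ^w(b)`, acting on functions on the torus, of a symbol `b(x, ξ)` that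
is periodic in `x` and smooth with compact support in `ξ`:
`Op_ħ^w(b)u(x) = (2πħ)⁻² ∫∫ e^{i⟨x-y,ξ⟩/ħ} b((x+y)/2, ξ) u(y) dξ dy` (integrated over `y ∈ ℝ²`, with
`u` extended periodically), written in the variable `z = x - y`. The `ξ`-integral decays rapidly
in `z`. -/
def weylOp (ħ : ℝ) (b : Torus → Plane → ℂ) (u : Torus → ℂ) (x : Torus) : ℂ :=
  (((2 * Real.pi * ħ) ^ 2 : ℝ) : ℂ)⁻¹ *
    ∫ z : Plane,
      (∫ ξ : Plane, Complex.exp (Complex.I * ((inner ℝ z ξ / ħ : ℝ) : ℂ)) *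
        b (x - proj ((1 / 2 : ℝ) • z)) ξ) * u (x - proj z)

/-! ### Symbols on the extended phase space -/

/-- The point `+∞` of `ℝ̂` has the chart `s ↦ 1/s`, `s ≥ 0`. -/
def chartTop (s : ℝ) : EReal := if s = 0 then ⊤ else ((s⁻¹ : ℝ) : EReal)

/-- The point `-∞` of `ℝ̂` has the chart `s ↦ -1/s`, `s ≥ 0`. -/
def chartBot (s : ℝ) : EReal := if s = 0 then ⊥ else ((-s⁻¹ : ℝ) : EReal)

/-- The space `C_c^∞(T*𝕋² × ℝ̂)`, where `ℝ̂ = [-∞, +∞]` is seen as a compact interval (a smooth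
manifold with two boundary points). -/
def symbols : Submodule ℂ (Phase → ℂ) where
  carrier := {a | HasCompactSupport a ∧
    ContDiff ℝ ∞ (fun p : Plane × Plane × ℝ => a (proj p.1, p.2.1, (p.2.2 : EReal))) ∧
    ContDiffOn ℝ ∞ (fun p : Plane × Plane × ℝ => a (proj p.1, p.2.1, chartTop p.2.2))
      {p | 0 ≤ p.2.2} ∧
    ContDiffOn ℝ ∞ (fun p : Plane × Plane × ℝ => a (proj p.1, p.2.1, chartBot p.2.2))
      {p | 0 ≤ p.2.2}}
  add_mem' := fun ha hb =>
    ⟨ha.1.add hb.1, ha.2.1.add hb.2.1, ha.2.2.1.add hb.2.2.1, ha.2.2.2.add hb.2.2.2⟩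
  zero_mem' := ⟨HasCompactSupport.zero, contDiff_const, contDiffOn_const, contDiffOn_const⟩
  smul_mem' := fun c _ ha =>
    ⟨ha.1.smul_left (f := fun _ => c), contDiff_const.smul ha.2.1, contDiffOn_const.smul ha.2.2.1,
      contDiffOn_const.smul ha.2.2.2⟩

/-- The norm of `a` in `𝓑 = C₀(ℝ² × ℝ̂, C³(𝕋²))` is at most `M` (up to the number of derivatives). -/
def BNormLE (a : Phase → ℂ) (M : ℝ) : Prop :=
  ∀ j : ℕ, j ≤ 3 → ∀ (ξ : Plane) (η : EReal) (y : Plane),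
    ‖iteratedFDeriv ℝ j (fun y' : Plane => a (proj y', ξ, η)) y‖ ≤ M

/-- Families of linear forms which define an element of `L¹(ℝ, 𝓑)'`. As `C_c^∞(T*𝕋² × ℝ̂)` is dense
in `𝓑`, an element of `𝓑'` is the same as a linear form on `C_c^∞(T*𝕋² × ℝ̂)` which is bounded for
the norm of `𝓑`. -/
def IsDualFamily (μ : ℝ → symbols →ₗ[ℂ] ℂ) : Prop :=
  (∀ a : symbols, AEStronglyMeasurable (fun t => μ t a) volume) ∧
  ∃ C : ℝ, ∀ᵐ t : ℝ, ∀ (a : symbols) (M : ℝ), BNormLE a M → ‖μ t a‖ ≤ C * M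

/-! ### Rational directions and two-microlocal distributions -/

/-- `Λ` is a primitive sublattice of rank one of `ℤ²`: its real span `⟨Λ⟩` is a line, and
`⟨Λ⟩ ∩ ℤ² = Λ`. -/
def IsPrimitiveRankOne (Λ : AddSubgroup (Fin 2 → ℤ)) : Prop :=
  Module.finrank ℝ (Submodule.span ℝ (latticeVec '' (Λ : Set (Fin 2 → ℤ)))) = 1 ∧
  ∀ k : Fin 2 → ℤ,
    latticeVec k ∈ Submodule.span ℝ (latticeVec '' (Λ : Set (Fin 2 → ℤ))) → k ∈ Λ

/-- `H_Λ(ξ) = ⟨ξ, 𝔢_Λ⟩ / L_Λ`, with `L_Λ = ‖𝔢_Λ‖`. -/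
def hamiltonian (e : Fin 2 → ℤ) (ξ : Plane) : ℝ := inner ℝ ξ (latticeVec e) / ‖latticeVec e‖

/-- The two-microlocal Wigner distribution
`⟨v, Op_ħ^w(a(x, ξ, H_Λ(ξ)/ε)) v⟩` of `v ∈ L²(𝕋²)`, tested against `a`. -/
def wigner (e : Fin 2 → ℤ) (ħ ε : ℝ) (v : L2) (a : Phase → ℂ) : ℂ :=
  ∫ x, starRingEnd ℂ (v x) *
    weylOp ħ (fun x' ξ => a (x', ξ, ((hamiltonian e ξ / ε : ℝ) : EReal))) v x ∂torusMeasure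

/-- The standing assumptions on the size of the perturbation and on the time scale, as `ħ → 0⁺`:
`ε_ħ → 0`, `ħ / ε_ħ → 0` and `τ_ħ → +∞`. -/
structure AdmissibleScales (ε τ : ℝ → ℝ) : Prop where
  eps_pos : ∀ᶠ ħ in 𝓝[>] (0 : ℝ), 0 < ε ħ
  eps_tendsto : Tendsto ε (𝓝[>] 0) (𝓝 0)
  strong : Tendsto (fun ħ => ħ / ε ħ) (𝓝[>] 0) (𝓝 0)
  tau_tendsto : Tendsto τ (𝓝[>] 0) atTop

/-- The set `𝓜_Λ(τ, ε)` of the accumulation points, for the weak-star topology of `L¹(ℝ, 𝓑)'`, of the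
rescaled two-microlocal distributions `t ↦ w_{Λ,ħ}(t τ_ħ)`, when the normalized initial data vary
among the sequences oscillating exactly at frequency `1 / ħ`. -/
def accumulationPoints (V : Torus → ℝ) (ε τ : ℝ → ℝ) (e : Fin 2 → ℤ) :
    Set (ℝ → symbols →ₗ[ℂ] ℂ) :=
  {μ | IsDualFamily μ ∧
    ∃ (ħ : ℕ → ℝ) (u : ℕ → L2) (v : ℕ → ℝ → L2),
      (∀ n, 0 < ħ n) ∧ Tendsto ħ atTop (𝓝 0) ∧
      (∀ n, ‖u n‖ = 1) ∧ NoHighFrequency ħ u ∧ NoLowFrequency ħ u ∧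
      (∀ n, IsSchrodingerSolution V (ħ n) (ε (ħ n)) (u n) (v n)) ∧
      ∀ θ : ℝ → ℂ, Integrable θ → ∀ a : symbols,
        Tendsto
          (fun n => ∫ t : ℝ, θ t * wigner e (ħ n) (ε (ħ n)) (v n (t * τ (ħ n))) a)
          atTop (𝓝 (∫ t : ℝ, θ t * μ t a))}

/-- The part at infinity `T*𝕋² × {±∞}` of the extended phase space. -/
def infinityPart : Set Phase := {p | p.2.2 = ⊤ ∨ p.2.2 = ⊥}

/-- The subset `𝕋² × Λ^⊥ × ℝ̂`, where `Λ^⊥ = {ξ : ⟨ξ, 𝔢_Λ⟩ = 0}`. -/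
def perpPart (e : Fin 2 → ℤ) : Set Phase := {p | inner ℝ p.2.1 (latticeVec e) = 0}

end

end TwoMicrolocal

open TwoMicrolocal

open MeasureTheory Filter Topology
open scoped ContDiff Laplacian

namespace TwoMicrolocal

noncomputable section

/-! Everything is done on Fourier coefficients. For a symbol `b(ξ, η) e_k(x)` the Wigner
distribution of `v` is the quadratic form `∑ⱼ conj(v_{j+k}) β(2πħ(j + k/2)) v_j`, with `β(ξ) = b(ξ,
H_Λ(ξ)/ε)` (`pairing_weylOp_mode`). Along the flow, the kinetic part of its time derivative
multiplies the symbol by `2πi k·ξ` exactly, because the symbol is evaluated at the midpoint. The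
potential contributes `O(ε²)` times the Lipschitz constant of `β`, that is `O(ε² + ε)` in general
(`hasDerivAt_transport`). Integration by parts in time, at the scale `τ`, then has two consequences.

If `k = m𝔢_Λ`, then `k·ξ = m‖𝔢_Λ‖ ε η`. Applied to `b η/(R² + η²)`, whose size and Lipschitz
constant are `O(1/R)`, and divided by `ε`, the identity bounds the limit tested on `b η²/(R² + η²)
e_k` by `O(1/R)`; this is where `τε ≥ 1` enters (`norm_integral_filtered_le`). As `R → ∞` the weight
tends to the indicator function of `η = ±∞`, so these modes vanish at infinity.

For every `k`, the limit vanishes on `(k·ξ) b e_k` (`ae_flowed_eq_zero`). If `k ∉ Λ`, then `k·ξ ≠ 0`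
on `Λ^⊥` except at `ξ = 0`, and the measure gives no mass to `ξ = 0`. The absence of low frequencies
is assumed only at time zero. It persists because the average of `v` over a time `ħT` solves the
same equation, has conserved norm, and is nearly a Fourier multiplier that damps all but the low
frequencies (`low_frequency_le`). Hence all nonzero modes vanish over `Λ^⊥` at infinity, which is
the product structure (`eq_prod_of_fourier`).

The limit is a measure because it is positive (`re_sum_shiftForm_ge`, `ae_re_ge`). Freezing the
symbol on windows of `M × M` frequencies gives Toeplitz forms that inherit the positivity of the
symbol. The errors are `O(Mħ/ε)` and `O(1/M)`, and both vanish since `ħ/ε → 0`. General symbols are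
reduced to trigonometric polynomials in `x` by interpolation on a grid, and the measure comes from
the Riesz extension and representation theorems (`exists_measure`). -/

/-! ### Fourier modes on the torus -/

/-- The Fourier basis of `L²(𝕋²)`. -/
def modeBasis : HilbertBasis (Fin 2 → ℤ) ℂ L2 := UnitAddTorus.mFourierBasis

theorem modeBasis_apply (k : Fin 2 → ℤ) : modeBasis k = expMode k := by
  have := congrFun (UnitAddTorus.coe_mFourierBasis (d := Fin 2)) k
  exact this

instance : IsProbabilityMeasure torusMeasure := inferInstance

/-- The Fourier coefficient `⟨e_k, v⟩`. -/
def coef (v : L2) (k : Fin 2 → ℤ) : ℂ := inner ℂ (expMode k) v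

theorem modeBasis_repr (v : L2) (k : Fin 2 → ℤ) : modeBasis.repr v k = coef v k := by
  rw [HilbertBasis.repr_apply_apply, modeBasis_apply]; rfl

theorem norm_expMode (k : Fin 2 → ℤ) : ‖expMode k‖ = 1 := by
  rw [← modeBasis_apply]; exact modeBasis.orthonormal.1 k

/-- The Fourier coefficient as a continuous linear form. -/
def coefL (k : Fin 2 → ℤ) : L2 →L[ℂ] ℂ := innerSL ℂ (expMode k)

@[simp] theorem coefL_apply (k : Fin 2 → ℤ) (v : L2) : coefL k v = coef v k := rfl

theorem norm_coefL (k : Fin 2 → ℤ) : ‖coefL k‖ = 1 := by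
  rw [coefL, innerSL_apply_norm, norm_expMode]

theorem hasSum_coef_conj_mul (f g : L2) :
    HasSum (fun k => starRingEnd ℂ (coef f k) * coef g k) (inner ℂ f g) := by
  have h := modeBasis.hasSum_inner_mul_inner f g
  refine h.congr_fun fun k => ?_
  rw [modeBasis_apply, coef, coef, inner_conj_symm]

theorem hasSum_coef_sq (v : L2) : HasSum (fun k => ‖coef v k‖ ^ 2) (‖v‖ ^ 2) := by
  have h := RCLike.hasSum_re ℂ (hasSum_coef_conj_mul v v)
  rw [inner_self_eq_norm_sq] at h
  refine h.congr_fun fun k => ?_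
  rw [mul_comm, RCLike.mul_conj]
  norm_cast

theorem summable_coef_sq (v : L2) : Summable fun k => ‖coef v k‖ ^ 2 := (hasSum_coef_sq v).summable

theorem coef_eq_integral (v : L2) (k : Fin 2 → ℤ) :
    coef v k = ∫ x, v x * starRingEnd ℂ (UnitAddTorus.mFourier k x) ∂torusMeasure := by
  rw [coef, L2.inner_def]
  refine integral_congr_ae ?_
  filter_upwards [ContinuousMap.coeFn_toLp (p := 2) (𝕜 := ℂ) torusMeasure (UnitAddTorus.mFourier k)]
    with x hx
  rw [expMode, hx, RCLike.inner_apply]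

theorem latticeVec_inner (k : Fin 2 → ℤ) (y : Plane) :
    inner ℝ (latticeVec k) y = k 0 * y 0 + k 1 * y 1 := by
  simp [latticeVec, PiLp.inner_apply, Fin.sum_univ_two, mul_comm]

theorem mFourier_proj (k : Fin 2 → ℤ) (y : Plane) :
    UnitAddTorus.mFourier k (proj y)
      = Complex.exp (Complex.I * ((2 * Real.pi * inner ℝ (latticeVec k) y : ℝ) : ℂ)) := by
  rw [latticeVec_inner]
  simp only [UnitAddTorus.mFourier, proj, ContinuousMap.coe_mk, Fin.prod_univ_two,
    fourier_coe_apply, ← Complex.exp_add]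
  congr 1
  push_cast
  ring

theorem mFourier_add_apply (k : Fin 2 → ℤ) (x x' : Torus) :
    UnitAddTorus.mFourier k (x + x') = UnitAddTorus.mFourier k x * UnitAddTorus.mFourier k x' := by
  simp only [UnitAddTorus.mFourier, ContinuousMap.coe_mk, Fin.prod_univ_two, Pi.add_apply,
    fourier_apply, smul_add, AddCircle.toCircle_add, Circle.coe_mul]
  ring

theorem norm_mFourier_apply (k : Fin 2 → ℤ) (x : Torus) : ‖UnitAddTorus.mFourier k x‖ = 1 := by
  simp only [UnitAddTorus.mFourier, ContinuousMap.coe_mk, norm_prod, fourier_apply,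
    Circle.norm_coe, Finset.prod_const_one]

/-! ### Lifting from the torus to the plane. -/

theorem proj_surjective : Function.Surjective proj := by
  intro x
  choose y hy using fun i => QuotientAddGroup.mk_surjective (x i)
  exact ⟨WithLp.toLp 2 y, funext hy⟩

theorem proj_add (y z : Plane) : proj (y + z) = proj y + proj z := by
  ext i; simp [proj]

theorem proj_neg (y : Plane) : proj (-y) = -proj y := by
  ext i; simp [proj]

theorem proj_sub (y z : Plane) : proj (y - z) = proj y - proj z := by
  ext i; simp [proj]

theorem continuous_proj : Continuous proj := by
  unfold proj
  refine continuous_pi fun i => ?_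
  exact (AddCircle.continuous_mk' 1).comp (by fun_prop)

/-- Openness matters: the product of an open quotient map with the identity is again a quotient map,
so continuity on the phase space can also be checked on lifts. -/
theorem isOpenQuotientMap_proj : IsOpenQuotientMap proj := by
  have h : IsOpenQuotientMap (fun (y : Fin 2 → ℝ) (i : Fin 2) => (y i : UnitAddCircle)) :=
    IsOpenQuotientMap.piMap fun _ => QuotientAddGroup.isOpenQuotientMap_mk
  exact h.comp (PiLp.homeomorph 2 (fun _ : Fin 2 => ℝ)).isOpenQuotientMap

/-- Every point of the torus has a lift of norm at most `2`. -/
theorem exists_proj_eq_norm_le (x : Torus) : ∃ y : Plane, ‖y‖ ≤ 2 ∧ proj y = x := by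
  obtain ⟨y, rfl⟩ := proj_surjective x
  refine ⟨WithLp.toLp 2 fun i => Int.fract (y i), ?_, ?_⟩
  · rw [EuclideanSpace.norm_eq, Real.sqrt_le_left (by norm_num)]
    simp only [Fin.sum_univ_two, Real.norm_eq_abs, sq_abs]
    nlinarith [Int.fract_nonneg (y 0), Int.fract_nonneg (y 1), Int.fract_lt_one (y 0),
      Int.fract_lt_one (y 1)]
  · ext i
    simp only [proj, Int.fract]
    rw [AddCircle.coe_sub]
    have : ((⌊y i⌋ : ℝ) : UnitAddCircle) = 0 := by
      rw [AddCircle.coe_eq_zero_iff]; exact ⟨⌊y i⌋, by simp⟩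
    rw [this, sub_zero]

theorem norm_latticeVec_le (k : Fin 2 → ℤ) : ‖latticeVec k‖ ≤ 2 * ‖k‖ := by
  have h0 := norm_le_pi_norm k 0
  have h1 := norm_le_pi_norm k 1
  rw [EuclideanSpace.norm_eq, Real.sqrt_le_left (by positivity)]
  simp only [latticeVec, Fin.sum_univ_two, Real.norm_eq_abs, sq_abs]
  have e0 : ((k 0 : ℝ)) ^ 2 = ‖k 0‖ ^ 2 := by rw [Int.norm_eq_abs, sq_abs]
  have e1 : ((k 1 : ℝ)) ^ 2 = ‖k 1‖ ^ 2 := by rw [Int.norm_eq_abs, sq_abs]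
  rw [e0, e1]
  nlinarith [norm_nonneg (k 0), norm_nonneg (k 1), norm_nonneg k]

theorem latticeVec_add (k l : Fin 2 → ℤ) : latticeVec (k + l) = latticeVec k + latticeVec l := by
  ext i; simp [latticeVec]

theorem latticeVec_sub (k l : Fin 2 → ℤ) : latticeVec (k - l) = latticeVec k - latticeVec l := by
  ext i; simp [latticeVec]

/-! ### Derivatives of the Fourier modes -/

/-- The linear phase `y ↦ 2π k·y`. -/
def phaseL (k : Fin 2 → ℤ) : Plane →L[ℝ] ℝ := (2 * Real.pi) • innerSL ℝ (latticeVec k)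

theorem norm_phaseL_le (k : Fin 2 → ℤ) : ‖phaseL k‖ ≤ 4 * Real.pi * ‖k‖ := by
  rw [phaseL, norm_smul, innerSL_apply_norm, Real.norm_of_nonneg (by positivity)]
  nlinarith [norm_latticeVec_le k, Real.pi_pos]

theorem mFourier_comp_proj (k : Fin 2 → ℤ) :
    (fun y : Plane => UnitAddTorus.mFourier k (proj y))
      = (fun r : ℝ => Complex.exp (Complex.I * r)) ∘ phaseL k := by
  ext y
  rw [mFourier_proj]
  simp [phaseL]

theorem iteratedDeriv_cexp_I (n : ℕ) :
    iteratedDeriv n (fun r : ℝ => Complex.exp (Complex.I * r))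
      = fun r : ℝ => Complex.I ^ n * Complex.exp (Complex.I * r) := by
  induction n with
  | zero => simp
  | succ n ih =>
    rw [iteratedDeriv_succ, ih]
    ext r
    have h : HasDerivAt (fun r : ℝ => Complex.exp (Complex.I * r))
        (Complex.exp (Complex.I * r) * (Complex.I * 1)) r := by
      have h1 : HasDerivAt (fun r : ℝ => Complex.I * (r : ℂ)) (Complex.I * 1) r :=
        (Complex.ofRealCLM.hasDerivAt (x := r)).const_mul Complex.I
      exact h1.cexp
    rw [(h.const_mul _).deriv]
    ring

theorem contDiff_cexp_I : ContDiff ℝ ∞ (fun r : ℝ => Complex.exp (Complex.I * r)) :=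
  (contDiff_const.mul Complex.ofRealCLM.contDiff).cexp

theorem contDiff_mFourier_proj (k : Fin 2 → ℤ) :
    ContDiff ℝ ∞ (fun y : Plane => UnitAddTorus.mFourier k (proj y)) := by
  rw [mFourier_comp_proj]
  exact contDiff_cexp_I.comp (phaseL k).contDiff

theorem torusSmooth_mFourier (k : Fin 2 → ℤ) : TorusSmooth (UnitAddTorus.mFourier k) :=
  contDiff_mFourier_proj k

theorem norm_iteratedFDeriv_mFourier_le (k : Fin 2 → ℤ) (n : ℕ) (y : Plane) :
    ‖iteratedFDeriv ℝ n (fun y : Plane => UnitAddTorus.mFourier k (proj y)) y‖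
      ≤ (4 * Real.pi * ‖k‖) ^ n := by
  rw [mFourier_comp_proj, (phaseL k).iteratedFDeriv_comp_right contDiff_cexp_I y
    (by exact_mod_cast le_top)]
  refine (ContinuousMultilinearMap.norm_compContinuousLinearMap_le _ _).trans ?_
  rw [norm_iteratedFDeriv_eq_norm_iteratedDeriv, iteratedDeriv_cexp_I]
  simp only [norm_mul, norm_pow, Complex.norm_I, one_pow, one_mul, Finset.prod_const,
    Finset.card_univ, Fintype.card_fin]
  rw [mul_comm Complex.I, Complex.norm_exp_ofReal_mul_I, one_mul]
  exact pow_le_pow_left₀ (norm_nonneg _) (norm_phaseL_le k) n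

theorem natCast_le_infty (n : ℕ) : (n : WithTop ℕ∞) ≤ ∞ := by exact_mod_cast le_top

theorem two_le_infty : (2 : WithTop ℕ∞) ≤ ∞ := natCast_le_infty 2

theorem torusLaplacian_mFourier (k : Fin 2 → ℤ) (x : Torus) :
    torusLaplacian (UnitAddTorus.mFourier k) x
      = -((4 * Real.pi ^ 2 * ‖latticeVec k‖ ^ 2 : ℝ) : ℂ) * UnitAddTorus.mFourier k x := by
  have hfun : (fun y : Plane => UnitAddTorus.mFourier k (x + proj y))
      = UnitAddTorus.mFourier k x • (fun y : Plane => UnitAddTorus.mFourier k (proj y)) := by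
    ext y; simp [mFourier_add_apply]
  have hs : ContDiff ℝ 2 (fun y : Plane => UnitAddTorus.mFourier k (proj y)) :=
    (contDiff_mFourier_proj k).of_le two_le_infty
  rw [torusLaplacian, hfun]
  rw [InnerProductSpace.laplacian_eq_iteratedFDeriv_orthonormalBasis _
    (EuclideanSpace.basisFun (Fin 2) ℝ)]
  simp only [Fin.sum_univ_two]
  rw [iteratedFDeriv_const_smul_apply hs.contDiffAt]
  rw [mFourier_comp_proj, (phaseL k).iteratedFDeriv_comp_right contDiff_cexp_I 0
    two_le_infty]
  simp only [smul_apply,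
    ContinuousMultilinearMap.compContinuousLinearMap_apply, iteratedFDeriv_apply_eq_iteratedDeriv_mul_prod,
    iteratedDeriv_cexp_I, Fin.prod_univ_two]
  have hb : ∀ i, phaseL k (EuclideanSpace.basisFun (Fin 2) ℝ i) = 2 * Real.pi * k i := by
    intro i
    simp [phaseL, latticeVec, EuclideanSpace.basisFun_apply, EuclideanSpace.inner_single_right]
  have hn : ‖latticeVec k‖ ^ 2 = (k 0 : ℝ) ^ 2 + (k 1 : ℝ) ^ 2 := by
    rw [EuclideanSpace.norm_sq_eq]; simp [latticeVec, Fin.sum_univ_two]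
  rw [hn]
  have hb0 := hb 0
  have hb1 := hb 1
  simp only [Matrix.cons_val_zero, Matrix.cons_val_one, hb0, hb1, map_zero]
  simp
  ring

/-! ### Decay of Fourier coefficients -/

/-- The forward difference with step `h`. -/
def stepDiff {E F : Type*} [Add E] [Sub F] (h : E) (g : E → F) : E → F := fun y => g (y + h) - g y

/-- The mean value inequality trades each difference for one derivative and a factor `‖h‖`.
Differences replace integration by parts on the torus, since a translation acts on a Fourier
coefficient by a scalar. -/
theorem norm_iterate_stepDiff_le {E F : Type*} [NormedAddCommGroup E] [NormedSpace ℝ E]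
    [NormedAddCommGroup F] [NormedSpace ℝ F] (h : E) (n : ℕ) :
    ∀ (g : E → F) (M : ℝ), ContDiff ℝ ∞ g → (∀ y, ‖iteratedFDeriv ℝ n g y‖ ≤ M) →
      ∀ y, ‖((stepDiff h)^[n] g) y‖ ≤ M * ‖h‖ ^ n := by
  induction n with
  | zero => intro g M _ hM y; simpa using hM y
  | succ n ih =>
    intro g M hg hM y
    rw [Function.iterate_succ_apply]
    have hsh : ContDiff ℝ ∞ (fun y => g (y + h)) := hg.comp (contDiff_id.add contDiff_const)
    refine (ih (stepDiff h g) (M * ‖h‖) (hsh.sub hg) (fun y => ?_) y).trans_eq (by ring)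
    have hsub : iteratedFDeriv ℝ n (stepDiff h g) y
        = iteratedFDeriv ℝ n g (y + h) - iteratedFDeriv ℝ n g y := by
      have h1 : stepDiff h g = (fun y => g (y + h)) - g := rfl
      rw [h1, iteratedFDeriv_sub_apply (hsh.of_le (natCast_le_infty n)).contDiffAt
        (hg.of_le (natCast_le_infty n)).contDiffAt, iteratedFDeriv_comp_add_right]
    rw [hsub]
    have hd : Differentiable ℝ (iteratedFDeriv ℝ n g) :=
      hg.differentiable_iteratedFDeriv (by exact_mod_cast WithTop.coe_lt_top n)
    have := convex_univ.norm_image_sub_le_of_norm_fderiv_le (𝕜 := ℝ) (f := iteratedFDeriv ℝ n g)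
      (C := M) (fun x _ => hd x) (fun x _ => by rw [norm_fderiv_iteratedFDeriv]; exact hM x)
      (Set.mem_univ y) (Set.mem_univ (y + h))
    simpa using this

/-- The Fourier coefficient of a function on the torus. -/
def torusCoef (f : Torus → ℂ) (l : Fin 2 → ℤ) : ℂ :=
  ∫ x, UnitAddTorus.mFourier (-l) x * f x ∂torusMeasure

theorem integrable_of_continuous {f : Torus → ℂ} (hf : Continuous f) : Integrable f torusMeasure :=
  hf.integrable_of_hasCompactSupport (HasCompactSupport.of_compactSpace f)

theorem torusCoef_stepDiff {f : Torus → ℂ} (hf : Continuous f) (z : Torus) (l : Fin 2 → ℤ) :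
    torusCoef (stepDiff z f) l = (UnitAddTorus.mFourier l z - 1) * torusCoef f l := by
  have hc : ∀ l : Fin 2 → ℤ, Continuous (UnitAddTorus.mFourier l) := fun l => map_continuous _
  have h1 : ∫ x, UnitAddTorus.mFourier (-l) x * f (x + z) ∂torusMeasure
      = UnitAddTorus.mFourier l z * torusCoef f l := by
    have := integral_add_right_eq_self (μ := torusMeasure)
      (fun x => UnitAddTorus.mFourier (-l) (x - z) * f x) z
    simp only [add_sub_cancel_right] at this
    rw [this, torusCoef, ← integral_const_mul]
    congr 1
    ext x
    rw [sub_eq_add_neg, mFourier_add_apply]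
    have : UnitAddTorus.mFourier (-l) (-z) = UnitAddTorus.mFourier l z := by
      simp [UnitAddTorus.mFourier, fourier_apply]
    rw [this]; ring
  simp only [torusCoef, stepDiff, mul_sub] at h1 ⊢
  rw [integral_sub, h1]
  · ring
  · exact integrable_of_continuous ((hc _).mul (hf.comp (continuous_id.add continuous_const)))
  · exact integrable_of_continuous ((hc _).mul hf)

theorem continuous_stepDiff {f : Torus → ℂ} (hf : Continuous f) (z : Torus) :
    Continuous (stepDiff z f) :=
  (hf.comp (continuous_id.add continuous_const)).sub hf

theorem torusCoef_iterate_stepDiff (z : Torus) (l : Fin 2 → ℤ) (n : ℕ) :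
    ∀ f : Torus → ℂ, Continuous f →
      torusCoef ((stepDiff z)^[n] f) l = (UnitAddTorus.mFourier l z - 1) ^ n * torusCoef f l := by
  induction n with
  | zero => intro f _; simp
  | succ n ih =>
    intro f hf
    rw [Function.iterate_succ_apply, ih _ (continuous_stepDiff hf z), torusCoef_stepDiff hf]
    ring

theorem iterate_stepDiff_proj (h : Plane) (n : ℕ) : ∀ (f : Torus → ℂ) (y : Plane),
    ((stepDiff (proj h))^[n] f) (proj y) = ((stepDiff h)^[n] (fun y => f (proj y))) y := by
  induction n with
  | zero => intro f y; rfl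
  | succ n ih =>
    intro f y
    rw [Function.iterate_succ_apply, Function.iterate_succ_apply, ih]
    congr 2

theorem TorusSmooth.continuous {F : Type} [NormedAddCommGroup F] [NormedSpace ℝ F] {f : Torus → F}
    (hf : TorusSmooth f) : Continuous f :=
  isOpenQuotientMap_proj.isQuotientMap.continuous_iff.2 (ContDiff.continuous hf)

theorem norm_torusCoef_le {f : Torus → ℂ} {M : ℝ} (hM : ∀ x, ‖f x‖ ≤ M) (l : Fin 2 → ℤ) :
    ‖torusCoef f l‖ ≤ M := by
  refine (norm_integral_le_of_norm_le_const (C := M) (ae_of_all _ fun x => ?_)).trans_eq (by simp)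
  rw [norm_mul, norm_mFourier_apply, one_mul]
  exact hM x

/-- The step `h` is half a period of `e_l` along the largest coordinate of `l`. Thus `e_l(h) = -1`,
each difference multiplies the coefficient by `-2`, and it gains a factor `‖h‖ = 1/(2‖l‖)`. -/
theorem norm_torusCoef_mul_pow_le {f : Torus → ℂ} (hf : TorusSmooth f) {M : ℝ} (n : ℕ)
    (h0 : ∀ x, ‖f x‖ ≤ M)
    (hM : ∀ y, ‖iteratedFDeriv ℝ n (fun y : Plane => f (proj y)) y‖ ≤ M) (l : Fin 2 → ℤ) :
    ‖torusCoef f l‖ * (1 + ‖l‖) ^ n ≤ M * 2 ^ n := by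
  have hM0 : 0 ≤ M := (norm_nonneg _).trans (h0 0)
  rcases eq_or_ne l 0 with rfl | hl
  · simp only [norm_zero, add_zero, one_pow, mul_one]
    refine (norm_torusCoef_le h0 0).trans ?_
    exact le_mul_of_one_le_right hM0 (one_le_pow₀ one_le_two)
  obtain ⟨i, hi⟩ : ∃ i, ‖l‖ = ‖l i‖ := by
    rcases le_total ‖l 0‖ ‖l 1‖ with h | h
    · refine ⟨1, le_antisymm ((pi_norm_le_iff_of_nonneg (norm_nonneg _)).2 ?_) (norm_le_pi_norm l 1)⟩
      intro i; fin_cases i <;> simp [h]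
    · refine ⟨0, le_antisymm ((pi_norm_le_iff_of_nonneg (norm_nonneg _)).2 ?_) (norm_le_pi_norm l 0)⟩
      intro i; fin_cases i <;> simp [h]
  have hli : l i ≠ 0 := by
    intro h0; rw [h0, norm_zero, norm_eq_zero] at hi; exact hl hi
  have hl1 : 1 ≤ ‖l‖ := by
    rw [hi, Int.norm_eq_abs]; exact_mod_cast Int.one_le_abs hli
  have hlr : (l i : ℝ) ≠ 0 := by exact_mod_cast hli
  set h : Plane := EuclideanSpace.single i (1 / (2 * (l i : ℝ))) with hh
  have hnorm : ‖h‖ = 1 / (2 * ‖l‖) := by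
    rw [hh, PiLp.norm_single, norm_div, norm_mul, hi, Int.norm_eq_abs, Real.norm_eq_abs]
    simp
  have hmode : UnitAddTorus.mFourier l (proj h) = -1 := by
    rw [mFourier_proj]
    have : inner ℝ (latticeVec l) h = 1 / 2 := by
      rw [hh, EuclideanSpace.inner_single_right]
      simp [latticeVec]
      field_simp
    rw [this, ← Complex.exp_pi_mul_I]
    congr 1
    push_cast
    ring
  have key := torusCoef_iterate_stepDiff (proj h) l n f hf.continuous
  have hb : ‖torusCoef ((stepDiff (proj h))^[n] f) l‖ ≤ M * ‖h‖ ^ n := by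
    refine norm_torusCoef_le (fun x => ?_) l
    obtain ⟨y, rfl⟩ := proj_surjective x
    rw [iterate_stepDiff_proj]
    exact norm_iterate_stepDiff_le h n _ M hf hM y
  rw [key, hmode, norm_mul, norm_pow, hnorm] at hb
  have h2 : ‖(-1 - 1 : ℂ)‖ = 2 := by norm_num
  rw [h2] at hb
  have hl0 : 0 < ‖l‖ := by linarith
  rw [div_pow, one_pow, mul_one_div, le_div_iff₀ (by positivity)] at hb
  calc ‖torusCoef f l‖ * (1 + ‖l‖) ^ n ≤ ‖torusCoef f l‖ * (2 * ‖l‖) ^ n := by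
        gcongr; linarith
    _ ≤ 2 ^ n * (‖torusCoef f l‖ * (2 * ‖l‖) ^ n) :=
        le_mul_of_one_le_left (by positivity) (one_le_pow₀ one_le_two)
    _ = 2 ^ n * ‖torusCoef f l‖ * (2 * ‖l‖) ^ n := by ring
    _ ≤ M := hb
    _ ≤ M * 2 ^ n := le_mul_of_one_le_right hM0 (one_le_pow₀ one_le_two)

theorem summable_one_add_norm_inv : Summable fun l : Fin 2 → ℤ => ((1 + ‖l‖) ^ 3)⁻¹ := by
  have h := EisensteinSeries.summable_one_div_norm_rpow (k := 3) (by norm_num)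
  refine Summable.of_norm_bounded_eventually h ?_
  have hfin : {l : Fin 2 → ℤ | l ≠ 0}ᶜ.Finite := by
    convert Set.finite_singleton (0 : Fin 2 → ℤ) using 1
    ext; simp
  filter_upwards [show {l : Fin 2 → ℤ | l ≠ 0} ∈ cofinite from hfin] with l hl
  have hl0 : 0 < ‖l‖ := norm_pos_iff.2 hl
  rw [Real.rpow_neg hl0.le, norm_inv, Real.norm_of_nonneg (by positivity)]
  norm_cast
  gcongr
  linarith

theorem torusSmooth_bounded {f : Torus → ℂ} (hf : TorusSmooth f) (n : ℕ) :
    ∃ M : ℝ, (∀ x, ‖f x‖ ≤ M) ∧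
      ∀ y, ‖iteratedFDeriv ℝ n (fun y : Plane => f (proj y)) y‖ ≤ M := by
  have hc : Continuous (fun y => iteratedFDeriv ℝ n (fun y : Plane => f (proj y)) y) :=
    ContDiff.continuous_iteratedFDeriv (natCast_le_infty n) hf
  obtain ⟨M, hM⟩ := (isCompact_closedBall (0 : Plane) 2).exists_bound_of_continuousOn
    hc.continuousOn
  obtain ⟨M', hM'⟩ := isCompact_univ.exists_bound_of_continuousOn hf.continuous.continuousOn
  refine ⟨max M M', fun x => (hM' x (Set.mem_univ _)).trans (le_max_right _ _), fun y => ?_⟩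
  refine le_trans ?_ (le_max_left _ _)
  obtain ⟨z, hz, hzy⟩ := exists_proj_eq_norm_le (proj y)
  have hper : (fun y' : Plane => f (proj (y' + (z - y)))) = fun y' => f (proj y') := by
    ext y'
    rw [proj_add, proj_sub, hzy, sub_self, add_zero]
  have h1 := iteratedFDeriv_comp_add_right (𝕜 := ℝ) (f := fun y : Plane => f (proj y)) n (z - y) y
  rw [hper, add_sub_cancel] at h1
  rw [h1]
  exact hM z (by simpa using hz)

/-- The Fourier series of a smooth function on the torus converges, with rapidly decaying
coefficients. -/
theorem TorusSmooth.summable_torusCoef {f : Torus → ℂ} (hf : TorusSmooth f) :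
    Summable fun l => ‖torusCoef f l‖ * (1 + ‖l‖) := by
  -- One derivative pays for the weight `1 + ‖l‖`, three for summability over a lattice of rank two.
  obtain ⟨M, h0, hM⟩ := torusSmooth_bounded hf 4
  refine Summable.of_nonneg_of_le (fun l => by positivity) (fun l => ?_)
    (summable_one_add_norm_inv.mul_left (M * 2 ^ 4))
  have := norm_torusCoef_mul_pow_le hf 4 h0 hM l
  rw [← div_eq_mul_inv, le_div_iff₀ (by positivity)]
  calc _ = ‖torusCoef f l‖ * (1 + ‖l‖) ^ 4 := by ring
    _ ≤ _ := this

theorem hasSum_torusCoef {f : Torus → ℂ} (hf : Continuous f) (hs : Summable (torusCoef f)) :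
    HasSum (fun l => torusCoef f l • UnitAddTorus.mFourier l) (ContinuousMap.mk f hf) :=
  UnitAddTorus.hasSum_mFourier_series_of_summable (f := ContinuousMap.mk f hf) hs

/-! ### Shifted quadratic forms in the Fourier coefficients -/

/-- The form `∑ⱼ conj(v_{j+p}) βⱼ v_{j+q}` in the Fourier coefficients of `v`. -/
def shiftForm (p q : Fin 2 → ℤ) (β : (Fin 2 → ℤ) → ℂ) (v : L2) : ℂ :=
  ∑' j, starRingEnd ℂ (coef v (j + p)) * β j * coef v (j + q)

theorem hasSum_coef_add_sq (v : L2) (p : Fin 2 → ℤ) :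
    HasSum (fun j => ‖coef v (j + p)‖ ^ 2) (‖v‖ ^ 2) :=
  (Equiv.addRight p).hasSum_iff (f := fun j => ‖coef v j‖ ^ 2) |>.2 (hasSum_coef_sq v)

theorem norm_shiftForm_term_le {β : (Fin 2 → ℤ) → ℂ} {M : ℝ} (hβ : ∀ j, ‖β j‖ ≤ M) (v : L2)
    (p q j : Fin 2 → ℤ) :
    ‖starRingEnd ℂ (coef v (j + p)) * β j * coef v (j + q)‖
      ≤ M / 2 * (‖coef v (j + p)‖ ^ 2 + ‖coef v (j + q)‖ ^ 2) := by
  rw [norm_mul, norm_mul, RCLike.norm_conj]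
  have hM : 0 ≤ M := (norm_nonneg _).trans (hβ 0)
  have h2 := two_mul_le_add_sq ‖coef v (j + p)‖ ‖coef v (j + q)‖
  calc ‖coef v (j + p)‖ * ‖β j‖ * ‖coef v (j + q)‖
      ≤ ‖coef v (j + p)‖ * M * ‖coef v (j + q)‖ := by gcongr; exact hβ j
    _ = M / 2 * (2 * ‖coef v (j + p)‖ * ‖coef v (j + q)‖) := by ring
    _ ≤ _ := by gcongr

theorem summable_norm_shiftForm {β : (Fin 2 → ℤ) → ℂ} {M : ℝ} (hβ : ∀ j, ‖β j‖ ≤ M) (v : L2)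
    (p q : Fin 2 → ℤ) :
    Summable fun j => ‖starRingEnd ℂ (coef v (j + p)) * β j * coef v (j + q)‖ :=
  Summable.of_nonneg_of_le (fun _ => norm_nonneg _) (norm_shiftForm_term_le hβ v p q)
    (((hasSum_coef_add_sq v p).summable.add (hasSum_coef_add_sq v q).summable).mul_left _)

theorem summable_shiftForm {β : (Fin 2 → ℤ) → ℂ} {M : ℝ} (hβ : ∀ j, ‖β j‖ ≤ M) (v : L2)
    (p q : Fin 2 → ℤ) :
    Summable fun j => starRingEnd ℂ (coef v (j + p)) * β j * coef v (j + q) :=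
  (summable_norm_shiftForm hβ v p q).of_norm

theorem tsum_norm_shiftForm_le {β : (Fin 2 → ℤ) → ℂ} {M : ℝ} (hβ : ∀ j, ‖β j‖ ≤ M) (v : L2)
    (p q : Fin 2 → ℤ) :
    ∑' j, ‖starRingEnd ℂ (coef v (j + p)) * β j * coef v (j + q)‖ ≤ M * ‖v‖ ^ 2 := by
  have h := ((hasSum_coef_add_sq v p).add (hasSum_coef_add_sq v q)).mul_left (M / 2)
  refine ((summable_norm_shiftForm hβ v p q).tsum_le_tsum (norm_shiftForm_term_le hβ v p q)
    h.summable).trans_eq ?_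
  rw [h.tsum_eq]
  ring

theorem norm_shiftForm_le {β : (Fin 2 → ℤ) → ℂ} {M : ℝ} (hβ : ∀ j, ‖β j‖ ≤ M) (v : L2)
    (p q : Fin 2 → ℤ) : ‖shiftForm p q β v‖ ≤ M * ‖v‖ ^ 2 :=
  (norm_tsum_le_tsum_norm (summable_norm_shiftForm hβ v p q)).trans (tsum_norm_shiftForm_le hβ v p q)

theorem shiftForm_sub {β γ : (Fin 2 → ℤ) → ℂ} {M N : ℝ} (hβ : ∀ j, ‖β j‖ ≤ M)
    (hγ : ∀ j, ‖γ j‖ ≤ N) (v : L2) (p q : Fin 2 → ℤ) :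
    shiftForm p q (fun j => β j - γ j) v = shiftForm p q β v - shiftForm p q γ v := by
  rw [shiftForm, shiftForm, shiftForm,
    ← (summable_shiftForm hβ v p q).tsum_sub (summable_shiftForm hγ v p q)]
  congr 1; ext j; ring

/-- Reindexing by `j ↦ j + r`. This turns the commutator with the potential into differences of `β`,
and lets the windows be compared with the original form. -/
theorem shiftForm_translate (p q r : Fin 2 → ℤ) (β : (Fin 2 → ℤ) → ℂ) (v : L2) :
    shiftForm (p + r) (q + r) β v = shiftForm p q (fun j => β (j - r)) v := by
  rw [shiftForm, shiftForm, ← (Equiv.addRight r).tsum_eq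
    (fun j => starRingEnd ℂ (coef v (j + p)) * β (j - r) * coef v (j + q))]
  congr 1
  ext j
  rw [Equiv.coe_addRight, add_sub_cancel_right, add_right_comm j r p, add_right_comm j r q,
    add_assoc j p r, add_assoc j q r]

theorem shiftForm_const_mul (p q : Fin 2 → ℤ) (β : (Fin 2 → ℤ) → ℂ) (v : L2) (a : ℂ) :
    shiftForm p q (fun j => a * β j) v = a * shiftForm p q β v := by
  rw [shiftForm, shiftForm, ← tsum_mul_left]
  congr 1; ext j; ring

theorem shiftForm_eq_sum {β : (Fin 2 → ℤ) → ℂ} (hβ : (Function.support β).Finite)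
    (p q : Fin 2 → ℤ) (v : L2) :
    shiftForm p q β v
      = ∑ j ∈ hβ.toFinset, starRingEnd ℂ (coef v (j + p)) * β j * coef v (j + q) :=
  tsum_eq_sum fun j hj => by
    have : β j = 0 := by simpa using hj
    simp [this]

theorem exists_bound_of_finite_support {β : (Fin 2 → ℤ) → ℂ} (hβ : (Function.support β).Finite) :
    ∃ M, ∀ j, ‖β j‖ ≤ M := by
  refine ⟨∑ j ∈ hβ.toFinset, ‖β j‖, fun j => ?_⟩
  by_cases h : β j = 0
  · rw [h, norm_zero]; positivity
  · exact Finset.single_le_sum (f := fun j => ‖β j‖) (fun _ _ => norm_nonneg _) (by simpa using h)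

theorem continuous_coef (j : Fin 2 → ℤ) : Continuous fun v : L2 => coef v j := (coefL j).continuous

theorem continuous_shiftForm {β : (Fin 2 → ℤ) → ℂ} (hβ : (Function.support β).Finite)
    (p q : Fin 2 → ℤ) : Continuous (shiftForm p q β) := by
  have : shiftForm p q β = fun v => ∑ j ∈ hβ.toFinset,
      starRingEnd ℂ (coef v (j + p)) * β j * coef v (j + q) :=
    funext fun v => shiftForm_eq_sum hβ p q v
  rw [this]
  refine continuous_finsetSum _ fun j _ => ?_
  exact ((RCLike.continuous_conj.comp (continuous_coef _)).mul continuous_const).mul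
    (continuous_coef _)

/-! ### The Schrödinger equation in Fourier coefficients -/

/-- The `j`-th Fourier coefficient of the product of `v` with the function of Fourier
coefficients `w`. -/
def potCoef (w : (Fin 2 → ℤ) → ℂ) (j : Fin 2 → ℤ) : L2 →L[ℂ] ℂ := ∑' l, w l • coefL (j - l)

theorem summable_potCoef {w : (Fin 2 → ℤ) → ℂ} (hw : Summable fun l => ‖w l‖) (j : Fin 2 → ℤ) :
    Summable fun l => w l • coefL (j - l) := by
  refine Summable.of_norm ?_
  simpa [norm_smul, norm_coefL] using hw

theorem hasSum_potCoef {w : (Fin 2 → ℤ) → ℂ} (hw : Summable fun l => ‖w l‖) (j : Fin 2 → ℤ)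
    (v : L2) : HasSum (fun l => w l * coef v (j - l)) (potCoef w j v) := by
  have h := (summable_potCoef hw j).hasSum.mapL (ContinuousLinearMap.apply ℂ ℂ v)
  simpa [potCoef] using h

/-- Half the eigenvalue of `-ħ²Δ` on `e_j`. -/
def kinetic (ħ : ℝ) (j : Fin 2 → ℤ) : ℝ := 2 * Real.pi ^ 2 * ħ ^ 2 * ‖latticeVec j‖ ^ 2

/-- The Schrödinger equation in Fourier coefficients, for a potential with Fourier
coefficients `w`. -/
structure IsModeSolution (w : (Fin 2 → ℤ) → ℂ) (ħ ε : ℝ) (v : ℝ → L2) : Prop where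
  continuous : Continuous v
  hasDerivAt : ∀ (j : Fin 2 → ℤ) (t : ℝ), HasDerivAt (fun s => coef (v s) j)
    (-(Complex.I / ħ) * (kinetic ħ j * coef (v t) j + (ε : ℂ) ^ 2 * potCoef w j (v t))) t

/-- The quadratic form of the commutator with the potential. -/
def commForm (w : (Fin 2 → ℤ) → ℂ) (k : Fin 2 → ℤ) (β : (Fin 2 → ℤ) → ℂ) (v : L2) : ℂ :=
  ∑' j, β j * (starRingEnd ℂ (coef v (j + k)) * potCoef w j v
    - starRingEnd ℂ (potCoef w (j + k) v) * coef v j)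

/-- Expanding the potential in Fourier modes, the two halves of the commutator become the same form
up to a translation by `l`, so that only `β j - β (j - l)` survives. Since the potential is real,
both halves carry the same coefficient `w l`. The finite support of `β` makes the exchange of sums
elementary. -/
theorem commForm_eq_tsum {w : (Fin 2 → ℤ) → ℂ} (hw : Summable fun l => ‖w l‖)
    (hconj : ∀ l, w (-l) = starRingEnd ℂ (w l)) (k : Fin 2 → ℤ) {β : (Fin 2 → ℤ) → ℂ}
    (hβ : (Function.support β).Finite) (v : L2) :
    HasSum (fun l => w l * shiftForm k (-l) (fun j => β j - β (j - l)) v) (commForm w k β v) := by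
  obtain ⟨M, hM⟩ := exists_bound_of_finite_support hβ
  have h1 : ∀ j, HasSum (fun l => β j * (starRingEnd ℂ (coef v (j + k)) * (w l * coef v (j - l))
      - w l * starRingEnd ℂ (coef v (j + k + l)) * coef v j))
      (β j * (starRingEnd ℂ (coef v (j + k)) * potCoef w j v
        - starRingEnd ℂ (potCoef w (j + k) v) * coef v j)) := by
    intro j
    have ha := (hasSum_potCoef hw j v).mul_left (starRingEnd ℂ (coef v (j + k)))
    have hb := ((Equiv.neg _).hasSum_iff.2 (hasSum_potCoef hw (j + k) v)).map
      (starRingEnd ℂ) RCLike.continuous_conj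
    have hb' : HasSum (fun l => w l * starRingEnd ℂ (coef v (j + k + l)))
        (starRingEnd ℂ (potCoef w (j + k) v)) := by
      refine hb.congr_fun fun l => ?_
      simp [hconj]
    exact (ha.sub (hb'.mul_right _)).mul_left _
  have h2 := hasSum_sum (s := hβ.toFinset) fun j _ => h1 j
  have h3 : ∑ j ∈ hβ.toFinset, (β j * (starRingEnd ℂ (coef v (j + k)) * potCoef w j v
        - starRingEnd ℂ (potCoef w (j + k) v) * coef v j)) = commForm w k β v := by
    refine (tsum_eq_sum fun j hj => ?_).symm
    have : β j = 0 := by simpa using hj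
    simp [this]
  rw [h3] at h2
  refine h2.congr_fun fun l => ?_
  have hs := shiftForm_sub (γ := fun j => β (j - l)) hM (fun j => hM (j - l)) v k (-l)
  have ht := shiftForm_translate k (-l) l β v
  rw [neg_add_cancel] at ht
  rw [hs, ← ht, shiftForm_eq_sum hβ, shiftForm_eq_sum hβ, ← Finset.sum_sub_distrib,
    Finset.mul_sum]
  refine Finset.sum_congr rfl fun j _ => ?_
  rw [← sub_eq_add_neg, add_zero, ← add_assoc]
  ring

/-- A slowly varying `β` almost commutes with the potential. The factor `‖l‖` lost in the Lipschitz
bound is absorbed by the weighted summability of `w`. -/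
theorem norm_commForm_le {w : (Fin 2 → ℤ) → ℂ} (hw : Summable fun l => ‖w l‖ * (1 + ‖l‖))
    (hconj : ∀ l, w (-l) = starRingEnd ℂ (w l)) (k : Fin 2 → ℤ) {β : (Fin 2 → ℤ) → ℂ}
    (hβ : (Function.support β).Finite) {Λ : ℝ} (hΛ : ∀ j l, ‖β j - β (j - l)‖ ≤ Λ * ‖l‖) (v : L2) :
    ‖commForm w k β v‖ ≤ Λ * (∑' l, ‖w l‖ * (1 + ‖l‖)) * ‖v‖ ^ 2 := by
  have hw' : Summable fun l => ‖w l‖ :=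
    Summable.of_nonneg_of_le (fun _ => norm_nonneg _)
      (fun l => le_mul_of_one_le_right (norm_nonneg _) (by linarith [norm_nonneg l])) hw
  have hΛ0 : 0 ≤ Λ := by
    have h := (norm_nonneg _).trans (hΛ 0 1)
    have h1 : ‖(1 : Fin 2 → ℤ)‖ = 1 := by simp
    rwa [h1, mul_one] at h
  have h := commForm_eq_tsum hw' hconj k hβ v
  rw [← h.tsum_eq]
  have hb : ∀ l, ‖w l * shiftForm k (-l) (fun j => β j - β (j - l)) v‖
      ≤ Λ * ‖v‖ ^ 2 * (‖w l‖ * (1 + ‖l‖)) := by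
    intro l
    rw [norm_mul]
    have := norm_shiftForm_le (fun j => hΛ j l) v k (-l)
    calc _ ≤ ‖w l‖ * (Λ * ‖l‖ * ‖v‖ ^ 2) := by gcongr
      _ ≤ ‖w l‖ * (Λ * (1 + ‖l‖) * ‖v‖ ^ 2) := by gcongr; linarith
      _ = _ := by ring
  refine (tsum_of_norm_bounded (hw.mul_left (Λ * ‖v‖ ^ 2)).hasSum hb).trans_eq ?_
  rw [tsum_mul_left]; ring

/-- The equation is known only mode by mode, but a finitely supported form is a finite sum of
products of coefficients and can be differentiated term by term. -/
theorem IsModeSolution.hasDerivAt_shiftForm {w : (Fin 2 → ℤ) → ℂ} {ħ ε : ℝ} {v : ℝ → L2}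
    (hv : IsModeSolution w ħ ε v) (k : Fin 2 → ℤ) {β : (Fin 2 → ℤ) → ℂ}
    (hβ : (Function.support β).Finite) (t : ℝ) :
    HasDerivAt (fun s => shiftForm k 0 β (v s))
      (-(Complex.I / ħ) * (shiftForm k 0
          (fun j => ((kinetic ħ j - kinetic ħ (j + k) : ℝ) : ℂ) * β j) (v t)
        + (ε : ℂ) ^ 2 * commForm w k β (v t))) t := by
  have hF : (fun s => shiftForm k 0 β (v s)) = fun s => ∑ j ∈ hβ.toFinset,
      starRingEnd ℂ (coef (v s) (j + k)) * β j * coef (v s) j := by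
    ext s; rw [shiftForm_eq_sum hβ]; simp
  rw [hF]
  have hd : ∀ j, HasDerivAt (fun s => starRingEnd ℂ (coef (v s) (j + k)) * β j * coef (v s) j) _ t :=
    fun j => (((hv.hasDerivAt (j + k) t).star).mul_const (β j)).mul (hv.hasDerivAt j t)
  refine (HasDerivAt.fun_sum fun j _ => hd j).congr_deriv ?_
  have h1 : shiftForm k 0 (fun j => ((kinetic ħ j - kinetic ħ (j + k) : ℝ) : ℂ) * β j) (v t)
      = ∑ j ∈ hβ.toFinset, starRingEnd ℂ (coef (v t) (j + k)) *
        (((kinetic ħ j - kinetic ħ (j + k) : ℝ) : ℂ) * β j) * coef (v t) j := by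
    rw [shiftForm, tsum_eq_sum (s := hβ.toFinset)]
    · simp
    · intro j hj
      have : β j = 0 := by simpa using hj
      simp [this]
  have h2 : commForm w k β (v t) = ∑ j ∈ hβ.toFinset, β j * (starRingEnd ℂ (coef (v t) (j + k))
      * potCoef w j (v t) - starRingEnd ℂ (potCoef w (j + k) (v t)) * coef (v t) j) := by
    refine tsum_eq_sum fun j hj => ?_
    have : β j = 0 := by simpa using hj
    simp [this]
  rw [h1, h2, Finset.mul_sum, ← Finset.sum_add_distrib, Finset.mul_sum]
  refine Finset.sum_congr rfl fun j _ => ?_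
  simp only [Complex.star_def, map_mul, map_neg, map_div₀, Complex.conj_I, Complex.conj_ofReal,
    map_add, map_pow]
  push_cast
  ring

/-! ### Conservation of the norm -/

/-- The tent function of height `1` and width `N` in frequency. -/
def tent (N : ℝ) (j : Fin 2 → ℤ) : ℝ := max 0 (1 - ‖j‖ / N)

theorem finite_support_of_bounded {β : (Fin 2 → ℤ) → ℂ} {N : ℝ} (h : ∀ j, N ≤ ‖j‖ → β j = 0) :
    (Function.support β).Finite := by
  have hfin : (Metric.closedBall (0 : Fin 2 → ℤ) N).Finite :=
    (isCompact_closedBall _ _).finite_of_discrete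
  refine hfin.subset fun j hj => ?_
  simp only [Metric.mem_closedBall, dist_zero_right]
  by_contra hc
  exact hj (h j (not_le.1 hc).le)

/-- The norm cannot be differentiated directly, as `v` need not lie in the domain of the Laplacian.
The mass truncated by a tent of width `N` can: for `k = 0` the kinetic terms cancel, and the
commutator is `O(1/N)` because the tent is `1/N`-Lipschitz. Letting `N → ∞` gives conservation. -/
theorem IsModeSolution.norm_eq {w : (Fin 2 → ℤ) → ℂ} (hw : Summable fun l => ‖w l‖ * (1 + ‖l‖))
    (hconj : ∀ l, w (-l) = starRingEnd ℂ (w l)) {ħ ε : ℝ} {v : ℝ → L2}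
    (hv : IsModeSolution w ħ ε v) (t : ℝ) : ‖v t‖ = ‖v 0‖ := by
  -- Continuity is the only a priori bound on the norm, hence a bound on the compact interval
  -- between `0` and `t`. It depends on `t` but not on `N`, which is enough.
  obtain ⟨C, hC⟩ := (isCompact_uIcc (a := 0) (b := t)).exists_bound_of_continuousOn
    hv.continuous.continuousOn
  set S := ∑' l, ‖w l‖ * (1 + ‖l‖) with hS
  have hS0 : 0 ≤ S := tsum_nonneg fun l => by positivity
  set K : ℝ := ‖(Complex.I / ħ : ℂ)‖ * (‖(ε : ℂ) ^ 2‖ * (S * C ^ 2)) with hK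
  have hsupp : ∀ N : ℝ, 0 < N → (Function.support fun j => (tent N j : ℂ)).Finite := by
    intro N hN
    refine finite_support_of_bounded (N := N) fun j hj => ?_
    have : 1 - ‖j‖ / N ≤ 0 := by
      rw [sub_nonpos, le_div_iff₀ hN]; linarith
    simp [tent, this]
  have hlip : ∀ N : ℝ, 0 < N → ∀ j l : Fin 2 → ℤ,
      ‖(tent N j : ℂ) - (tent N (j - l) : ℂ)‖ ≤ 1 / N * ‖l‖ := by
    intro N hN j l
    rw [← Complex.ofReal_sub, Complex.norm_real, Real.norm_eq_abs]
    have h1 : |tent N j - tent N (j - l)| ≤ |(1 - ‖j‖ / N) - (1 - ‖j - l‖ / N)| := by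
      unfold tent
      rw [max_comm 0, max_comm 0]
      exact abs_max_sub_max_le_abs _ _ _
    refine h1.trans ?_
    have : (1 - ‖j‖ / N) - (1 - ‖j - l‖ / N) = (‖j - l‖ - ‖j‖) / N := by ring
    rw [this, abs_div, abs_of_pos hN, div_eq_inv_mul, one_div]
    gcongr
    have := abs_norm_sub_norm_le (j - l) j
    simpa using this
  have hmain : ∀ N : ℝ, 0 < N →
      ‖shiftForm 0 0 (fun j => (tent N j : ℂ)) (v t) - shiftForm 0 0 (fun j => (tent N j : ℂ)) (v 0)‖
        ≤ K / N * |t| := by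
    intro N hN
    have hd := fun s => hv.hasDerivAt_shiftForm 0 (hsupp N hN) s
    have := (convex_uIcc 0 t).norm_image_sub_le_of_norm_hasDerivWithin_le (C := K / N)
      (fun s _ => (hd s).hasDerivWithinAt) (fun s hs => ?_) Set.left_mem_uIcc Set.right_mem_uIcc
    · simpa using this
    · have hz : shiftForm 0 0 (fun j => ((kinetic ħ j - kinetic ħ (j + 0) : ℝ) : ℂ) * (tent N j : ℂ))
          (v s) = 0 := by simp [shiftForm]
      rw [hz, zero_add, norm_mul, norm_neg, norm_mul]
      have h1 := norm_commForm_le hw hconj 0 (hsupp N hN) (hlip N hN) (v s)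
      have h2 : ‖commForm w 0 (fun j => (tent N j : ℂ)) (v s)‖ ≤ 1 / N * S * C ^ 2 := by
        refine h1.trans ?_
        have := hC s hs
        gcongr
      calc _ ≤ ‖(Complex.I / ħ : ℂ)‖ * (‖(ε : ℂ) ^ 2‖ * (1 / N * S * C ^ 2)) := by gcongr
        _ = K / N := by rw [hK]; ring
  have hlim : ∀ u : L2, Tendsto (fun N : ℝ => shiftForm 0 0 (fun j => (tent N j : ℂ)) u) atTop
      (𝓝 ((‖u‖ ^ 2 : ℝ) : ℂ)) := by
    intro u
    have hsum : ((‖u‖ ^ 2 : ℝ) : ℂ) = ∑' j, starRingEnd ℂ (coef u (j + 0)) * 1 * coef u (j + 0) := by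
      rw [← (hasSum_coef_sq u).tsum_eq, Complex.ofReal_tsum]
      congr 1; ext j
      rw [mul_one, RCLike.conj_mul]; simp
    rw [hsum]
    refine tendsto_tsum_of_dominated_convergence (bound := fun j => ‖coef u j‖ ^ 2)
      (summable_coef_sq u) (fun j => ?_) ?_
    · refine (tendsto_const_nhds.mul ?_).mul tendsto_const_nhds
      have h1 : Tendsto (fun N : ℝ => max 0 (1 - ‖j‖ / N)) atTop (𝓝 (max 0 (1 - 0))) :=
        tendsto_const_nhds.max (tendsto_const_nhds.sub (tendsto_const_nhds.div_atTop tendsto_id))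
      rw [sub_zero, max_eq_right zero_le_one] at h1
      have h2 := (Complex.continuous_ofReal.tendsto 1).comp h1
      simpa [tent, Function.comp_def] using h2
    · filter_upwards [eventually_gt_atTop 0] with N hN j
      rw [norm_mul, norm_mul, RCLike.norm_conj, add_zero, Complex.norm_real,
        Real.norm_of_nonneg (show 0 ≤ tent N j from le_max_left _ _), sq]
      have : tent N j ≤ 1 := max_le zero_le_one (by
        have : 0 ≤ ‖j‖ / N := by positivity
        linarith)
      calc _ ≤ ‖coef u j‖ * 1 * ‖coef u j‖ := by gcongr
        _ = _ := by ring
  have hle := le_of_tendsto_of_tendsto ((hlim (v t)).sub (hlim (v 0))).norm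
    ((tendsto_const_nhds (x := K)).div_atTop tendsto_id |>.mul_const |t|)
    ((eventually_gt_atTop 0).mono hmain)
  rw [zero_mul, norm_le_zero_iff, sub_eq_zero] at hle
  have h2 : ‖v t‖ ^ 2 = ‖v 0‖ ^ 2 := by exact_mod_cast hle
  exact (sq_eq_sq₀ (norm_nonneg _) (norm_nonneg _)).1 h2

/-! ### From the weak Schrödinger equation to the equation for Fourier coefficients -/

theorem torusCoef_conj (V : Torus → ℝ) (l : Fin 2 → ℤ) :
    torusCoef (fun x => (V x : ℂ)) (-l) = starRingEnd ℂ (torusCoef (fun x => (V x : ℂ)) l) := by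
  rw [torusCoef, torusCoef, ← integral_conj]
  congr 1
  ext x
  rw [map_mul, UnitAddTorus.mFourier_neg, UnitAddTorus.mFourier_neg, Complex.conj_conj,
    Complex.conj_ofReal]

theorem TorusSmooth.ofReal {V : Torus → ℝ} (hV : TorusSmooth V) :
    TorusSmooth (fun x => (V x : ℂ)) :=
  Complex.ofRealCLM.contDiff.comp hV

theorem summable_norm_of_weighted {w : (Fin 2 → ℤ) → ℂ}
    (hw : Summable fun l => ‖w l‖ * (1 + ‖l‖)) : Summable fun l => ‖w l‖ :=
  Summable.of_nonneg_of_le (fun _ => norm_nonneg _)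
    (fun l => le_mul_of_one_le_right (norm_nonneg _) (by linarith [norm_nonneg l])) hw

/-- Multiplication becomes convolution: the Fourier series of `V` converges uniformly, so it can be
integrated term by term against `v`. -/
theorem integral_potential_mul {V : Torus → ℝ} (hV : TorusSmooth V) (v : L2) (j : Fin 2 → ℤ) :
    ∫ x, v x * starRingEnd ℂ ((V x : ℂ) * UnitAddTorus.mFourier j x) ∂torusMeasure
      = potCoef (torusCoef fun x => (V x : ℂ)) j v := by
  set w := torusCoef fun x => (V x : ℂ) with hw
  have hsw : Summable fun l => ‖w l‖ := summable_norm_of_weighted hV.ofReal.summable_torusCoef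
  have h1 := (hasSum_torusCoef hV.ofReal.continuous hsw.of_norm).mul_right (UnitAddTorus.mFourier j)
  have h2 := h1.mapL (ContinuousMap.toLp (E := ℂ) 2 torusMeasure ℂ)
  have h3 := (h2.map (innerSL ℂ v) (innerSL ℂ v).continuous).map (starRingEnd ℂ)
    RCLike.continuous_conj
  -- The conjugation turns `w l` into `w (-l)`; changing `l` into `-l` restores the convolution.
  have h4 := (Equiv.neg (Fin 2 → ℤ)).hasSum_iff.2 h3
  have h5 : (starRingEnd ℂ) (innerSL ℂ v ((ContinuousMap.toLp (E := ℂ) 2 torusMeasure ℂ)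
      (ContinuousMap.mk _ hV.ofReal.continuous * UnitAddTorus.mFourier j)))
      = ∫ x, v x * starRingEnd ℂ ((V x : ℂ) * UnitAddTorus.mFourier j x) ∂torusMeasure := by
    rw [innerSL_apply_apply, inner_conj_symm, L2.inner_def]
    refine integral_congr_ae ?_
    filter_upwards [ContinuousMap.coeFn_toLp (p := 2) (𝕜 := ℂ) torusMeasure
      (ContinuousMap.mk _ hV.ofReal.continuous * UnitAddTorus.mFourier j)] with x hx
    rw [hx, RCLike.inner_apply]
    rfl
  rw [← h5]
  refine h4.unique ((hasSum_potCoef hsw j v).congr_fun fun l => ?_)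
  simp only [Function.comp_apply, Equiv.neg_apply]
  have h6 : UnitAddTorus.mFourier (-l) * UnitAddTorus.mFourier j
      = UnitAddTorus.mFourier (d := Fin 2) (j - l) := by
    ext x
    rw [sub_eq_neg_add, UnitAddTorus.mFourier_add]; rfl
  rw [smul_mul_assoc, h6, map_smul, map_smul, smul_eq_mul, map_mul, innerSL_apply_apply,
    inner_conj_symm, hw, torusCoef_conj, Complex.conj_conj]
  rfl

theorem IsSchrodingerSolution.isModeSolution {V : Torus → ℝ} (hV : TorusSmooth V) {ħ ε : ℝ}
    (hħ : ħ ≠ 0) {u : L2} {v : ℝ → L2} (hv : IsSchrodingerSolution V ħ ε u v) :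
    IsModeSolution (torusCoef fun x => (V x : ℂ)) ħ ε v where
  continuous := hv.continuous
  hasDerivAt j t := by
    have h := hv.equation _ (torusSmooth_mFourier j) t
    simp only [← coef_eq_integral] at h
    have hI : Complex.I * (ħ : ℂ) ≠ 0 := mul_ne_zero Complex.I_ne_zero (by exact_mod_cast hħ)
    have h' := h.const_mul (Complex.I * (ħ : ℂ))⁻¹
    simp only [inv_mul_cancel_left₀ hI] at h'
    refine h'.congr_deriv ?_
    have hint : ∀ g : C(Torus, ℂ), Integrable (fun x => v t x * starRingEnd ℂ (g x)) torusMeasure := by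
      intro g
      have := L2.integrable_inner (𝕜 := ℂ) (ContinuousMap.toLp (E := ℂ) 2 torusMeasure ℂ g) (v t)
      refine this.congr ?_
      filter_upwards [ContinuousMap.coeFn_toLp (p := 2) (𝕜 := ℂ) torusMeasure g] with x hx
      rw [hx, RCLike.inner_apply]
    have e1 : (fun x => v t x * starRingEnd ℂ (-((ħ : ℂ) ^ 2 / 2) *
        torusLaplacian (UnitAddTorus.mFourier j) x + (ε : ℂ) ^ 2 * (V x : ℂ) *
          UnitAddTorus.mFourier j x))
        = fun x => (kinetic ħ j : ℂ) * (v t x * starRingEnd ℂ (UnitAddTorus.mFourier j x))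
          + (ε : ℂ) ^ 2 * (v t x * starRingEnd ℂ ((V x : ℂ) * UnitAddTorus.mFourier j x)) := by
      ext x
      rw [torusLaplacian_mFourier, kinetic]
      simp only [map_add, map_mul, map_neg, map_div₀, map_pow, Complex.conj_ofReal, map_ofNat]
      push_cast
      ring
    rw [e1, integral_add, integral_const_mul, integral_const_mul, integral_potential_mul hV,
      ← coef_eq_integral]
    · have : (Complex.I * (ħ : ℂ))⁻¹ = -(Complex.I / ħ) := by
        rw [mul_inv, Complex.inv_I, div_eq_mul_inv]; ring
      rw [this]
    · exact (hint _).const_mul _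
    · exact (hint (ContinuousMap.mk _ hV.ofReal.continuous * UnitAddTorus.mFourier j)).const_mul _

/-! ### Time averages and low frequencies -/

/-- A finite trigonometric sum in `L²`. -/
def modeSum (F : Finset (Fin 2 → ℤ)) (a : (Fin 2 → ℤ) → ℂ) : L2 := ∑ j ∈ F, a j • expMode j

theorem orthonormal_expMode : Orthonormal ℂ expMode := by
  have := modeBasis.orthonormal
  rwa [show (modeBasis : (Fin 2 → ℤ) → L2) = expMode from funext modeBasis_apply] at this

theorem norm_modeSum_sq (F : Finset (Fin 2 → ℤ)) (a : (Fin 2 → ℤ) → ℂ) :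
    ‖modeSum F a‖ ^ 2 = ∑ j ∈ F, ‖a j‖ ^ 2 := by
  have h := orthonormal_expMode.inner_sum a a F
  have h2 : ((‖modeSum F a‖ ^ 2 : ℝ) : ℂ) = ((∑ j ∈ F, ‖a j‖ ^ 2 : ℝ) : ℂ) := by
    have h3 := inner_self_eq_norm_sq_to_K (𝕜 := ℂ) (modeSum F a)
    rw [modeSum, h] at h3
    push_cast
    rw [modeSum]
    refine h3.symm.trans ?_
    refine Finset.sum_congr rfl fun j _ => ?_
    rw [RCLike.conj_mul]; rfl
  exact_mod_cast h2

theorem norm_modeSum_congr {F : Finset (Fin 2 → ℤ)} {a b : (Fin 2 → ℤ) → ℂ}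
    (h : ∀ j ∈ F, ‖a j‖ ≤ ‖b j‖) : ‖modeSum F a‖ ≤ ‖modeSum F b‖ := by
  rw [← sq_le_sq₀ (norm_nonneg _) (norm_nonneg _), norm_modeSum_sq, norm_modeSum_sq]
  exact Finset.sum_le_sum fun j hj => pow_le_pow_left₀ (norm_nonneg _) (h j hj) 2

theorem modeSum_sub (F : Finset (Fin 2 → ℤ)) (a b : (Fin 2 → ℤ) → ℂ) :
    modeSum F (fun j => a j - b j) = modeSum F a - modeSum F b := by
  simp [modeSum, sub_smul]

theorem norm_modeSum_coef_add_le (F : Finset (Fin 2 → ℤ)) (v : L2) (p : Fin 2 → ℤ) :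
    ‖modeSum F (fun j => coef v (j + p))‖ ≤ ‖v‖ := by
  rw [← sq_le_sq₀ (norm_nonneg _) (norm_nonneg _), norm_modeSum_sq]
  exact sum_le_hasSum F (fun _ _ => by positivity) (hasSum_coef_add_sq v p)

/-- Young's inequality for the convolution of an `ℓ¹` and an `ℓ²` sequence. -/
theorem norm_modeSum_potCoef_le {w : (Fin 2 → ℤ) → ℂ} (hw : Summable fun l => ‖w l‖)
    (F : Finset (Fin 2 → ℤ)) (v : L2) :
    ‖modeSum F (fun j => potCoef w j v)‖ ≤ (∑' l, ‖w l‖) * ‖v‖ := by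
  have h1 : HasSum (fun l => ∑ j ∈ F, (w l * coef v (j - l)) • expMode j)
      (modeSum F (fun j => potCoef w j v)) :=
    hasSum_sum fun j _ => (hasSum_potCoef hw j v).smul_const (expMode j)
  rw [← h1.tsum_eq]
  refine tsum_of_norm_bounded (hw.hasSum.mul_right ‖v‖) fun l => ?_
  have : ∑ j ∈ F, (w l * coef v (j - l)) • expMode j
      = w l • modeSum F (fun j => coef v (j + -l)) := by
    simp only [modeSum, Finset.smul_sum, smul_smul, sub_eq_add_neg]
  rw [this, norm_smul]
  gcongr
  exact norm_modeSum_coef_add_le F v (-l)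

/-- Duhamel's formula: after removal of the free phases only the potential drives the evolution, at
speed `O(ε²/ħ)`. Working on a finite set of modes avoids any question of domain. -/
theorem IsModeSolution.norm_modeSum_duhamel_le {w : (Fin 2 → ℤ) → ℂ}
    (hw : Summable fun l => ‖w l‖) {ħ ε : ℝ} (hħ : 0 < ħ) {v : ℝ → L2}
    (hv : IsModeSolution w ħ ε v) {C : ℝ} (hC : ∀ t, ‖v t‖ ≤ C) (F : Finset (Fin 2 → ℤ)) (t σ : ℝ)
    (hσ : 0 ≤ σ) :
    ‖modeSum F (fun j => coef (v (t + σ)) j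
        - Complex.exp (-(Complex.I * (kinetic ħ j / ħ * σ : ℝ))) * coef (v t) j)‖
      ≤ ε ^ 2 / ħ * ((∑' l, ‖w l‖) * C) * σ := by
  set g : ℝ → L2 := fun s => modeSum F (fun j =>
    Complex.exp (Complex.I * (kinetic ħ j / ħ * s : ℝ)) * coef (v (t + s)) j) with hg
  have hder : ∀ s, HasDerivAt g (modeSum F (fun j =>
      Complex.exp (Complex.I * (kinetic ħ j / ħ * s : ℝ)) *
        (-(Complex.I / ħ) * ((ε : ℂ) ^ 2 * potCoef w j (v (t + s)))))) s := by
    intro s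
    refine HasDerivAt.fun_sum fun j _ => HasDerivAt.smul_const ?_ _
    have h1 : HasDerivAt (fun s : ℝ => Complex.I * ((kinetic ħ j / ħ * s : ℝ) : ℂ))
        (Complex.I * ((kinetic ħ j / ħ : ℝ) : ℂ)) s := by
      have h0 : HasDerivAt (fun s : ℝ => kinetic ħ j / ħ * s) (kinetic ħ j / ħ * 1) s :=
        (hasDerivAt_id s).const_mul _
      rw [mul_one] at h0
      exact h0.ofReal_comp.const_mul Complex.I
    have h2 : HasDerivAt (fun s => coef (v (t + s)) j) _ s :=
      (hv.hasDerivAt j (t + s)).comp_const_add t s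
    refine (h1.cexp.mul h2).congr_deriv ?_
    push_cast
    ring
  have hbound : ∀ s, ‖modeSum F (fun j =>
      Complex.exp (Complex.I * (kinetic ħ j / ħ * s : ℝ)) *
        (-(Complex.I / ħ) * ((ε : ℂ) ^ 2 * potCoef w j (v (t + s)))))‖
        ≤ ε ^ 2 / ħ * ((∑' l, ‖w l‖) * C) := by
    intro s
    have hS : 0 ≤ ∑' l, ‖w l‖ := tsum_nonneg fun _ => norm_nonneg _
    have h1 : modeSum F (fun j => (-(Complex.I / ħ) * (ε : ℂ) ^ 2) * potCoef w j (v (t + s)))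
        = (-(Complex.I / ħ) * (ε : ℂ) ^ 2) • modeSum F (fun j => potCoef w j (v (t + s))) := by
      simp only [modeSum, Finset.smul_sum, smul_smul]
    refine (norm_modeSum_congr (b := fun j => (-(Complex.I / ħ) * (ε : ℂ) ^ 2)
      * potCoef w j (v (t + s))) fun j _ => ?_).trans ?_
    · rw [norm_mul, mul_comm Complex.I, Complex.norm_exp_ofReal_mul_I, one_mul, mul_assoc]
    · rw [h1, norm_smul]
      have h2 : ‖(-(Complex.I / ħ) * (ε : ℂ) ^ 2)‖ = ε ^ 2 / ħ := by
        simp [abs_of_pos hħ]; ring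
      rw [h2]
      gcongr
      exact (norm_modeSum_potCoef_le hw F _).trans (by gcongr; exact hC _)
  have hmv := (convex_Icc 0 σ).norm_image_sub_le_of_norm_hasDerivWithin_le
    (fun s _ => (hder s).hasDerivWithinAt) (fun s _ => hbound s) (Set.left_mem_Icc.2 hσ)
    (Set.right_mem_Icc.2 hσ)
  rw [sub_zero, Real.norm_of_nonneg hσ] at hmv
  refine le_trans ?_ hmv
  rw [hg]
  simp only
  rw [← modeSum_sub]
  refine norm_modeSum_congr fun j _ => le_of_eq ?_
  have h1 : Complex.exp (Complex.I * (kinetic ħ j / ħ * σ : ℝ)) * coef (v (t + σ)) j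
      - Complex.exp (Complex.I * (kinetic ħ j / ħ * 0 : ℝ)) * coef (v (t + 0)) j
      = Complex.exp (Complex.I * (kinetic ħ j / ħ * σ : ℝ)) * (coef (v (t + σ)) j
        - Complex.exp (-(Complex.I * (kinetic ħ j / ħ * σ : ℝ))) * coef (v t) j) := by
    rw [mul_sub, ← mul_assoc, ← Complex.exp_add]
    simp
  rw [h1, norm_mul, mul_comm Complex.I, Complex.norm_exp_ofReal_mul_I, one_mul]

/-- The average of `v` over the time interval `[t, t + ħT]`. -/
def timeAverage (ħ T : ℝ) (v : ℝ → L2) (t : ℝ) : L2 := (ħ * T)⁻¹ • ∫ s in t..(t + ħ * T), v s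

/-- The equation is linear and autonomous, so averages of time translates are again solutions. The
gain is that their norm is conserved as well. -/
theorem IsModeSolution.timeAverage {w : (Fin 2 → ℤ) → ℂ} {ħ ε : ℝ} {v : ℝ → L2}
    (hv : IsModeSolution w ħ ε v) (T : ℝ) : IsModeSolution w ħ ε (timeAverage ħ T v) := by
  have hii : ∀ a b, IntervalIntegrable v volume a b := fun a b => hv.continuous.intervalIntegrable a b
  have hL : ∀ (L : L2 →L[ℂ] ℂ) t, L (TwoMicrolocal.timeAverage ħ T v t)
      = (ħ * T)⁻¹ • ∫ s in t..(t + ħ * T), L (v s) := by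
    intro L t
    rw [TwoMicrolocal.timeAverage, L.intervalIntegral_comp_comm (hii _ _)]
    exact L.map_smul_of_tower _ _
  have hG : ∀ {E : Type} [NormedAddCommGroup E] [NormedSpace ℝ E] [CompleteSpace E] (f : ℝ → E),
      Continuous f → ∀ t, HasDerivAt (fun t => ∫ s in t..(t + ħ * T), f s) (f (t + ħ * T) - f t) t := by
    intro E _ _ _ f hf t
    have h1 : (fun t => ∫ s in t..(t + ħ * T), f s)
        = fun t => (∫ s in (0 : ℝ)..(t + ħ * T), f s) - ∫ s in (0 : ℝ)..t, f s := by
      ext t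
      rw [intervalIntegral.integral_interval_sub_left (hf.intervalIntegrable _ _)
        (hf.intervalIntegrable _ _)]
    rw [h1]
    exact (((hf.integral_hasStrictDerivAt 0 (t + ħ * T)).hasDerivAt).comp_add_const t (ħ * T)).sub
      (hf.integral_hasStrictDerivAt 0 t).hasDerivAt
  refine ⟨?_, fun j t => ?_⟩
  · have : Continuous fun t => ∫ s in t..(t + ħ * T), v s :=
      continuous_iff_continuousAt.2 fun t => (hG v hv.continuous t).continuousAt
    exact this.const_smul (ħ * T)⁻¹
  · set D : L2 →L[ℂ] ℂ := (-(Complex.I / ħ)) • ((kinetic ħ j : ℂ) • coefL j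
      + ((ε : ℂ) ^ 2) • potCoef w j) with hD
    have hDv : ∀ u, D u = -(Complex.I / ħ) * (kinetic ħ j * coef u j
      + (ε : ℂ) ^ 2 * potCoef w j u) := fun u => by simp [hD]; ring
    rw [← hDv]
    have h1 : (fun s => coef (TwoMicrolocal.timeAverage ħ T v s) j)
        = fun t => (ħ * T)⁻¹ • ∫ s in t..(t + ħ * T), coef (v s) j := by
      ext t; exact hL (coefL j) t
    rw [h1, hL D t]
    refine ((hG (fun s => coef (v s) j) ((continuous_coef j).comp hv.continuous) t).fun_const_smul
      (ħ * T)⁻¹).congr_deriv ?_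
    congr 1
    rw [intervalIntegral.integral_eq_sub_of_hasDerivAt (f := fun s => coef (v s) j)]
    · intro s _
      rw [hDv]; exact hv.hasDerivAt j s
    · exact (D.continuous.comp hv.continuous).intervalIntegrable _ _

/-- The multiplier of the time average for the free evolution. -/
def averageMultiplier (ħ T : ℝ) (j : Fin 2 → ℤ) : ℂ :=
  (ħ * T)⁻¹ • ∫ σ in (0 : ℝ)..(ħ * T), Complex.exp (-(Complex.I * (kinetic ħ j / ħ * σ : ℝ)))

theorem norm_averageMultiplier_le_one {ħ T : ℝ} (hħ : 0 < ħ) (hT : 0 < T) (j : Fin 2 → ℤ) :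
    ‖averageMultiplier ħ T j‖ ≤ 1 := by
  have hp : 0 < ħ * T := mul_pos hħ hT
  rw [averageMultiplier, norm_smul, norm_inv, Real.norm_of_nonneg hp.le, inv_mul_le_iff₀ hp, mul_one]
  refine (intervalIntegral.norm_integral_le_of_norm_le_const (C := 1) fun σ _ => ?_).trans_eq ?_
  · rw [← mul_neg, ← Complex.ofReal_neg, mul_comm, Complex.norm_exp_ofReal_mul_I]
  · rw [sub_zero, one_mul, abs_of_pos hp]

/-- The free phase turns at rate `kinetic ħ j / ħ` for a time `ħ T`, so the average is damped by
`kinetic ħ j * T`. -/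
theorem norm_averageMultiplier_le {ħ T : ℝ} (hħ : 0 < ħ) (hT : 0 < T) {j : Fin 2 → ℤ}
    (hj : 0 < kinetic ħ j) : ‖averageMultiplier ħ T j‖ ≤ 2 / (kinetic ħ j * T) := by
  have hp : 0 < ħ * T := mul_pos hħ hT
  have hc : (-(Complex.I * (kinetic ħ j / ħ : ℝ)) : ℂ) ≠ 0 := by
    rw [neg_ne_zero]
    refine mul_ne_zero Complex.I_ne_zero ?_
    exact_mod_cast (div_pos hj hħ).ne'
  have h := integral_exp_mul_complex (a := 0) (b := ħ * T) hc
  have h2 : (fun σ : ℝ => Complex.exp (-(Complex.I * (kinetic ħ j / ħ * σ : ℝ))))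
      = fun σ : ℝ => Complex.exp (-(Complex.I * (kinetic ħ j / ħ : ℝ)) * σ) := by
    ext σ; congr 1; push_cast; ring
  rw [averageMultiplier, h2, h, norm_smul, norm_inv, Real.norm_of_nonneg hp.le, norm_div]
  have h3 : ‖(-(Complex.I * (kinetic ħ j / ħ : ℝ)) : ℂ)‖ = kinetic ħ j / ħ := by
    rw [norm_neg, norm_mul, Complex.norm_I, one_mul, Complex.norm_real,
      Real.norm_of_nonneg (div_pos hj hħ).le]
  have h4 : ‖Complex.exp (-(Complex.I * (kinetic ħ j / ħ : ℝ)) * ((ħ * T : ℝ) : ℂ))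
      - Complex.exp (-(Complex.I * (kinetic ħ j / ħ : ℝ)) * ((0 : ℝ) : ℂ))‖ ≤ 2 := by
    have h5 : ∀ r : ℝ, ‖Complex.exp (-(Complex.I * (kinetic ħ j / ħ : ℝ)) * (r : ℂ))‖ = 1 := by
      intro r
      have : (-(Complex.I * (kinetic ħ j / ħ : ℝ)) * (r : ℂ))
        = ((-(kinetic ħ j / ħ * r) : ℝ) : ℂ) * Complex.I := by push_cast; ring
      rw [this, Complex.norm_exp_ofReal_mul_I]
    refine (norm_sub_le _ _).trans ?_
    rw [h5, h5]; norm_num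
  rw [h3]
  calc _ ≤ (ħ * T)⁻¹ * (2 / (kinetic ħ j / ħ)) := by gcongr
    _ = _ := by field_simp

/-- The phase moves by at most `kinetic ħ j * T ≤ 1 / 2` during the average, so the exponential
stays at distance at most `1/2` from `1`. -/
theorem half_le_norm_averageMultiplier {ħ T : ℝ} (hħ : 0 < ħ) (hT : 0 < T) {j : Fin 2 → ℤ}
    (hj : kinetic ħ j * T ≤ 1 / 2) : 1 / 2 ≤ ‖averageMultiplier ħ T j‖ := by
  have hp : 0 < ħ * T := mul_pos hħ hT
  have hk : 0 ≤ kinetic ħ j := by unfold kinetic; positivity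
  have h1 : averageMultiplier ħ T j - 1 = (ħ * T)⁻¹ • ∫ σ in (0 : ℝ)..(ħ * T),
      (Complex.exp (-(Complex.I * (kinetic ħ j / ħ * σ : ℝ))) - 1) := by
    rw [intervalIntegral.integral_sub, smul_sub, averageMultiplier]
    · congr 1
      rw [intervalIntegral.integral_const, sub_zero, smul_smul, inv_mul_cancel₀ hp.ne', one_smul]
    · exact Continuous.intervalIntegrable (by fun_prop) _ _
    · exact Continuous.intervalIntegrable (by fun_prop) _ _
  have h2 : ‖averageMultiplier ħ T j - 1‖ ≤ 1 / 2 := by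
    rw [h1, norm_smul, norm_inv, Real.norm_of_nonneg hp.le, inv_mul_le_iff₀ hp]
    refine (intervalIntegral.norm_integral_le_of_norm_le_const (C := 1 / 2) fun σ hσ => ?_).trans_eq ?_
    · rw [Set.uIoc_of_le hp.le] at hσ
      rw [← mul_neg, ← Complex.ofReal_neg]
      refine Real.norm_exp_I_mul_ofReal_sub_one_le.trans ?_
      rw [norm_neg, Real.norm_of_nonneg (mul_nonneg (div_nonneg hk hħ.le) hσ.1.le)]
      calc kinetic ħ j / ħ * σ ≤ kinetic ħ j / ħ * (ħ * T) := by gcongr; exact hσ.2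
        _ = kinetic ħ j * T := by field_simp
        _ ≤ _ := hj
    · rw [sub_zero, abs_of_pos hp]; ring
  have h3 := norm_sub_norm_le (1 : ℂ) (1 - averageMultiplier ħ T j)
  rw [sub_sub_cancel, norm_one, norm_sub_rev] at h3
  linarith

/-- Over the averaging time `ħT` the Duhamel error is at most `(ε²/ħ)·ħT`: the factor `ħ`
disappears, and for fixed `T` the average is asymptotically a Fourier multiplier. -/
theorem IsModeSolution.norm_modeSum_timeAverage_sub_le {w : (Fin 2 → ℤ) → ℂ}
    (hw : Summable fun l => ‖w l‖) {ħ ε T : ℝ} (hħ : 0 < ħ) (hT : 0 < T) {v : ℝ → L2}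
    (hv : IsModeSolution w ħ ε v) {C : ℝ} (hC : ∀ t, ‖v t‖ ≤ C) (F : Finset (Fin 2 → ℤ)) (t : ℝ) :
    ‖modeSum F (fun j => coef (TwoMicrolocal.timeAverage ħ T v t) j
        - averageMultiplier ħ T j * coef (v t) j)‖
      ≤ ε ^ 2 * T * ((∑' l, ‖w l‖) * C) := by
  have hp : 0 < ħ * T := mul_pos hħ hT
  have hC0 : 0 ≤ C := (norm_nonneg _).trans (hC 0)
  have hS : 0 ≤ ∑' l, ‖w l‖ := tsum_nonneg fun _ => norm_nonneg _
  have hcont : ∀ j, Continuous fun σ => coef (v (t + σ)) j := fun j =>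
    (continuous_coef j).comp (hv.continuous.comp (by fun_prop))
  have hcont2 : ∀ j, Continuous fun σ : ℝ =>
      (Complex.exp (-(Complex.I * (kinetic ħ j / ħ * σ : ℝ))) * coef (v t) j) := fun j => by fun_prop
  have key : modeSum F (fun j => coef (TwoMicrolocal.timeAverage ħ T v t) j
        - averageMultiplier ħ T j * coef (v t) j)
      = (ħ * T)⁻¹ • ∫ σ in (0 : ℝ)..(ħ * T), modeSum F (fun j => coef (v (t + σ)) j
        - Complex.exp (-(Complex.I * (kinetic ħ j / ħ * σ : ℝ))) * coef (v t) j) := by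
    simp only [modeSum]
    rw [intervalIntegral.integral_finsetSum, Finset.smul_sum]
    · refine Finset.sum_congr rfl fun j _ => ?_
      rw [intervalIntegral.integral_smul_const, ← smul_assoc]
      congr 1
      rw [intervalIntegral.integral_sub ((hcont j).intervalIntegrable _ _)
        ((hcont2 j).intervalIntegrable _ _), smul_sub]
      congr 1
      · have h1 := (coefL j).map_smul_of_tower (ħ * T)⁻¹ (∫ s in t..(t + ħ * T), v s)
        rw [← (coefL j).intervalIntegral_comp_comm (hv.continuous.intervalIntegrable _ _)] at h1
        rw [intervalIntegral.integral_comp_add_left (fun s => coef (v s) j), add_zero]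
        exact h1
      · rw [intervalIntegral.integral_mul_const, averageMultiplier, smul_mul_assoc]
    · intro j _
      exact (((hcont j).sub (hcont2 j)).smul continuous_const).intervalIntegrable _ _
  rw [key, norm_smul, norm_inv, Real.norm_of_nonneg hp.le, inv_mul_le_iff₀ hp]
  refine (intervalIntegral.norm_integral_le_of_norm_le_const
    (C := ε ^ 2 * T * ((∑' l, ‖w l‖) * C)) fun σ hσ => ?_).trans_eq ?_
  · rw [Set.uIoc_of_le hp.le] at hσ
    refine (hv.norm_modeSum_duhamel_le hw hħ hC F t σ hσ.1.le).trans ?_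
    calc _ ≤ ε ^ 2 / ħ * ((∑' l, ‖w l‖) * C) * (ħ * T) := by gcongr; exact hσ.2
      _ = _ := by field_simp
  · rw [sub_zero, abs_of_pos hp]; ring

theorem norm_le_of_forall_modeSum {v : L2} {C : ℝ} (hC : 0 ≤ C)
    (h : ∀ F : Finset (Fin 2 → ℤ), ‖modeSum F (coef v)‖ ≤ C) : ‖v‖ ≤ C := by
  rw [← sq_le_sq₀ (norm_nonneg _) hC]
  refine hasSum_le_of_sum_le (hasSum_coef_sq v) fun F => ?_
  rw [← norm_modeSum_sq]
  exact pow_le_pow_left₀ (norm_nonneg _) (h F) 2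

/-- The low frequencies of a solution are controlled, uniformly in time, by those of the data. -/
theorem IsModeSolution.low_frequency_le {w : (Fin 2 → ℤ) → ℂ}
    (hw : Summable fun l => ‖w l‖ * (1 + ‖l‖)) (hconj : ∀ l, w (-l) = starRingEnd ℂ (w l))
    {ħ ε T ρ P : ℝ} (hħ : 0 < ħ) (hT : 0 < T) (hρ : 0 < ρ) {v : ℝ → L2}
    (hv : IsModeSolution w ħ ε v) (h1 : ‖v 0‖ = 1)
    (hP : ∀ F : Finset (Fin 2 → ℤ), (∀ j ∈ F, kinetic ħ j ≤ ρ) → ‖modeSum F (coef (v 0))‖ ≤ P)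
    (F : Finset (Fin 2 → ℤ)) (hF : ∀ j ∈ F, kinetic ħ j * T ≤ 1 / 2) (t : ℝ) :
    ‖modeSum F (coef (v t))‖ ≤ 2 * (P + 2 / (ρ * T) + 2 * (ε ^ 2 * T * ∑' l, ‖w l‖)) := by
  have hw' := summable_norm_of_weighted hw
  have hnorm : ∀ t, ‖v t‖ = 1 := fun t => (hv.norm_eq hw hconj t).trans h1
  have hS : 0 ≤ ∑' l, ‖w l‖ := tsum_nonneg fun _ => norm_nonneg _
  have happ := fun F t => hv.norm_modeSum_timeAverage_sub_le hw' hħ hT (fun t => (hnorm t).le) F t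
  simp only [mul_one] at happ
  -- Up to `O(ε²T)`, `A` is the multiplier applied to `v`. At time zero it is small, since the data
  -- have little mass below `ρ` and the multiplier is small above. Its norm does not change in time,
  -- and at time `t` it controls the modes of `F`, where the multiplier is at least `1/2`.
  set A := TwoMicrolocal.timeAverage ħ T v with hA
  have hP0 : 0 ≤ P := (norm_nonneg _).trans (hP ∅ (by simp))
  have hA0 : ‖A 0‖ ≤ P + 2 / (ρ * T) + ε ^ 2 * T * ∑' l, ‖w l‖ := by
    refine norm_le_of_forall_modeSum (by positivity) fun G => ?_
    have e1 : modeSum G (coef (A 0)) = modeSum G (fun j => coef (A 0) j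
        - averageMultiplier ħ T j * coef (v 0) j)
        + (modeSum (G.filter fun j => kinetic ħ j ≤ ρ) (fun j => averageMultiplier ħ T j * coef (v 0) j)
        + modeSum (G.filter fun j => ¬ kinetic ħ j ≤ ρ)
          (fun j => averageMultiplier ħ T j * coef (v 0) j)) := by
      have : (modeSum (G.filter fun j => kinetic ħ j ≤ ρ)
            (fun j => averageMultiplier ħ T j * coef (v 0) j)
        + modeSum (G.filter fun j => ¬ kinetic ħ j ≤ ρ)
          (fun j => averageMultiplier ħ T j * coef (v 0) j))
        = modeSum G (fun j => averageMultiplier ħ T j * coef (v 0) j) :=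
        Finset.sum_filter_add_sum_filter_not _ _ _
      rw [this, modeSum_sub, sub_add_cancel]
    rw [e1]
    refine (norm_add_le _ _).trans ?_
    have b1 : ‖modeSum (G.filter fun j => kinetic ħ j ≤ ρ)
        (fun j => averageMultiplier ħ T j * coef (v 0) j)‖ ≤ P := by
      refine (norm_modeSum_congr (b := coef (v 0)) fun j _ => ?_).trans
        (hP _ fun j hj => (Finset.mem_filter.1 hj).2)
      rw [norm_mul]
      exact mul_le_of_le_one_left (norm_nonneg _) (norm_averageMultiplier_le_one hħ hT j)
    have b2 : ‖modeSum (G.filter fun j => ¬ kinetic ħ j ≤ ρ)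
        (fun j => averageMultiplier ħ T j * coef (v 0) j)‖ ≤ 2 / (ρ * T) := by
      refine (norm_modeSum_congr (b := fun j => ((2 / (ρ * T) : ℝ) : ℂ) * coef (v 0) j)
        fun j hj => ?_).trans ?_
      · have hj' := not_le.1 (Finset.mem_filter.1 hj).2
        rw [norm_mul, norm_mul, Complex.norm_real, Real.norm_of_nonneg (by positivity)]
        gcongr
        refine (norm_averageMultiplier_le hħ hT (hρ.trans hj')).trans ?_
        gcongr
      · have : modeSum (G.filter fun j => ¬ kinetic ħ j ≤ ρ)
            (fun j => ((2 / (ρ * T) : ℝ) : ℂ) * coef (v 0) j)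
            = ((2 / (ρ * T) : ℝ) : ℂ) • modeSum (G.filter fun j => ¬ kinetic ħ j ≤ ρ)
              (coef (v 0)) := by
          simp only [modeSum, Finset.smul_sum, smul_smul]
        rw [this, norm_smul, Complex.norm_real, Real.norm_of_nonneg (by positivity)]
        have := norm_modeSum_coef_add_le (G.filter fun j => ¬ kinetic ħ j ≤ ρ) (v 0) 0
        simp only [add_zero, h1] at this
        exact mul_le_of_le_one_right (by positivity) this
    have := norm_add_le (modeSum (G.filter fun j => kinetic ħ j ≤ ρ)
        (fun j => averageMultiplier ħ T j * coef (v 0) j)) (modeSum (G.filter fun j => ¬ kinetic ħ j ≤ ρ)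
        (fun j => averageMultiplier ħ T j * coef (v 0) j))
    linarith [happ G 0]
  have hAt : ‖A t‖ = ‖A 0‖ := (hv.timeAverage T).norm_eq hw hconj t
  have h2 : ‖modeSum F (coef (v t))‖
      ≤ ‖modeSum F (fun j => (2 : ℂ) * (averageMultiplier ħ T j * coef (v t) j))‖ := by
    refine norm_modeSum_congr fun j hj => ?_
    rw [norm_mul, norm_mul, ← mul_assoc]
    refine le_mul_of_one_le_left (norm_nonneg _) ?_
    have := half_le_norm_averageMultiplier hħ hT (hF j hj)
    rw [Complex.norm_ofNat]; linarith
  have h3 : modeSum F (fun j => (2 : ℂ) * (averageMultiplier ħ T j * coef (v t) j))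
      = (2 : ℂ) • (modeSum F (coef (A t)) - modeSum F (fun j => coef (A t) j
        - averageMultiplier ħ T j * coef (v t) j)) := by
    rw [modeSum_sub, sub_sub_cancel]
    simp only [modeSum, Finset.smul_sum, smul_smul]
  rw [h3, norm_smul, Complex.norm_ofNat] at h2
  have h4 := norm_modeSum_coef_add_le F (A t) 0
  simp only [add_zero] at h4
  have h5 := norm_sub_le (modeSum F (coef (A t))) (modeSum F (fun j => coef (A t) j
        - averageMultiplier ħ T j * coef (v t) j))
  have h6 := happ F t
  have h4' : ‖modeSum F (coef (A t))‖ ≤ ‖A t‖ := h4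
  linarith

/-! ### The Weyl quantization of a Fourier mode -/

open scoped FourierTransform

/-- Parseval's identity for `v · conj e_k`, whose coefficients are those of `v` shifted by `k`, and
for a translate of `v`, whose coefficients are those of `v` up to a phase. -/
theorem mode_translate_pairing (v : L2) (k : Fin 2 → ℤ) (z : Torus) :
    HasSum (fun j => starRingEnd ℂ (coef v (j + k)) *
        (UnitAddTorus.mFourier j (-z) * coef v j))
      (∫ x, starRingEnd ℂ (v x) * (UnitAddTorus.mFourier k x * v (x - z)) ∂torusMeasure) := by
  have hf : MemLp (fun x => v x * starRingEnd ℂ (UnitAddTorus.mFourier k x)) 2 torusMeasure := by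
    refine (Lp.memLp v).of_le ?_ (ae_of_all _ fun x => ?_)
    · exact (Lp.aestronglyMeasurable v).mul
        (RCLike.continuous_conj.comp (map_continuous _)).aestronglyMeasurable
    · rw [norm_mul, RCLike.norm_conj, norm_mFourier_apply, mul_one]
  have hmp : MeasurePreserving (fun x : Torus => x - z) torusMeasure torusMeasure :=
    measurePreserving_sub_right _ z
  have hg : MemLp (fun x => v (x - z)) 2 torusMeasure := (Lp.memLp v).comp_measurePreserving hmp
  have h := hasSum_coef_conj_mul (hf.toLp _) (hg.toLp _)
  have e1 : inner ℂ (hf.toLp _) (hg.toLp _)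
      = ∫ x, starRingEnd ℂ (v x) * (UnitAddTorus.mFourier k x * v (x - z)) ∂torusMeasure := by
    rw [L2.inner_def]
    refine integral_congr_ae ?_
    filter_upwards [hf.coeFn_toLp, hg.coeFn_toLp] with x hx hx'
    rw [hx, hx', RCLike.inner_apply, map_mul, Complex.conj_conj]
    ring
  rw [e1] at h
  refine h.congr_fun fun j => ?_
  have e2 : coef (hf.toLp _) j = coef v (j + k) := by
    rw [coef_eq_integral, coef_eq_integral]
    refine integral_congr_ae ?_
    filter_upwards [hf.coeFn_toLp] with x hx
    rw [hx, UnitAddTorus.mFourier_add, map_mul]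
    ring
  have e3 : coef (hg.toLp _) j = UnitAddTorus.mFourier j (-z) * coef v j := by
    rw [coef_eq_integral, coef_eq_integral, ← integral_const_mul]
    have h1 := integral_sub_right_eq_self (μ := torusMeasure)
      (fun x => UnitAddTorus.mFourier j (-z) * (v x * starRingEnd ℂ (UnitAddTorus.mFourier j x))) z
    rw [← h1]
    refine integral_congr_ae ?_
    filter_upwards [hg.coeFn_toLp] with x hx
    rw [hx, sub_eq_add_neg x z, mFourier_add_apply, map_mul, mul_comm (v _), mul_comm (v _),
      ← mul_assoc, mul_comm (starRingEnd ℂ _) (starRingEnd ℂ _), ← mul_assoc, RCLike.mul_conj,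
      norm_mFourier_apply]
    simp
  rw [e2, e3]

theorem norm_sq_integral (v : L2) : ∫ x, ‖v x‖ ^ 2 ∂torusMeasure = ‖v‖ ^ 2 := by
  have h := inner_self_eq_norm_sq_to_K (𝕜 := ℂ) v
  rw [L2.inner_def] at h
  have h2 : ∫ x, inner ℂ (v x) (v x) ∂torusMeasure = ((∫ x, ‖v x‖ ^ 2 ∂torusMeasure : ℝ) : ℂ) := by
    rw [← integral_complex_ofReal]
    congr 1; ext x
    rw [inner_self_eq_norm_sq_to_K]; push_cast; rfl
  rw [h2] at h
  have h3 : ((∫ x, ‖v x‖ ^ 2 ∂torusMeasure : ℝ) : ℂ) = ((‖v‖ ^ 2 : ℝ) : ℂ) := by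
    rw [Complex.ofReal_pow]; exact h
  exact Complex.ofReal_injective h3

/-- The hypothesis of Fubini's theorem for the Weyl kernel: the product `|v(x)| |v(x - z)|` is
dominated by the sum of squares, and each square is integrable by translation invariance. -/
theorem integrable_pairing_kernel (v : L2) {G : Plane → ℂ} (hG : Continuous G)
    (hGi : Integrable G) (k : Fin 2 → ℤ) :
    Integrable (fun p : Torus × Plane => starRingEnd ℂ (v p.1) *
      (UnitAddTorus.mFourier k p.1 * (G p.2 * v (p.1 - proj p.2)))) (torusMeasure.prod volume) := by
  have hv : StronglyMeasurable v := Lp.stronglyMeasurable v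
  have hsub : Measurable fun p : Torus × Plane => p.1 - proj p.2 :=
    measurable_fst.sub (continuous_proj.measurable.comp measurable_snd)
  have hsq : Integrable (fun x => ‖v x‖ ^ 2) torusMeasure := (Lp.memLp v).integrable_norm_pow (by simp)
  have h1 : Integrable (fun p : Torus × Plane => ‖v p.1‖ ^ 2 * ‖G p.2‖) (torusMeasure.prod volume) :=
    hsq.mul_prod hGi.norm
  have h2 : Integrable (fun p : Torus × Plane => ‖v (p.1 - proj p.2)‖ ^ 2 * ‖G p.2‖)
      (torusMeasure.prod volume) := by
    have hmeas : AEStronglyMeasurable (fun p : Torus × Plane => ‖v (p.1 - proj p.2)‖ ^ 2 * ‖G p.2‖)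
        (torusMeasure.prod volume) :=
      (((hv.comp_measurable hsub).norm.pow 2).mul
        (hG.norm.stronglyMeasurable.comp_measurable measurable_snd)).aestronglyMeasurable
    rw [integrable_prod_iff' hmeas]
    refine ⟨ae_of_all _ fun z => ?_, ?_⟩
    · have h3 := ((measurePreserving_sub_right torusMeasure (proj z)).integrable_comp
        hsq.aestronglyMeasurable).2 hsq
      exact h3.mul_const ‖G z‖
    · have : (fun z => ∫ x, ‖‖v (x - proj z)‖ ^ 2 * ‖G z‖‖ ∂torusMeasure)
          = fun z => ‖v‖ ^ 2 * ‖G z‖ := by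
        ext z
        have h3 := integral_sub_right_eq_self (μ := torusMeasure) (fun x => ‖v x‖ ^ 2) (proj z)
        rw [← norm_sq_integral, ← h3, ← integral_mul_const]
        congr 1; ext x
        rw [Real.norm_of_nonneg (by positivity)]
      simp only [this]
      exact hGi.norm.const_mul _
  refine (h1.add h2).mono' ?_ (ae_of_all _ fun p => ?_)
  · have hc : Measurable fun z : ℂ => starRingEnd ℂ z := RCLike.continuous_conj.measurable
    exact ((hc.stronglyMeasurable.comp_measurable (hv.measurable.comp measurable_fst)).mul
      (((map_continuous (UnitAddTorus.mFourier k)).stronglyMeasurable.comp_measurable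
        measurable_fst).mul ((hG.stronglyMeasurable.comp_measurable measurable_snd).mul
          (hv.comp_measurable hsub)))).aestronglyMeasurable
  · rw [norm_mul, norm_mul, norm_mul, RCLike.norm_conj, norm_mFourier_apply, one_mul]
    have h3 := two_mul_le_add_sq ‖v p.1‖ ‖v (p.1 - proj p.2)‖
    have h4 : ‖v p.1‖ * ‖v (p.1 - proj p.2)‖ ≤ ‖v p.1‖ ^ 2 + ‖v (p.1 - proj p.2)‖ ^ 2 := by
      nlinarith [norm_nonneg (v p.1), norm_nonneg (v (p.1 - proj p.2))]
    calc _ = ‖v p.1‖ * ‖v (p.1 - proj p.2)‖ * ‖G p.2‖ := by ring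
      _ ≤ (‖v p.1‖ ^ 2 + ‖v (p.1 - proj p.2)‖ ^ 2) * ‖G p.2‖ := by gcongr
      _ = _ := by simp only [Pi.add_apply]; ring

/-- The frequency at which the symbol is evaluated by the Weyl quantization, between the modes `j`
and `j + k`. -/
def midFreq (ħ : ℝ) (k j : Fin 2 → ℤ) : Plane :=
  (2 * Real.pi * ħ) • (latticeVec j + (1 / 2 : ℝ) • latticeVec k)

/-- Fourier inversion after the dilation by `2πħ`; its Jacobian in dimension two cancels the
prefactor `(2πħ)⁻²`. -/
theorem integral_weyl_kernel {ħ : ℝ} (hħ : 0 < ħ) (ψ : SchwartzMap Plane ℂ) (ζ : Plane) :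
    ∫ z : Plane, ((((2 * Real.pi * ħ) ^ 2 : ℝ) : ℂ)⁻¹ * (𝓕⁻ ψ) ((2 * Real.pi * ħ)⁻¹ • z)) *
      Complex.exp (-(Complex.I * ((2 * Real.pi * inner ℝ z ζ : ℝ) : ℂ)))
      = ψ ((2 * Real.pi * ħ) • ζ) := by
  have hc : 0 < 2 * Real.pi * ħ := by positivity
  set c := 2 * Real.pi * ħ with hcdef
  have h1 := Measure.integral_comp_inv_smul_of_nonneg (volume : Measure Plane)
    (fun z => ((((c) ^ 2 : ℝ) : ℂ)⁻¹ * (𝓕⁻ ψ) z) *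
      Complex.exp (-(Complex.I * ((2 * Real.pi * inner ℝ (c • z) ζ : ℝ) : ℂ)))) hc.le
  simp only [smul_inv_smul₀ hc.ne'] at h1
  rw [h1, ← integral_smul]
  have h2 : (𝓕 (𝓕⁻ ψ)) (c • ζ) = ψ (c • ζ) := by rw [FourierTransform.fourier_fourierInv_eq]
  rw [← h2, SchwartzMap.fourier_coe, Real.fourier_eq']
  congr 1
  ext z
  have h3 : Module.finrank ℝ Plane = 2 := by simp
  rw [h3, inner_smul_left, inner_smul_right, smul_eq_mul, Complex.real_smul, mul_assoc, ← mul_assoc,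
    mul_inv_cancel₀ (by exact_mod_cast (pow_pos hc 2).ne'), one_mul, mul_comm]
  congr 2
  simp
  ring

/-- In the variable `z = x - y`, the Weyl midpoint rule contributes the phase `e_k(-z/2)` and the
translation of `v` the phase `e_j(-z)`. Together they evaluate the symbol by Fourier inversion at
`2πħ(j + k/2)`, which is `midFreq`. -/
theorem pairing_weylOp_mode {ħ : ℝ} (hħ : 0 < ħ) (v : L2) (k : Fin 2 → ℤ) {β : Plane → ℂ}
    (hβ : ContDiff ℝ ∞ β) (hc : HasCompactSupport β) :
    ∫ x, starRingEnd ℂ (v x) *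
        weylOp ħ (fun x' ξ => β ξ * UnitAddTorus.mFourier k x') v x ∂torusMeasure
      = shiftForm k 0 (fun j => β (midFreq ħ k j)) v := by
  set ψ : SchwartzMap Plane ℂ := hc.toSchwartzMap hβ with hψ
  have hcc : 0 < 2 * Real.pi * ħ := by positivity
  set g : Plane → ℂ := fun z => (((2 * Real.pi * ħ) ^ 2 : ℝ) : ℂ)⁻¹ *
    (𝓕⁻ ψ) ((2 * Real.pi * ħ)⁻¹ • z) with hg
  have hgc : Continuous g := continuous_const.mul ((𝓕⁻ ψ).continuous.comp (continuous_const_smul _))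
  have hgi : Integrable g := by
    refine Integrable.const_mul ?_ _
    have h := (𝓕⁻ ψ).integrable (μ := (volume : Measure Plane))
    exact (integrable_comp_smul_iff volume (fun z => (𝓕⁻ ψ) z) (inv_ne_zero hcc.ne')).2 h
  set G : Plane → ℂ := fun z => g z * UnitAddTorus.mFourier k (proj (-((1 / 2 : ℝ) • z))) with hGdef
  have hmc : ∀ l : Fin 2 → ℤ, Continuous fun z : Plane => UnitAddTorus.mFourier l (proj (-z)) :=
    fun l => (map_continuous _).comp (continuous_proj.comp continuous_neg)
  have hGc : Continuous G := hgc.mul ((hmc k).comp (continuous_const_smul _))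
  have hGi : Integrable G := by
    refine hgi.mono hGc.aestronglyMeasurable (ae_of_all _ fun z => ?_)
    rw [hGdef, norm_mul, norm_mFourier_apply, mul_one]
  have hop : ∀ x, weylOp ħ (fun x' ξ => β ξ * UnitAddTorus.mFourier k x') v x
      = ∫ z : Plane, UnitAddTorus.mFourier k x * (G z * v (x - proj z)) := by
    intro x
    rw [weylOp, ← integral_const_mul]
    congr 1
    ext z
    have hin : (∫ ξ : Plane, Complex.exp (Complex.I * ((inner ℝ z ξ / ħ : ℝ) : ℂ)) *
        (β ξ * UnitAddTorus.mFourier k (x - proj ((1 / 2 : ℝ) • z))))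
        = (𝓕⁻ ψ) ((2 * Real.pi * ħ)⁻¹ • z) *
          UnitAddTorus.mFourier k (x - proj ((1 / 2 : ℝ) • z)) := by
      rw [SchwartzMap.fourierInv_coe, Real.fourierInv_eq', ← integral_mul_const]
      congr 1
      ext ξ
      rw [inner_smul_right, real_inner_comm, smul_eq_mul, ← mul_assoc]
      congr 2
      congr 1
      have : (2 * Real.pi * ((2 * Real.pi * ħ)⁻¹ * inner ℝ z ξ) : ℝ) = inner ℝ z ξ / ħ := by
        field_simp
      rw [real_inner_comm, this, mul_comm]
    rw [hin, hGdef, hg]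
    simp only
    rw [sub_eq_add_neg x, mFourier_add_apply, ← proj_neg]
    ring
  simp only [hop]
  have hint := integrable_pairing_kernel v hGc hGi k
  have hswap : ∫ x, starRingEnd ℂ (v x) * (∫ z : Plane, UnitAddTorus.mFourier k x *
      (G z * v (x - proj z))) ∂torusMeasure
      = ∫ z : Plane, ∫ x, starRingEnd ℂ (v x) *
        (UnitAddTorus.mFourier k x * (G z * v (x - proj z))) ∂torusMeasure := by
    rw [← integral_integral_swap hint]
    congr 1; ext x
    rw [← integral_const_mul]
  rw [hswap]
  have hinner : ∀ z : Plane, ∫ x, starRingEnd ℂ (v x) *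
        (UnitAddTorus.mFourier k x * (G z * v (x - proj z))) ∂torusMeasure
      = ∑' j, starRingEnd ℂ (coef v (j + k)) * coef v j *
        (G z * UnitAddTorus.mFourier j (proj (-z))) := by
    intro z
    have h := (mode_translate_pairing v k (proj z)).mul_left (G z)
    rw [← integral_const_mul] at h
    rw [← (h.congr_fun (g := fun j => starRingEnd ℂ (coef v (j + k)) * coef v j *
        (G z * UnitAddTorus.mFourier j (proj (-z)))) fun j => by rw [proj_neg]; ring).tsum_eq.symm]
    congr 1; ext x; ring
  simp only [hinner]
  have hFi : ∀ j : Fin 2 → ℤ, Integrable fun z => G z * UnitAddTorus.mFourier j (proj (-z)) := by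
    intro j
    refine hGi.mono (hGc.mul (hmc j)).aestronglyMeasurable (ae_of_all _ fun z => ?_)
    rw [norm_mul, norm_mFourier_apply, mul_one]
  have hnorm : ∀ j : Fin 2 → ℤ, ∫ z, ‖starRingEnd ℂ (coef v (j + k)) * coef v j *
        (G z * UnitAddTorus.mFourier j (proj (-z)))‖
      = ‖starRingEnd ℂ (coef v (j + k)) * (fun _ => (1 : ℂ)) j * coef v (j + 0)‖ * ∫ z, ‖G z‖ := by
    intro j
    rw [← integral_const_mul]
    congr 1; ext z
    simp only [norm_mul, norm_mFourier_apply, mul_one, add_zero]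
  have hs := hasSum_integral_of_summable_integral_norm
    (F := fun j z => starRingEnd ℂ (coef v (j + k)) * coef v j *
        (G z * UnitAddTorus.mFourier j (proj (-z))))
    (fun j => (hFi j).const_mul _) (by
      simp only [hnorm]
      exact (summable_norm_shiftForm (β := fun _ => (1 : ℂ)) (M := 1) (fun j => by simp) v k 0).mul_right _)
  rw [← hs.tsum_eq, shiftForm]
  congr 1
  ext j
  rw [integral_const_mul]
  have hfin : ∫ z, G z * UnitAddTorus.mFourier j (proj (-z)) = β (midFreq ħ k j) := by
    have h := integral_weyl_kernel hħ ψ (latticeVec j + (1 / 2 : ℝ) • latticeVec k)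
    have h2 : ψ ((2 * Real.pi * ħ) • (latticeVec j + (1 / 2 : ℝ) • latticeVec k))
        = β (midFreq ħ k j) := rfl
    rw [← h2, ← h]
    congr 1; ext z
    rw [hGdef, hg]
    simp only
    rw [mul_assoc (_ * _), mFourier_proj, mFourier_proj, ← Complex.exp_add]
    congr 2
    rw [inner_neg_right, inner_neg_right, inner_add_right, inner_smul_right, inner_smul_right,
      real_inner_comm z, real_inner_comm z]
    push_cast
    ring
  rw [hfin, add_zero]
  ring

/-! ### Almost positivity of the quantization -/

theorem integral_mFourier (k : Fin 2 → ℤ) :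
    ∫ x, UnitAddTorus.mFourier k x ∂torusMeasure = if k = 0 then 1 else 0 := by
  have h := orthonormal_iff_ite.1 orthonormal_expMode 0 k
  rw [show inner ℂ (expMode 0) (expMode k) = coef (expMode k) 0 from rfl, coef_eq_integral] at h
  have h2 : ∫ x, expMode k x * starRingEnd ℂ (UnitAddTorus.mFourier 0 x) ∂torusMeasure
      = ∫ x, UnitAddTorus.mFourier k x ∂torusMeasure := by
    refine integral_congr_ae ?_
    filter_upwards [ContinuousMap.coeFn_toLp (p := 2) (𝕜 := ℂ) torusMeasure
      (UnitAddTorus.mFourier k)] with x hx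
    rw [expMode, hx, UnitAddTorus.mFourier_zero]
    simp
  rw [← h2, h]
  simp only [eq_comm]

/-- A trigonometric polynomial with real part at least `-δ` gives a Toeplitz form with real part at
least `-δ`, also after restriction to a finite window. -/
theorem re_window_sum_ge (K Q : Finset (Fin 2 → ℤ)) (b a : (Fin 2 → ℤ) → ℂ) {δ : ℝ}
    (hb : ∀ x, -δ ≤ (∑ k ∈ K, b k * UnitAddTorus.mFourier k x).re) :
    -δ * ∑ q ∈ Q, ‖a q‖ ^ 2
      ≤ (∑ k ∈ K, ∑ q ∈ Q with q + k ∈ Q, starRingEnd ℂ (a (q + k)) * b k * a q).re := by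
  classical
  -- For `T = ∑ a_q e_q` and `A` the given polynomial, the windowed form is exactly `∫ A |T|²`:
  -- orthogonality keeps only the pairs whose two frequencies lie in `Q`. The lower bound on `Re A`
  -- can then be integrated.
  set T : Torus → ℂ := fun x => ∑ q ∈ Q, a q * UnitAddTorus.mFourier q x with hT
  have hm : ∀ k : Fin 2 → ℤ, Continuous (UnitAddTorus.mFourier k) := fun k => map_continuous _
  have hTc : Continuous T := continuous_finsetSum _ fun q _ => continuous_const.mul (hm q)
  set A : Torus → ℂ := fun x => ∑ k ∈ K, b k * UnitAddTorus.mFourier k x with hA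
  have hAc : Continuous A := continuous_finsetSum _ fun q _ => continuous_const.mul (hm q)
  have hgen : ∀ k : Fin 2 → ℤ, ∫ x, UnitAddTorus.mFourier k x * (starRingEnd ℂ (T x) * T x) ∂torusMeasure
      = ∑ q ∈ Q with q + k ∈ Q, starRingEnd ℂ (a (q + k)) * a q := by
    intro k
    have e1 : (fun x => UnitAddTorus.mFourier k x * (starRingEnd ℂ (T x) * T x))
        = fun x => ∑ q ∈ Q, ∑ q' ∈ Q, (starRingEnd ℂ (a q') * a q) *
          UnitAddTorus.mFourier (k + q - q') x := by
      ext x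
      simp only [hT, map_sum, Finset.mul_sum, Finset.sum_mul]
      refine Finset.sum_congr rfl fun q _ => Finset.sum_congr rfl fun q' _ => ?_
      rw [sub_eq_add_neg, UnitAddTorus.mFourier_add, UnitAddTorus.mFourier_add,
        UnitAddTorus.mFourier_neg, map_mul]
      ring
    have hi : ∀ (c : ℂ) (l : Fin 2 → ℤ), Integrable (fun x => c * UnitAddTorus.mFourier l x)
        torusMeasure := fun c l => integrable_of_continuous (continuous_const.mul (hm l))
    rw [e1, integral_finsetSum _ fun q _ => integrable_finsetSum _ fun q' _ => hi _ _,
      Finset.sum_filter]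
    refine Finset.sum_congr rfl fun q _ => ?_
    rw [integral_finsetSum _ fun q' _ => hi _ _]
    simp only [integral_const_mul, integral_mFourier, mul_ite, mul_one, mul_zero, sub_eq_zero]
    rw [Finset.sum_ite_eq, add_comm k q]
  have e2 : ∫ x, A x * (starRingEnd ℂ (T x) * T x) ∂torusMeasure
      = ∑ k ∈ K, ∑ q ∈ Q with q + k ∈ Q, starRingEnd ℂ (a (q + k)) * b k * a q := by
    simp only [hA, Finset.sum_mul]
    rw [integral_finsetSum]
    · refine Finset.sum_congr rfl fun k _ => ?_
      simp only [mul_assoc (b k)]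
      rw [integral_const_mul, hgen, Finset.mul_sum]
      exact Finset.sum_congr rfl fun q _ => by ring
    · intro k _
      exact integrable_of_continuous ((continuous_const.mul (hm k)).mul
        ((RCLike.continuous_conj.comp hTc).mul hTc))
  have e3 : ((∑ q ∈ Q, ‖a q‖ ^ 2 : ℝ) : ℂ) = ∫ x, (starRingEnd ℂ (T x) * T x) ∂torusMeasure := by
    have := hgen 0
    simp only [UnitAddTorus.mFourier_zero, ContinuousMap.one_apply, one_mul, add_zero] at this
    rw [this, Finset.filter_true_of_mem (fun q hq => hq)]
    push_cast
    exact Finset.sum_congr rfl fun q _ => by rw [RCLike.conj_mul]; rfl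
  have e4 : (∑ q ∈ Q, ‖a q‖ ^ 2) = ∫ x, ‖T x‖ ^ 2 ∂torusMeasure := by
    have h5 : ∫ x, (starRingEnd ℂ (T x) * T x) ∂torusMeasure
        = ((∫ x, ‖T x‖ ^ 2 ∂torusMeasure : ℝ) : ℂ) := by
      rw [← integral_complex_ofReal]
      congr 1; ext x; rw [RCLike.conj_mul]; push_cast; rfl
    rw [h5] at e3
    exact Complex.ofReal_injective e3
  have hAT : Integrable (fun x => A x * (starRingEnd ℂ (T x) * T x)) torusMeasure :=
    integrable_of_continuous (hAc.mul ((RCLike.continuous_conj.comp hTc).mul hTc))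
  have hT2 : Integrable (fun x => ‖T x‖ ^ 2) torusMeasure :=
    (hTc.norm.pow 2).integrable_of_hasCompactSupport (HasCompactSupport.of_compactSpace _)
  rw [← e2, e4, ← integral_const_mul]
  have h6 := integral_re hAT
  simp only [RCLike.re_to_complex] at h6
  rw [← h6]
  refine integral_mono (hT2.const_mul _) hAT.re fun x => ?_
  have h7 : starRingEnd ℂ (T x) * T x = ((‖T x‖ ^ 2 : ℝ) : ℂ) := by
    rw [RCLike.conj_mul]; push_cast; rfl
  simp only
  rw [h7, Complex.re_mul_ofReal]
  exact mul_le_mul_of_nonneg_right (hb x) (by positivity)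

/-- The square window of side `M` in frequency. -/
def window (M : ℕ) : Finset (Fin 2 → ℤ) := Fintype.piFinset fun _ => Finset.Ico 0 (M : ℤ)

theorem card_window (M : ℕ) : (window M).card = M ^ 2 := by
  simp [window, Fintype.card_piFinset]

theorem card_Ico_shift_le (M : ℕ) (m : ℤ) :
    ((((Finset.Ico 0 (M : ℤ)).filter fun r => r + m ∉ Finset.Ico 0 (M : ℤ)).card : ℕ) : ℝ) ≤ |(m : ℝ)| := by
  have h : ((((Finset.Ico 0 (M : ℤ)).filter fun r => r + m ∉ Finset.Ico 0 (M : ℤ)).card : ℕ) : ℤ)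
      ≤ |m| := by
    rcases le_total 0 m with hm | hm
    · have hsub : ((Finset.Ico 0 (M : ℤ)).filter fun r => r + m ∉ Finset.Ico 0 (M : ℤ))
          ⊆ Finset.Ico ((M : ℤ) - m) M := by
        intro r hr
        simp only [Finset.mem_filter, Finset.mem_Ico, not_and, not_lt] at hr ⊢
        have := hr.2 (by omega)
        omega
      have := Finset.card_le_card hsub
      rw [Int.card_Ico] at this
      rw [abs_of_nonneg hm]
      omega
    · have hsub : ((Finset.Ico 0 (M : ℤ)).filter fun r => r + m ∉ Finset.Ico 0 (M : ℤ))
          ⊆ Finset.Ico 0 (-m) := by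
        intro r hr
        simp only [Finset.mem_filter, Finset.mem_Ico, not_and, not_lt] at hr ⊢
        refine ⟨hr.1.1, ?_⟩
        by_contra hc
        have := hr.2 (by omega)
        omega
      have := Finset.card_le_card hsub
      rw [Int.card_Ico] at this
      rw [abs_of_nonpos hm]
      omega
  exact_mod_cast h

/-- A shifted point leaves the square through one of its two coordinates, hence starts in one of two
strips of width at most `‖k‖`. This is `O(M)` points out of `M²`. -/
theorem card_window_shift_le (M : ℕ) (k : Fin 2 → ℤ) :
    ((((window M).filter fun q => q + k ∉ window M).card : ℕ) : ℝ) ≤ 2 * M * ‖k‖ := by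
  classical
  set I := Finset.Ico 0 (M : ℤ) with hI
  set T : Fin 2 → Finset ℤ := fun i => I.filter fun r => r + k i ∉ I with hT
  have hsub : ((window M).filter fun q => q + k ∉ window M)
      ⊆ Fintype.piFinset ![T 0, I] ∪ Fintype.piFinset ![I, T 1] := by
    intro q hq
    simp only [Finset.mem_filter, window, Fintype.mem_piFinset, Fin.forall_fin_two, Pi.add_apply,
      not_and_or, Finset.mem_union, Matrix.cons_val_zero, Matrix.cons_val_one, hT] at hq ⊢
    obtain ⟨⟨h0, h1⟩, h | h⟩ := hq
    · exact Or.inl ⟨⟨h0, h⟩, h1⟩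
    · exact Or.inr ⟨h0, h1, h⟩
  have h1 := (Finset.card_le_card hsub).trans (Finset.card_union_le _ _)
  rw [Fintype.card_piFinset, Fintype.card_piFinset, Fin.prod_univ_two, Fin.prod_univ_two] at h1
  simp only [Matrix.cons_val_zero, Matrix.cons_val_one] at h1
  have hIc : I.card = M := by simp [hI]
  rw [hIc] at h1
  have hk : ∀ i, (((T i).card : ℕ) : ℝ) ≤ ‖k‖ := fun i =>
    (card_Ico_shift_le M (k i)).trans (by
      have := norm_le_pi_norm k i
      rwa [Int.norm_eq_abs] at this)
  have h2 : ((((window M).filter fun q => q + k ∉ window M).card : ℕ) : ℝ)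
      ≤ (T 0).card * M + M * (T 1).card := by exact_mod_cast h1
  refine h2.trans ?_
  have hM : (0 : ℝ) ≤ M := by positivity
  nlinarith [hk 0, hk 1]

theorem norm_le_of_mem_window {M : ℕ} {q : Fin 2 → ℤ} (hq : q ∈ window M) : ‖q‖ ≤ M := by
  refine (pi_norm_le_iff_of_nonneg (by positivity)).2 fun i => ?_
  have := Fintype.mem_piFinset.1 hq i
  rw [Finset.mem_Ico] at this
  rw [Int.norm_eq_abs, abs_of_nonneg (by exact_mod_cast this.1)]
  exact_mod_cast this.2.le

/-- The quantization of a trigonometric polynomial in `x` whose real part is at least `-δ` is at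
least `-δ`, up to an error which is small when the coefficients vary slowly on the scale `ħ`. -/
theorem re_sum_shiftForm_ge (K : Finset (Fin 2 → ℤ)) (b : (Fin 2 → ℤ) → Plane → ℂ)
    {B Λ δ ħ : ℝ} (hħ : 0 ≤ ħ) (hB : ∀ k ∈ K, ∀ ξ, ‖b k ξ‖ ≤ B)
    (hΛ : ∀ k ∈ K, ∀ ξ ξ', ‖b k ξ - b k ξ'‖ ≤ Λ * ‖ξ - ξ'‖) (hΛ0 : 0 ≤ Λ)
    (hb : ∀ ξ x, -δ ≤ (∑ k ∈ K, b k ξ * UnitAddTorus.mFourier k x).re) {M : ℕ} (hM : 0 < M) (v : L2) :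
    -(δ + ∑ k ∈ K, (Λ * (2 * Real.pi * ħ * (2 * M + ‖k‖)) + B * (2 * ‖k‖ / M))) * ‖v‖ ^ 2
      ≤ (∑ k ∈ K, shiftForm k 0 (fun j => b k (midFreq ħ k j)) v).re := by
  classical
  -- On each translated window `p + window M` the coefficients are frozen at `ξ p`, so the Toeplitz
  -- bound applies exactly; the sum over `p` counts every frequency `M²` times. Two errors arise:
  -- unfreezing moves the symbol by `O(ħM)` in frequency, and a fraction `O(‖k‖/M)` of the pairs
  -- leaves the window.
  set ξ : (Fin 2 → ℤ) → Plane := fun p => (2 * Real.pi * ħ) • latticeVec p with hξ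
  have hMr : (0 : ℝ) < M := by exact_mod_cast hM
  have hsum1 : HasSum (fun p => ∑ k ∈ K, ∑ q ∈ window M with q + k ∈ window M,
      starRingEnd ℂ (coef v (p + (q + k))) * b k (ξ p) * coef v (p + q))
      (∑ k ∈ K, ∑ q ∈ window M with q + k ∈ window M,
        shiftForm k 0 (fun j => b k (ξ (j - q))) v) := by
    refine hasSum_sum fun k hk => hasSum_sum fun q _ => ?_
    have ht := shiftForm_translate k 0 q (fun p => b k (ξ p)) v
    rw [zero_add, add_comm k q] at ht
    rw [← ht]
    exact (summable_shiftForm (fun j => hB k hk _) v (q + k) q).hasSum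
  have hsum2 : HasSum (fun p => -δ * ∑ q ∈ window M, ‖coef v (p + q)‖ ^ 2)
      (-δ * ((M : ℝ) ^ 2 * ‖v‖ ^ 2)) := by
    have h := hasSum_sum (s := window M) fun q _ => hasSum_coef_add_sq v q
    rw [Finset.sum_const, card_window, nsmul_eq_mul] at h
    push_cast at h
    exact h.mul_left (-δ)
  have hlow : -δ * ((M : ℝ) ^ 2 * ‖v‖ ^ 2)
      ≤ (∑ k ∈ K, ∑ q ∈ window M with q + k ∈ window M,
        shiftForm k 0 (fun j => b k (ξ (j - q))) v).re := by
    refine hasSum_le (fun p => ?_) hsum2 (Complex.hasSum_re hsum1)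
    have := re_window_sum_ge K (window M) (fun k => b k (ξ p)) (fun q => coef v (p + q))
      (δ := δ) (hb (ξ p))
    exact this
  have hcmp : ∀ k ∈ K, ‖(M : ℂ) ^ 2 * shiftForm k 0 (fun j => b k (midFreq ħ k j)) v
      - ∑ q ∈ window M with q + k ∈ window M, shiftForm k 0 (fun j => b k (ξ (j - q))) v‖
      ≤ (M : ℝ) ^ 2 * ((Λ * (2 * Real.pi * ħ * (2 * M + ‖k‖)) + B * (2 * ‖k‖ / M)) * ‖v‖ ^ 2) := by
    intro k hk
    have hB0 : 0 ≤ B := (norm_nonneg _).trans (hB k hk 0)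
    have e1 : (M : ℂ) ^ 2 * shiftForm k 0 (fun j => b k (midFreq ħ k j)) v
        = ∑ q ∈ window M with q + k ∈ window M, shiftForm k 0 (fun j => b k (midFreq ħ k j)) v
        + ∑ q ∈ window M with q + k ∉ window M, shiftForm k 0 (fun j => b k (midFreq ħ k j)) v := by
      rw [Finset.sum_filter_add_sum_filter_not, Finset.sum_const, card_window, nsmul_eq_mul]
      push_cast; rfl
    rw [e1, add_sub_right_comm, ← Finset.sum_sub_distrib]
    refine (norm_add_le _ _).trans ?_
    have h1 : ‖∑ q ∈ window M with q + k ∈ window M,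
        (shiftForm k 0 (fun j => b k (midFreq ħ k j)) v
          - shiftForm k 0 (fun j => b k (ξ (j - q))) v)‖
        ≤ (M : ℝ) ^ 2 * (Λ * (2 * Real.pi * ħ * (2 * M + ‖k‖)) * ‖v‖ ^ 2) := by
      refine (norm_sum_le_of_le _ (fun q hq => ?_ : ∀ q ∈ (window M).filter _, _
        ≤ Λ * (2 * Real.pi * ħ * (2 * M + ‖k‖)) * ‖v‖ ^ 2)).trans ?_
      · rw [← shiftForm_sub (fun j => hB k hk _) (fun j => hB k hk _)]
        refine norm_shiftForm_le (fun j => (hΛ k hk _ _).trans ?_) v k 0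
        gcongr
        have e2 : midFreq ħ k j - ξ (j - q)
            = (2 * Real.pi * ħ) • (latticeVec q + (1 / 2 : ℝ) • latticeVec k) := by
          rw [midFreq, hξ]
          simp only [latticeVec_sub]
          rw [← smul_sub]
          congr 1
          abel
        rw [e2, norm_smul, Real.norm_of_nonneg (by positivity)]
        gcongr
        refine (norm_add_le _ _).trans ?_
        rw [norm_smul]
        have h3 := norm_latticeVec_le q
        have h4 := norm_latticeVec_le k
        have h5 := norm_le_of_mem_window (Finset.mem_filter.1 hq).1
        have h6 : ‖(1 / 2 : ℝ)‖ = 1 / 2 := by norm_num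
        rw [h6]
        linarith
      · rw [Finset.sum_const, nsmul_eq_mul]
        gcongr
        have := Finset.card_filter_le (window M) (fun q => q + k ∈ window M)
        rw [card_window] at this
        exact_mod_cast this
    have h2 : ‖∑ q ∈ window M with q + k ∉ window M, shiftForm k 0 (fun j => b k (midFreq ħ k j)) v‖
        ≤ (M : ℝ) ^ 2 * (B * (2 * ‖k‖ / M) * ‖v‖ ^ 2) := by
      rw [Finset.sum_const, nsmul_eq_mul, norm_mul, Complex.norm_natCast]
      calc _ ≤ (2 * M * ‖k‖) * (B * ‖v‖ ^ 2) := by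
            gcongr
            · exact card_window_shift_le M k
            · exact norm_shiftForm_le (fun j => hB k hk _) v k 0
        _ = _ := by field_simp
    linarith
  have htot : ‖(M : ℂ) ^ 2 * (∑ k ∈ K, shiftForm k 0 (fun j => b k (midFreq ħ k j)) v)
      - ∑ k ∈ K, ∑ q ∈ window M with q + k ∈ window M,
        shiftForm k 0 (fun j => b k (ξ (j - q))) v‖
      ≤ (M : ℝ) ^ 2 * ((∑ k ∈ K, (Λ * (2 * Real.pi * ħ * (2 * M + ‖k‖)) + B * (2 * ‖k‖ / M)))
        * ‖v‖ ^ 2) := by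
    rw [Finset.mul_sum, ← Finset.sum_sub_distrib, Finset.sum_mul, Finset.mul_sum]
    exact norm_sum_le_of_le _ hcmp
  have hre := (Complex.abs_re_le_norm _).trans htot
  have e5 : ((M : ℂ) ^ 2 * (∑ k ∈ K, shiftForm k 0 (fun j => b k (midFreq ħ k j)) v)).re
      = (M : ℝ) ^ 2 * (∑ k ∈ K, shiftForm k 0 (fun j => b k (midFreq ħ k j)) v).re := by
    have : ((M : ℂ) ^ 2) = (((M : ℝ) ^ 2 : ℝ) : ℂ) := by push_cast; rfl
    rw [this, Complex.re_ofReal_mul]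
  rw [Complex.sub_re, e5] at hre
  have hre' := (abs_le.1 hre).1
  have hM2 : (0 : ℝ) < (M : ℝ) ^ 2 := by positivity
  refine le_of_mul_le_mul_left ?_ hM2
  linarith

/-! ### Smooth functions on the extended phase space -/

/-- The domain of the charts at infinity. -/
def chartDomain : Set (Plane × Plane × ℝ) := {p | 0 ≤ p.2.2}

/-- Smoothness of a function on `T*𝕋² × ℝ̂`, in the three charts. -/
structure SmoothPhase (m : Phase → ℂ) : Prop where
  finite : ContDiff ℝ ∞ (fun p : Plane × Plane × ℝ => m (proj p.1, p.2.1, (p.2.2 : EReal)))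
  top : ContDiffOn ℝ ∞ (fun p : Plane × Plane × ℝ => m (proj p.1, p.2.1, chartTop p.2.2)) chartDomain
  bot : ContDiffOn ℝ ∞ (fun p : Plane × Plane × ℝ => m (proj p.1, p.2.1, chartBot p.2.2)) chartDomain

theorem mem_symbols_iff {a : Phase → ℂ} : a ∈ symbols ↔ HasCompactSupport a ∧ SmoothPhase a :=
  ⟨fun h => ⟨h.1, h.2.1, h.2.2.1, h.2.2.2⟩, fun h => ⟨h.1, h.2.1, h.2.2, h.2.3⟩⟩

theorem SmoothPhase.mul {m n : Phase → ℂ} (hm : SmoothPhase m) (hn : SmoothPhase n) :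
    SmoothPhase (fun p => m p * n p) :=
  ⟨hm.finite.mul hn.finite, hm.top.mul hn.top, hm.bot.mul hn.bot⟩

theorem SmoothPhase.postcomp {m : Phase → ℂ} (hm : SmoothPhase m) (L : ℂ →L[ℝ] ℂ) :
    SmoothPhase (fun p => L (m p)) :=
  ⟨L.contDiff.comp hm.finite, L.contDiff.comp_contDiffOn hm.top, L.contDiff.comp_contDiffOn hm.bot⟩

theorem smoothPhase_of_torus {f : Torus → ℂ} (hf : TorusSmooth f) : SmoothPhase (fun p => f p.1) :=
  have h : ContDiff ℝ ∞ (fun p : Plane × Plane × ℝ => f (proj p.1)) :=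
    ContDiff.comp (g := fun y : Plane => f (proj y)) hf contDiff_fst
  ⟨h, h.contDiffOn, h.contDiffOn⟩

theorem smoothPhase_of_plane {f : Plane → ℂ} (hf : ContDiff ℝ ∞ f) :
    SmoothPhase (fun p => f p.2.1) :=
  have h : ContDiff ℝ ∞ (fun p : Plane × Plane × ℝ => f p.2.1) := hf.comp (contDiff_fst.comp contDiff_snd)
  ⟨h, h.contDiffOn, h.contDiffOn⟩

theorem smoothPhase_of_ereal {g : EReal → ℂ} {g₀ g₁ g₂ : ℝ → ℂ} (h₀ : ContDiff ℝ ∞ g₀)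
    (h₁ : ContDiff ℝ ∞ g₁) (h₂ : ContDiff ℝ ∞ g₂) (e₀ : ∀ s : ℝ, g s = g₀ s)
    (e₁ : ∀ s, 0 ≤ s → g (chartTop s) = g₁ s) (e₂ : ∀ s, 0 ≤ s → g (chartBot s) = g₂ s) :
    SmoothPhase (fun p => g p.2.2) := by
  have hs : ContDiff ℝ ∞ (fun p : Plane × Plane × ℝ => p.2.2) := contDiff_snd.comp contDiff_snd
  refine ⟨?_, ?_, ?_⟩
  · simp only [e₀]; exact h₀.comp hs
  · exact (h₁.comp hs).contDiffOn.congr fun p hp => e₁ _ hp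
  · exact (h₂.comp hs).contDiffOn.congr fun p hp => e₂ _ hp

theorem symbols_mul {a m : Phase → ℂ} (ha : a ∈ symbols) (hm : SmoothPhase m) :
    (fun p => a p * m p) ∈ symbols := by
  rw [mem_symbols_iff] at ha ⊢
  exact ⟨ha.1.mul_right, ha.2.mul hm⟩

theorem symbols_postcomp {a : Phase → ℂ} (ha : a ∈ symbols) (L : ℂ →L[ℝ] ℂ) :
    (fun p => L (a p)) ∈ symbols := by
  rw [mem_symbols_iff] at ha ⊢
  exact ⟨ha.1.comp_left (map_zero L), ha.2.postcomp L⟩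

/-- Freezing the position variable of a symbol. -/
theorem symbols_sample {a : Phase → ℂ} (ha : a ∈ symbols) (x : Torus) :
    (fun p : Phase => a (x, p.2)) ∈ symbols := by
  rw [mem_symbols_iff] at ha ⊢
  obtain ⟨hc, hs⟩ := ha
  refine ⟨?_, ?_⟩
  · have hK : IsCompact ((Set.univ : Set Torus) ×ˢ (Prod.snd '' tsupport a)) :=
      isCompact_univ.prod (hc.isCompact.image continuous_snd)
    refine HasCompactSupport.intro hK fun p hp => ?_
    by_contra h
    exact hp ⟨Set.mem_univ _, ⟨(x, p.2), subset_tsupport _ h, rfl⟩⟩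
  · obtain ⟨y, rfl⟩ := proj_surjective x
    have hl : ContDiff ℝ ∞ (fun p : Plane × Plane × ℝ => (y, p.2)) :=
      contDiff_const.prodMk contDiff_snd
    exact ⟨hs.finite.comp hl, hs.top.comp hl.contDiffOn fun p hp => hp,
      hs.bot.comp hl.contDiffOn fun p hp => hp⟩

/-- A smooth compactly supported function of `ξ` is a symbol. -/
theorem symbols_of_plane {f : Plane → ℂ} (hf : ContDiff ℝ ∞ f) (hc : HasCompactSupport f) :
    (fun p : Phase => f p.2.1) ∈ symbols := by
  rw [mem_symbols_iff]
  refine ⟨?_, smoothPhase_of_plane hf⟩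
  have hK : IsCompact ((Set.univ : Set Torus) ×ˢ (tsupport f ×ˢ (Set.univ : Set EReal))) :=
    isCompact_univ.prod (hc.isCompact.prod isCompact_univ)
  refine HasCompactSupport.intro hK fun p hp => ?_
  by_contra h
  exact hp ⟨Set.mem_univ _, subset_tsupport _ h, Set.mem_univ _⟩

theorem exists_radius {a : Phase → ℂ} (ha : a ∈ symbols) :
    ∃ R : ℝ, 0 < R ∧ ∀ x ξ η, R < ‖ξ‖ → a (x, ξ, η) = 0 := by
  rw [mem_symbols_iff] at ha
  have hK : IsCompact ((fun p : Phase => p.2.1) '' tsupport a) :=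
    ha.1.isCompact.image (by fun_prop)
  obtain ⟨R, hR⟩ := hK.isBounded.subset_closedBall 0
  refine ⟨max R 1, by positivity, fun x ξ η h => ?_⟩
  by_contra hne
  have := hR ⟨(x, ξ, η), subset_tsupport _ hne, rfl⟩
  simp only [Metric.mem_closedBall, dist_zero_right] at this
  exact absurd (h.trans_le this) (not_lt.2 (le_max_left _ _))

/-! ### Charts of the extended line -/

/-- The chart pieces are compact, so bounds obtained by continuity in each chart are global in `η`.
-/
theorem chart_cover (η : EReal) : (∃ s : ℝ, s ∈ Set.Icc (-1 : ℝ) 1 ∧ η = s) ∨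
    (∃ s : ℝ, s ∈ Set.Icc (0 : ℝ) 1 ∧ η = chartTop s) ∨
    ∃ s : ℝ, s ∈ Set.Icc (0 : ℝ) 1 ∧ η = chartBot s := by
  induction η with
  | bot => exact Or.inr (Or.inr ⟨0, by simp, by simp [chartBot]⟩)
  | top => exact Or.inr (Or.inl ⟨0, by simp, by simp [chartTop]⟩)
  | coe r =>
    rcases le_or_gt |r| 1 with h | h
    · exact Or.inl ⟨r, abs_le.1 h, rfl⟩
    · rcases lt_abs.1 h with h | h
      · refine Or.inr (Or.inl ⟨r⁻¹, ⟨by positivity, inv_le_one_of_one_le₀ h.le⟩, ?_⟩)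
        have : r⁻¹ ≠ 0 := by positivity
        simp [chartTop, (by positivity : r ≠ 0)]
      · have hr : 0 < -r := by linarith
        refine Or.inr (Or.inr ⟨(-r)⁻¹, ⟨by positivity, inv_le_one_of_one_le₀ h.le⟩, ?_⟩)
        have : r ≠ 0 := by linarith
        simp [chartBot, this]

/-- The coordinate at `±∞`. -/
def invCoord (η : EReal) : ℝ := η.toReal⁻¹

/-- The conventions `toReal ⊤ = 0` and `0⁻¹ = 0` give `invCoord` the correct value at the endpoint
itself. -/
theorem tendsto_invCoord_top : Tendsto invCoord (𝓝 ⊤) (𝓝 0) := by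
  rw [Metric.tendsto_nhds]
  intro δ hδ
  filter_upwards [EReal.nhds_top_basis.mem_of_mem (i := δ⁻¹) trivial] with η hη
  induction η with
  | bot => simp at hη
  | top => simpa [invCoord] using hδ
  | coe r =>
    have hr : δ⁻¹ < r := by simpa using hη
    have hr0 : 0 < r := (inv_pos.2 hδ).trans hr
    simp only [invCoord, EReal.toReal_coe, dist_zero_right, norm_inv, Real.norm_of_nonneg hr0.le]
    exact inv_lt_of_inv_lt₀ hδ hr

theorem tendsto_invCoord_bot : Tendsto (fun η => -invCoord η) (𝓝 ⊥) (𝓝 0) := by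
  have h : (fun η => -invCoord η) = invCoord ∘ Neg.neg := by
    ext η; simp [invCoord, EReal.toReal_neg_eq, inv_neg]
  rw [h]
  have h2 : Tendsto (fun η : EReal => -η) (𝓝 ⊥) (𝓝 ⊤) := by
    simpa using ((continuous_neg (G := EReal)).tendsto ⊥)
  exact tendsto_invCoord_top.comp h2

/-- Near an endpoint, `f` is its chart expression composed with the coordinate `±1/η`, which tends
to `0⁺` there. -/
theorem continuous_of_charts {Z E : Type*} [TopologicalSpace Z] [TopologicalSpace E]
    {f : Z × EReal → E} (h₀ : Continuous fun p : Z × ℝ => f (p.1, (p.2 : EReal)))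
    (h₁ : ContinuousOn (fun p : Z × ℝ => f (p.1, chartTop p.2)) {p | 0 ≤ p.2})
    (h₂ : ContinuousOn (fun p : Z × ℝ => f (p.1, chartBot p.2)) {p | 0 ≤ p.2}) : Continuous f := by
  rw [continuous_iff_continuousAt]
  rintro ⟨z, η⟩
  induction η with
  | coe r =>
    have he : IsOpenEmbedding (Prod.map (id : Z → Z) (Real.toEReal)) :=
      IsOpenEmbedding.id.prodMap EReal.isOpenEmbedding_coe
    exact (he.continuousAt_iff (x := (z, r))).1 h₀.continuousAt
  | top =>
    have hc := h₁ (z, 0) (by simp)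
    rw [ContinuousWithinAt] at hc
    have h0 : chartTop 0 = ⊤ := by simp [chartTop]
    simp only [h0] at hc
    have hpos : ∀ᶠ p : Z × EReal in 𝓝 (z, ⊤), 0 < p.2 :=
      (continuous_snd.tendsto (z, (⊤ : EReal))).eventually (lt_mem_nhds (by simp))
    have ht : Tendsto (fun p : Z × EReal => (p.1, invCoord p.2)) (𝓝 (z, ⊤))
        (𝓝[{p | 0 ≤ p.2}] (z, 0)) := by
      refine tendsto_nhdsWithin_iff.2 ⟨?_, ?_⟩
      · rw [nhds_prod_eq, nhds_prod_eq]
        exact tendsto_id.prodMap tendsto_invCoord_top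
      · filter_upwards [hpos] with p hp
        exact inv_nonneg.2 (EReal.toReal_nonneg hp.le)
    refine (hc.comp ht).congr' ?_
    filter_upwards [hpos] with p hp
    obtain ⟨z', η⟩ := p
    simp only [Function.comp_apply]
    congr 2
    induction η with
    | bot => simp at hp
    | top => simp [invCoord, chartTop]
    | coe r =>
      have : r ≠ 0 := by rintro rfl; simp at hp
      simp [invCoord, chartTop, this]
  | bot =>
    have hc := h₂ (z, 0) (by simp)
    rw [ContinuousWithinAt] at hc
    have h0 : chartBot 0 = ⊥ := by simp [chartBot]
    simp only [h0] at hc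
    have hpos : ∀ᶠ p : Z × EReal in 𝓝 (z, ⊥), p.2 < 0 :=
      (continuous_snd.tendsto (z, (⊥ : EReal))).eventually (gt_mem_nhds (by simp))
    have ht : Tendsto (fun p : Z × EReal => (p.1, -invCoord p.2)) (𝓝 (z, ⊥))
        (𝓝[{p | 0 ≤ p.2}] (z, 0)) := by
      refine tendsto_nhdsWithin_iff.2 ⟨?_, ?_⟩
      · rw [nhds_prod_eq, nhds_prod_eq]
        exact tendsto_id.prodMap tendsto_invCoord_bot
      · filter_upwards [hpos] with p hp
        exact neg_nonneg.2 (inv_nonpos.2 (EReal.toReal_nonpos hp.le))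
    refine (hc.comp ht).congr' ?_
    filter_upwards [hpos] with p hp
    obtain ⟨z', η⟩ := p
    simp only [Function.comp_apply]
    congr 2
    induction η with
    | bot => simp [invCoord, chartBot]
    | top => simp at hp
    | coe r =>
      have : r ≠ 0 := by rintro rfl; simp at hp
      simp [invCoord, chartBot, this]

theorem SmoothPhase.continuous {m : Phase → ℂ} (hm : SmoothPhase m) : Continuous m := by
  have hq : IsOpenQuotientMap (Prod.map proj (id : Plane × EReal → Plane × EReal)) :=
    isOpenQuotientMap_proj.prodMap IsOpenQuotientMap.id
  refine hq.isQuotientMap.continuous_iff.2 ?_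
  have h : Continuous fun q : (Plane × Plane) × EReal => m (proj q.1.1, q.1.2, q.2) := by
    have hassoc : Continuous fun q : (Plane × Plane) × ℝ => (q.1.1, q.1.2, q.2) := by fun_prop
    refine continuous_of_charts (hm.finite.continuous.comp hassoc)
      (hm.top.continuousOn.comp hassoc.continuousOn fun q hq => hq)
      (hm.bot.continuousOn.comp hassoc.continuousOn fun q hq => hq)
  exact h.comp (by fun_prop : Continuous fun q : Plane × Plane × EReal => ((q.1, q.2.1), q.2.2))

theorem symbols_continuous {a : Phase → ℂ} (ha : a ∈ symbols) : Continuous a :=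
  (mem_symbols_iff.1 ha).2.continuous

theorem symbols_bounded {a : Phase → ℂ} (ha : a ∈ symbols) : ∃ B : ℝ, 0 ≤ B ∧ ∀ p, ‖a p‖ ≤ B := by
  obtain ⟨B, hB⟩ := (mem_symbols_iff.1 ha).1.exists_bound_of_continuous (symbols_continuous ha)
  exact ⟨B, (norm_nonneg _).trans (hB (0, 0, 0)), hB⟩

/-! ### Bounds on derivatives of symbols -/

theorem uniqueDiffOn_chartDomain : UniqueDiffOn ℝ chartDomain := by
  have : chartDomain = (Set.univ : Set Plane) ×ˢ ((Set.univ : Set Plane) ×ˢ Set.Ici (0 : ℝ)) := by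
    ext p; simp [chartDomain]
  rw [this]
  exact uniqueDiffOn_univ.prod (uniqueDiffOn_univ.prod (uniqueDiffOn_Ici 0))

open scoped Pointwise in
-- At the boundary of a chart only derivatives within `S` exist. They are restricted along the
-- affine inclusion `y ↦ (y, p.2)`; by `hSy` the preimage of `S` is the whole plane, so the
-- derivatives in `y` become ordinary ones.
theorem exists_bound_iteratedFDeriv_fst {G : Plane × Plane × ℝ → ℂ} {S : Set (Plane × Plane × ℝ)}
    (hS : UniqueDiffOn ℝ S) (hSy : ∀ p ∈ S, ∀ y : Plane, (p.1 + y, p.2) ∈ S) (hG : ContDiffOn ℝ ∞ G S)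
    {K : Set (Plane × Plane × ℝ)} (hK : IsCompact K) (hKS : K ⊆ S) (n : ℕ) :
    ∃ M : ℝ, ∀ p ∈ K, ‖iteratedFDeriv ℝ n (fun y => G (y, p.2)) p.1‖ ≤ M := by
  obtain ⟨M, hM⟩ := hK.exists_bound_of_continuousOn
    ((hG.continuousOn_iteratedFDerivWithin (natCast_le_infty n) hS).mono hKS)
  refine ⟨M, fun p hp => ?_⟩
  set c : Plane × Plane × ℝ := (0, p.2) with hc
  have hpc : ContinuousLinearMap.inl ℝ Plane (Plane × ℝ) p.1 + c = p := by
    ext1 <;> simp [hc]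
  set S' : Set (Plane × Plane × ℝ) := (fun z => z + c) ⁻¹' S with hS'
  have hS'eq : c +ᵥ S' = S := by
    ext z
    rw [Set.mem_vadd_set_iff_neg_vadd_mem, hS', Set.mem_preimage, vadd_eq_add]
    simp
  have huniv : (ContinuousLinearMap.inl ℝ Plane (Plane × ℝ)) ⁻¹' S' = Set.univ := by
    ext y
    have := hSy p (hKS hp) (y - p.1)
    simpa [hS', hc] using this
  have hG' : ContDiffOn ℝ ∞ (fun z => G (z + c)) S' :=
    hG.comp (contDiff_id.add contDiff_const).contDiffOn fun z hz => hz
  have hS'u : UniqueDiffOn ℝ S' := by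
    have h2 : S' = (-c) +ᵥ S := by rw [← hS'eq, neg_vadd_vadd]
    have h3 : S' = (fun z => -c + z) '' S := by rw [h2]; rfl
    rw [h3]
    intro z hz
    obtain ⟨w, hw, rfl⟩ := hz
    have := (hS w hw)
    exact (hasFDerivWithinAt_id (𝕜 := ℝ) w S |>.const_add (-c)).uniqueDiffWithinAt this
      (by simpa using Function.surjective_id.denseRange)
  have h1 := (ContinuousLinearMap.inl ℝ Plane (Plane × ℝ)).iteratedFDerivWithin_comp_right
    hG' hS'u (by rw [huniv]; exact uniqueDiffOn_univ) (x := p.1)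
    (show ContinuousLinearMap.inl ℝ Plane (Plane × ℝ) p.1 ∈ S' by
      rw [hS', Set.mem_preimage, hpc]; exact hKS hp) (natCast_le_infty n)
  rw [huniv, iteratedFDerivWithin_univ, iteratedFDerivWithin_comp_add_right, hS'eq, hpc] at h1
  have h2 : (fun y => G (y, p.2)) = (fun z => G (z + c)) ∘ (ContinuousLinearMap.inl ℝ Plane (Plane × ℝ)) := by
    ext y; simp [hc]
  rw [h2, h1]
  refine (ContinuousMultilinearMap.norm_compContinuousLinearMap_le _ _).trans ?_
  refine (mul_le_of_le_one_right (norm_nonneg _) ?_).trans (hM p hp)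
  exact Finset.prod_le_one (fun _ _ => norm_nonneg _)
    fun _ _ => ContinuousLinearMap.norm_inl_le_one ℝ _ _

theorem norm_iteratedFDeriv_proj_le {f : Torus → ℂ} {M : ℝ} (n : ℕ)
    (h : ∀ y : Plane, ‖y‖ ≤ 2 → ‖iteratedFDeriv ℝ n (fun y : Plane => f (proj y)) y‖ ≤ M) (y : Plane) :
    ‖iteratedFDeriv ℝ n (fun y : Plane => f (proj y)) y‖ ≤ M := by
  obtain ⟨z, hz, hzy⟩ := exists_proj_eq_norm_le (proj y)
  have hper : (fun y' : Plane => f (proj (y' + (z - y)))) = fun y' => f (proj y') := by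
    ext y'
    rw [proj_add, proj_sub, hzy, sub_self, add_zero]
  have h1 := iteratedFDeriv_comp_add_right (𝕜 := ℝ) (f := fun y : Plane => f (proj y)) n (z - y) y
  rw [hper, add_sub_cancel] at h1
  rw [h1]
  exact h z hz

theorem symbols_torusSmooth {a : Phase → ℂ} (ha : a ∈ symbols) (ξ : Plane) (η : EReal) :
    TorusSmooth (fun x => a (x, ξ, η)) := by
  have hs := (mem_symbols_iff.1 ha).2
  have hl : ∀ s : ℝ, ContDiff ℝ ∞ (fun y : Plane => (y, ξ, s)) := fun s =>
    contDiff_id.prodMk contDiff_const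
  rcases chart_cover η with ⟨s, -, rfl⟩ | ⟨s, hs0, rfl⟩ | ⟨s, hs0, rfl⟩
  · exact hs.finite.comp (hl s)
  · rw [TorusSmooth, ← contDiffOn_univ]
    exact hs.top.comp (hl s).contDiffOn fun y _ => hs0.1
  · rw [TorusSmooth, ← contDiffOn_univ]
    exact hs.bot.comp (hl s).contDiffOn fun y _ => hs0.1

/-- Compactness in every variable: lifts of norm at most `2` in `x`, the support in `ξ`, and the
compact chart pieces in `η`. -/
theorem exists_bound_iteratedFDeriv {a : Phase → ℂ} (ha : a ∈ symbols) (n : ℕ) :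
    ∃ M : ℝ, ∀ ξ η y, ‖iteratedFDeriv ℝ n (fun y : Plane => a (proj y, ξ, η)) y‖ ≤ M := by
  have hs := (mem_symbols_iff.1 ha).2
  obtain ⟨R, hR, hRa⟩ := exists_radius ha
  have hK : ∀ u v : ℝ, IsCompact ((Metric.closedBall (0 : Plane) 2) ×ˢ
      ((Metric.closedBall (0 : Plane) R) ×ˢ Set.Icc u v)) := fun u v =>
    (isCompact_closedBall _ _).prod ((isCompact_closedBall _ _).prod isCompact_Icc)
  obtain ⟨M₀, h₀⟩ := exists_bound_iteratedFDeriv_fst uniqueDiffOn_univ (fun _ _ _ => trivial)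
    hs.finite.contDiffOn (hK (-1) 1) (Set.subset_univ _) n
  have hsub : (Metric.closedBall (0 : Plane) 2) ×ˢ
      ((Metric.closedBall (0 : Plane) R) ×ˢ Set.Icc (0 : ℝ) 1) ⊆ chartDomain := fun p hp => hp.2.2.1
  obtain ⟨M₁, h₁⟩ := exists_bound_iteratedFDeriv_fst uniqueDiffOn_chartDomain (fun _ h _ => h)
    hs.top (hK 0 1) hsub n
  obtain ⟨M₂, h₂⟩ := exists_bound_iteratedFDeriv_fst uniqueDiffOn_chartDomain (fun _ h _ => h)
    hs.bot (hK 0 1) hsub n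
  refine ⟨max (max M₀ M₁) (max M₂ 0), fun ξ η y => ?_⟩
  rcases lt_or_ge R ‖ξ‖ with hξ | hξ
  · have : (fun y : Plane => a (proj y, ξ, η)) = fun _ => 0 := by
      ext y; exact hRa _ _ _ hξ
    rw [this]
    have h0 : iteratedFDeriv ℝ n (fun _ : Plane => (0 : ℂ)) = 0 := iteratedFDeriv_fun_zero
    rw [h0]
    simp
  refine norm_iteratedFDeriv_proj_le (f := fun x => a (x, ξ, η)) n (fun y hy => ?_) y
  have hy' : y ∈ Metric.closedBall (0 : Plane) 2 := by simpa using hy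
  have hξ' : ξ ∈ Metric.closedBall (0 : Plane) R := by simpa using hξ
  rcases chart_cover η with ⟨s, hs0, rfl⟩ | ⟨s, hs0, rfl⟩ | ⟨s, hs0, rfl⟩
  · exact (h₀ (y, ξ, s) ⟨hy', hξ', hs0⟩).trans ((le_max_left _ _).trans (le_max_left _ _))
  · exact (h₁ (y, ξ, s) ⟨hy', hξ', hs0⟩).trans ((le_max_right _ _).trans (le_max_left _ _))
  · exact (h₂ (y, ξ, s) ⟨hy', hξ', hs0⟩).trans ((le_max_left _ _).trans (le_max_right _ _))

/-! ### Lipschitz bounds for symbols independent of the position -/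

/-- Mean value inequality on a convex slab: the derivative vanishes for `‖ξ‖ > R` and is bounded by
compactness elsewhere. -/
theorem lipschitz_piece {G : Plane × ℝ → ℂ} {D : Set (Plane × ℝ)} (hD : UniqueDiffOn ℝ D)
    (hG : ContDiffOn ℝ ∞ G D) {R : ℝ} (hR : ∀ q : Plane × ℝ, R < ‖q.1‖ → G q = 0) {u v : ℝ}
    (hsub : ∀ q : Plane × ℝ, q.2 ∈ Set.Icc u v → q ∈ D) :
    ∃ C : ℝ, 0 ≤ C ∧ ∀ q q' : Plane × ℝ, q.2 ∈ Set.Icc u v → q'.2 ∈ Set.Icc u v →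
      ‖G q - G q'‖ ≤ C * (‖q.1 - q'.1‖ + |q.2 - q'.2|) := by
  have hK : IsCompact ((Metric.closedBall (0 : Plane) R) ×ˢ Set.Icc u v) :=
    (isCompact_closedBall _ _).prod isCompact_Icc
  obtain ⟨M, hM⟩ := hK.exists_bound_of_continuousOn
    ((hG.continuousOn_fderivWithin hD (by exact_mod_cast le_top)).mono fun q hq => hsub q hq.2)
  refine ⟨max M 0, le_max_right _ _, fun q q' hq hq' => ?_⟩
  have hconv : Convex ℝ ((Set.univ : Set Plane) ×ˢ Set.Icc u v) := convex_univ.prod (convex_Icc u v)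
  have hd : ∀ p ∈ (Set.univ : Set Plane) ×ˢ Set.Icc u v,
      HasFDerivWithinAt G (fderivWithin ℝ G D p) ((Set.univ : Set Plane) ×ˢ Set.Icc u v) p :=
    fun p hp => ((hG.differentiableOn (by simp)) p (hsub p hp.2)).hasFDerivWithinAt.mono
      fun p hp => hsub p hp.2
  have hb : ∀ p ∈ (Set.univ : Set Plane) ×ˢ Set.Icc u v, ‖fderivWithin ℝ G D p‖ ≤ max M 0 := by
    intro p hp
    rcases lt_or_ge R ‖p.1‖ with h | h
    · have h0 : G =ᶠ[𝓝[D] p] fun _ => 0 := by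
        refine eventually_nhdsWithin_of_eventually_nhds ?_
        filter_upwards [(continuous_fst.norm.tendsto p).eventually (lt_mem_nhds h)] with q hq
        exact hR q hq
      rw [h0.fderivWithin_eq (hR p h), fderivWithin_const_apply, norm_zero]
      exact le_max_right _ _
    · exact (hM p ⟨by simpa using h, hp.2⟩).trans (le_max_left _ _)
  refine (hconv.norm_image_sub_le_of_norm_hasFDerivWithin_le hd hb (x := q') (y := q)
    ⟨trivial, hq'⟩ ⟨trivial, hq⟩).trans ?_
  gcongr
  rw [Prod.norm_def]
  exact max_le (le_add_of_nonneg_right (abs_nonneg _)) (le_add_of_nonneg_left (norm_nonneg _))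

/-- A Lipschitz condition on the part of `ℝ² × ℝ` over a set of `η`. -/
def LipOver (b : Plane × EReal → ℂ) (C : ℝ) (S : Set ℝ) : Prop :=
  ∀ (ξ ξ' : Plane) (η η' : ℝ), η ∈ S → η' ∈ S → ‖b (ξ, η) - b (ξ', η')‖ ≤ C * (‖ξ - ξ'‖ + |η - η'|)

/-- Two points on opposite sides are joined through `η = c`, where both bounds are available; the
distances in `η` add up exactly. -/
theorem LipOver.union {b : Plane × EReal → ℂ} {C C' : ℝ} {S T : Set ℝ} (hS : LipOver b C S)
    (hT : LipOver b C' T) {c : ℝ} (hcS : c ∈ S) (hcT : c ∈ T)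
    (hSc : ∀ η ∈ S, η ≤ c) (hTc : ∀ η ∈ T, c ≤ η) : LipOver b (max C C') (S ∪ T) := by
  have hm : ∀ r : ℝ, 0 ≤ r → C * r ≤ max C C' * r ∧ C' * r ≤ max C C' * r := fun r hr =>
    ⟨mul_le_mul_of_nonneg_right (le_max_left _ _) hr, mul_le_mul_of_nonneg_right (le_max_right _ _) hr⟩
  have key : ∀ (ξ ξ' : Plane) (η η' : ℝ), η ∈ S → η' ∈ T →
      ‖b (ξ, η) - b (ξ', η')‖ ≤ max C C' * (‖ξ - ξ'‖ + |η - η'|) := by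
    intro ξ ξ' η η' h h'
    have h1 := hS ξ ξ η c h hcS
    have h2 := hT ξ ξ' c η' hcT h'
    have h3 := norm_sub_le_norm_sub_add_norm_sub (b (ξ, (η : EReal))) (b (ξ, (c : EReal))) (b (ξ', (η' : EReal)))
    have h4 : |η - η'| = |η - c| + |c - η'| := by
      have := hSc η h
      have := hTc η' h'
      rw [abs_of_nonpos (by linarith), abs_of_nonpos (by linarith), abs_of_nonpos (by linarith)]
      ring
    rw [sub_self, norm_zero, zero_add] at h1
    have h5 := (hm |η - c| (abs_nonneg _)).1
    have h6 := (hm (‖ξ - ξ'‖ + |c - η'|) (by positivity)).2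
    rw [h4]
    linarith
  rintro ξ ξ' η η' (h | h) (h' | h')
  · exact (hS _ _ _ _ h h').trans (hm _ (by positivity)).1
  · exact key _ _ _ _ h h'
  · rw [norm_sub_rev, norm_sub_rev ξ, abs_sub_comm]
    exact key _ _ _ _ h' h
  · exact (hT _ _ _ _ h h').trans (hm _ (by positivity)).2

theorem abs_inv_sub_inv_le {x y : ℝ} (hx : 1 ≤ x) (hy : 1 ≤ y) : |x⁻¹ - y⁻¹| ≤ |x - y| := by
  have hx0 : 0 < x := by linarith
  have hy0 : 0 < y := by linarith
  rw [inv_sub_inv hx0.ne' hy0.ne', abs_div, abs_of_pos (mul_pos hx0 hy0), abs_sub_comm y]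
  exact div_le_self (abs_nonneg _) (by nlinarith)

/-- Smoothness up to the endpoints gives a Lipschitz bound in `±1/η`, and `η ↦ 1/η` is `1`-Lipschitz
on each half-line `±η ≥ 1`. The bound is therefore global in `η`, which allows the substitution `η =
H_Λ(ξ)/ε`. -/
theorem fiber_symbol_lipschitz {b : Plane × EReal → ℂ} (hb : (fun p : Phase => b p.2) ∈ symbols) :
    ∃ C : ℝ, 0 ≤ C ∧ LipOver b C Set.univ := by
  have hs := (mem_symbols_iff.1 hb).2
  obtain ⟨R, hR, hRb⟩ := exists_radius hb
  have hRb' : ∀ ξ η, R < ‖ξ‖ → b (ξ, η) = 0 := fun ξ η h => hRb 0 ξ η h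
  have hl : ContDiff ℝ ∞ (fun q : Plane × ℝ => ((0 : Plane), q)) := contDiff_const.prodMk contDiff_id
  have hDu : UniqueDiffOn ℝ {q : Plane × ℝ | 0 ≤ q.2} := by
    have : {q : Plane × ℝ | 0 ≤ q.2} = (Set.univ : Set Plane) ×ˢ Set.Ici (0 : ℝ) := by ext; simp
    rw [this]; exact uniqueDiffOn_univ.prod (uniqueDiffOn_Ici 0)
  have g0 : ContDiffOn ℝ ∞ (fun q : Plane × ℝ => b (q.1, (q.2 : EReal))) Set.univ :=
    (hs.finite.comp hl).contDiffOn
  have g1 : ContDiffOn ℝ ∞ (fun q : Plane × ℝ => b (q.1, chartTop q.2)) {q | 0 ≤ q.2} :=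
    hs.top.comp hl.contDiffOn fun q hq => hq
  have g2 : ContDiffOn ℝ ∞ (fun q : Plane × ℝ => b (q.1, chartBot q.2)) {q | 0 ≤ q.2} :=
    hs.bot.comp hl.contDiffOn fun q hq => hq
  obtain ⟨C₀, hC₀, h₀⟩ := lipschitz_piece uniqueDiffOn_univ g0 (fun q h => hRb' _ _ h)
    (u := -1) (v := 1) (fun _ _ => trivial)
  obtain ⟨C₁, hC₁, h₁⟩ := lipschitz_piece hDu g1 (fun q h => hRb' _ _ h)
    (u := 0) (v := 1) (fun _ h => h.1)
  obtain ⟨C₂, hC₂, h₂⟩ := lipschitz_piece hDu g2 (fun q h => hRb' _ _ h)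
    (u := 0) (v := 1) (fun _ h => h.1)
  have l0 : LipOver b C₀ (Set.Icc (-1) 1) := fun ξ ξ' η η' h h' => h₀ (ξ, η) (ξ', η') h h'
  have hinv : ∀ η : ℝ, 1 ≤ η → η⁻¹ ∈ Set.Icc (0 : ℝ) 1 := fun η h =>
    ⟨by positivity, inv_le_one_of_one_le₀ h⟩
  have l1 : LipOver b C₁ (Set.Ici 1) := by
    intro ξ ξ' η η' h h'
    have e : ∀ η : ℝ, 1 ≤ η → chartTop η⁻¹ = η := fun η h => by
      have : η ≠ 0 := by positivity
      simp [chartTop, this]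
    have := h₁ (ξ, η⁻¹) (ξ', η'⁻¹) (hinv η h) (hinv η' h')
    simp only [e η h, e η' h'] at this
    refine this.trans ?_
    exact mul_le_mul_of_nonneg_left (add_le_add le_rfl (abs_inv_sub_inv_le h h')) hC₁
  have l2 : LipOver b C₂ (Set.Iic (-1)) := by
    intro ξ ξ' η η' h h'
    rw [Set.mem_Iic] at h h'
    have e : ∀ η : ℝ, η ≤ -1 → chartBot (-η)⁻¹ = η := fun η h => by
      have : η ≠ 0 := by linarith
      simp [chartBot, this]
    have := h₂ (ξ, (-η)⁻¹) (ξ', (-η')⁻¹) (hinv _ (by linarith)) (hinv _ (by linarith))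
    simp only [e η h, e η' h'] at this
    refine this.trans ?_
    refine mul_le_mul_of_nonneg_left (add_le_add le_rfl ?_) hC₂
    refine (abs_inv_sub_inv_le (x := -η) (y := -η') (by linarith) (by linarith)).trans_eq ?_
    rw [← abs_neg]; congr 1; ring
  have l02 := l2.union l0 (c := -1) (by simp) (by simp) (fun _ h => h) (fun _ h => h.1)
  have l012 := l02.union l1 (c := 1) (by simp) (by simp)
    (by rintro η (h | h); exacts [le_trans h (by norm_num), h.2]) (fun _ h => h)
  refine ⟨_, le_max_of_le_right hC₁, fun ξ ξ' η η' _ _ => l012 ξ ξ' η η' ?_ ?_⟩ <;>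
  · simp only [Set.mem_union, Set.mem_Iic, Set.mem_Icc, Set.mem_Ici]
    grind

/-! ### Separability of the space of symbols -/

/-- Symbols supported in a fixed ball restrict to a compact set `K`, and every subset of the
separable space `C(K)` is separable, so the dense family can be chosen inside `S`. The density is
uniform only; derivatives are recovered by interpolation. -/
theorem exists_countable_dense_symbols (S : Set (Phase → ℂ)) (hS : S ⊆ symbols) :
    ∃ D ⊆ S, D.Countable ∧ ∀ a ∈ S, ∀ δ > 0, ∃ d ∈ D, ∀ p, ‖a p - d p‖ ≤ δ := by
  have hR : ∀ R : ℕ, ∃ D ⊆ S, D.Countable ∧ ∀ a ∈ S, (∀ x ξ η, (R : ℝ) < ‖ξ‖ → a (x, ξ, η) = 0) →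
      ∀ δ > 0, ∃ d ∈ D, ∀ p, ‖a p - d p‖ ≤ δ := by
    intro R
    set K : Set Phase := Set.univ ×ˢ (Metric.closedBall (0 : Plane) R ×ˢ Set.univ) with hK
    have hKc : IsCompact K := isCompact_univ.prod ((isCompact_closedBall _ _).prod isCompact_univ)
    have : CompactSpace K := isCompact_iff_compactSpace.1 hKc
    set S' := {a : Phase → ℂ | a ∈ S ∧ ∀ x ξ η, (R : ℝ) < ‖ξ‖ → a (x, ξ, η) = 0} with hS'
    set r : S' → C(K, ℂ) := fun a => ⟨fun p => a.1 p, (symbols_continuous (hS a.2.1)).comp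
      continuous_subtype_val⟩ with hr
    obtain ⟨T, hTs, hTc, hTd⟩ := (TopologicalSpace.IsSeparable.of_separableSpace
      (Set.range r)).exists_countable_dense_subset
    choose g hg using fun t : T => hTs t.2
    have := hTc.to_subtype
    refine ⟨Set.range fun t => (g t).1, ?_, Set.countable_range _, ?_⟩
    · rintro _ ⟨t, rfl⟩; exact (g t).2.1
    · intro a ha ha0 δ hδ
      obtain ⟨t, ht, hdist⟩ := Metric.mem_closure_iff.1 (hTd ⟨⟨a, ha, ha0⟩, rfl⟩) δ hδ
      refine ⟨_, ⟨⟨t, ht⟩, rfl⟩, fun p => ?_⟩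
      change ‖a p - (g ⟨t, ht⟩).1 p‖ ≤ δ
      by_cases hp : p ∈ K
      · have hdist : dist (r ⟨a, ha, ha0⟩) (r (g ⟨t, ht⟩)) < δ := by rwa [hg]
        have := (ContinuousMap.dist_apply_le_dist (f := r ⟨a, ha, ha0⟩) (g := r (g ⟨t, ht⟩)) ⟨p, hp⟩).trans
          hdist.le
        rwa [dist_eq_norm] at this
      · have hpR : (R : ℝ) < ‖p.2.1‖ := by
          by_contra hc
          exact hp ⟨trivial, by simpa using hc, trivial⟩
        have h1 := ha0 p.1 p.2.1 p.2.2 hpR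
        have h2 := (g ⟨t, ht⟩).2.2 p.1 p.2.1 p.2.2 hpR
        simp only [Prod.mk.eta] at h1 h2
        rw [h1, h2]; simpa using hδ.le
  choose D hDS hDc hD using hR
  refine ⟨⋃ R, D R, Set.iUnion_subset hDS, Set.countable_iUnion hDc, fun a ha δ hδ => ?_⟩
  obtain ⟨R, -, hRa⟩ := exists_radius (hS ha)
  obtain ⟨n, hn⟩ := exists_nat_ge R
  obtain ⟨d, hd, h⟩ := hD n a ha (fun x ξ η h => hRa x ξ η (hn.trans_lt h)) δ hδ
  exact ⟨d, Set.mem_iUnion.2 ⟨n, hd⟩, h⟩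

/-! ### Trigonometric interpolation on a grid -/

/-- The number of points of the grid on each axis. -/
def gridSize (N : ℕ) : ℕ := 2 * N + 1

/-- The frequencies of the trigonometric polynomials used for the interpolation. -/
def freqBox (N : ℕ) : Finset (Fin 2 → ℤ) := Fintype.piFinset fun _ => Finset.Icc (-(N : ℤ)) N

def gridPoint (N : ℕ) (g : Fin 2 → Fin (gridSize N)) : Torus :=
  fun i => (((g i : ℕ) / (gridSize N : ℝ) : ℝ) : UnitAddCircle)

/-- A finite combination of values of `f`. Applied to a symbol at fixed `(ξ, η)`, it clearly gives a
symbol again, with no integral depending on parameters, and it is controlled by the uniform norm. -/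
def gridCoef (N : ℕ) (f : Torus → ℂ) (κ : Fin 2 → ℤ) : ℂ :=
  ((gridSize N : ℂ) ^ 2)⁻¹ * ∑ g, f (gridPoint N g) * UnitAddTorus.mFourier (-κ) (gridPoint N g)

def gridInterp (N : ℕ) (f : Torus → ℂ) (x : Torus) : ℂ :=
  ∑ κ ∈ freqBox N, gridCoef N f κ * UnitAddTorus.mFourier κ x

/-- The frequency of the box which is equal to a given one on the grid. -/
def aliasFreq (N : ℕ) (l : Fin 2 → ℤ) : Fin 2 → ℤ := fun i => Int.bmod (l i) (gridSize N)

theorem gridSize_pos (N : ℕ) : 0 < gridSize N := by unfold gridSize; omega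

theorem mem_freqBox {N : ℕ} {κ : Fin 2 → ℤ} : κ ∈ freqBox N ↔ ∀ i, -(N : ℤ) ≤ κ i ∧ κ i ≤ N := by
  simp [freqBox]

theorem mem_freqBox_iff_norm {N : ℕ} {κ : Fin 2 → ℤ} : κ ∈ freqBox N ↔ ‖κ‖ ≤ N := by
  rw [mem_freqBox, pi_norm_le_iff_of_nonneg (by positivity)]
  refine forall_congr' fun i => ?_
  rw [Int.norm_eq_abs, abs_le]
  exact_mod_cast Iff.rfl

theorem aliasFreq_bounds (N : ℕ) (l : Fin 2 → ℤ) (i : Fin 2) :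
    -(N : ℤ) ≤ aliasFreq N l i ∧ aliasFreq N l i ≤ N := by
  have h1 := Int.le_bmod (x := l i) (gridSize_pos N)
  have h2 := Int.bmod_lt (x := l i) (gridSize_pos N)
  unfold aliasFreq
  unfold gridSize at *
  omega

theorem aliasFreq_mem (N : ℕ) (l : Fin 2 → ℤ) : aliasFreq N l ∈ freqBox N :=
  mem_freqBox.2 (aliasFreq_bounds N l)

theorem dvd_sub_aliasFreq (N : ℕ) (l : Fin 2 → ℤ) (i : Fin 2) :
    (gridSize N : ℤ) ∣ l i - aliasFreq N l i := Int.dvd_self_sub_bmod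

/-- The box has odd side `2N + 1`, so each residue class modulo `gridSize N` is represented in it
exactly once. -/
theorem eq_aliasFreq {N : ℕ} {κ l : Fin 2 → ℤ} (hκ : κ ∈ freqBox N)
    (h : ∀ i, (gridSize N : ℤ) ∣ l i - κ i) : κ = aliasFreq N l := by
  funext i
  have h1 := mem_freqBox.1 hκ i
  have h2 := aliasFreq_bounds N l i
  have h3 : (gridSize N : ℤ) ∣ aliasFreq N l i - κ i := by
    have := dvd_sub (h i) (dvd_sub_aliasFreq N l i)
    rwa [sub_sub_sub_cancel_left] at this
  have h4 := Int.eq_zero_of_abs_lt_dvd h3 (by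
    rw [abs_lt]; unfold gridSize; constructor <;> push_cast <;> omega)
  omega

theorem aliasFreq_of_mem {N : ℕ} {l : Fin 2 → ℤ} (hl : l ∈ freqBox N) : aliasFreq N l = l :=
  (eq_aliasFreq hl fun i => by simp).symm

/-- Aliasing never raises the frequency, so the derivatives of the aliased mode obey the bounds of
the original one. -/
theorem norm_aliasFreq_le (N : ℕ) (l : Fin 2 → ℤ) : ‖aliasFreq N l‖ ≤ ‖l‖ := by
  by_cases hl : l ∈ freqBox N
  · rw [aliasFreq_of_mem hl]
  · have h1 := mem_freqBox_iff_norm.1 (aliasFreq_mem N l)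
    rw [mem_freqBox_iff_norm, not_le] at hl
    exact h1.trans hl.le

theorem sum_fourier_grid {M : ℕ} (hM : 0 < M) (k : ℤ) :
    ∑ g : Fin M, fourier k (((g : ℕ) / (M : ℝ) : ℝ) : UnitAddCircle) = if (M : ℤ) ∣ k then (M : ℂ) else 0 := by
  have hM0 : (M : ℂ) ≠ 0 := by exact_mod_cast hM.ne'
  set ζ : ℂ := Complex.exp (2 * Real.pi * Complex.I * k / M) with hζ
  have h1 : ∀ g : Fin M, fourier k (((g : ℕ) / (M : ℝ) : ℝ) : UnitAddCircle) = ζ ^ (g : ℕ) := by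
    intro g
    rw [fourier_coe_apply, hζ, ← Complex.exp_nat_mul]
    congr 1
    push_cast
    field_simp
  simp only [h1]
  rw [Fin.sum_univ_eq_sum_range (fun i => ζ ^ i) M]
  have h2 : ζ ^ M = 1 := by
    rw [hζ, ← Complex.exp_nat_mul, Complex.exp_eq_one_iff]
    exact ⟨k, by field_simp⟩
  split_ifs with hd
  · obtain ⟨m, rfl⟩ := hd
    have : ζ = 1 := by
      rw [hζ, Complex.exp_eq_one_iff]
      exact ⟨m, by push_cast; field_simp⟩
    simp [this]
  · have : ζ ≠ 1 := by
      rw [hζ, Ne, Complex.exp_eq_one_iff]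
      rintro ⟨m, hm⟩
      apply hd
      refine ⟨m, ?_⟩
      have hpi : (2 * Real.pi * Complex.I : ℂ) ≠ 0 := Complex.two_pi_I_ne_zero
      have : (k : ℂ) = M * m := by
        field_simp at hm
        exact hm
      exact_mod_cast this
    have h3 := mul_neg_geom_sum ζ M
    rw [h2, sub_self] at h3
    exact (mul_eq_zero.1 h3).resolve_left (sub_ne_zero.2 this.symm)

theorem gridCoef_mFourier (N : ℕ) (l κ : Fin 2 → ℤ) (hκ : κ ∈ freqBox N) :
    gridCoef N (UnitAddTorus.mFourier l) κ = if κ = aliasFreq N l then 1 else 0 := by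
  have h1 : ∀ g, UnitAddTorus.mFourier l (gridPoint N g) * UnitAddTorus.mFourier (-κ) (gridPoint N g) =
      ∏ i, fourier (l i - κ i) (((g i : ℕ) / (gridSize N : ℝ) : ℝ) : UnitAddCircle) := by
    intro g
    rw [← UnitAddTorus.mFourier_add, ← sub_eq_add_neg]
    rfl
  have h2 : ∑ g : Fin 2 → Fin (gridSize N), ∏ i, fourier (l i - κ i) (((g i : ℕ) / (gridSize N : ℝ) : ℝ) : UnitAddCircle)
      = ∏ i : Fin 2, ∑ g : Fin (gridSize N), fourier (l i - κ i) (((g : ℕ) / (gridSize N : ℝ) : ℝ) : UnitAddCircle) := by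
    rw [Finset.prod_univ_sum, Fintype.piFinset_univ]
  have hM : (gridSize N : ℂ) ≠ 0 := by exact_mod_cast (gridSize_pos N).ne'
  rw [gridCoef, Finset.sum_congr rfl fun g _ => h1 g, h2]
  simp only [sum_fourier_grid (gridSize_pos N)]
  split_ifs with h
  · subst h
    simp only [dvd_sub_aliasFreq, if_true, Finset.prod_const, Finset.card_univ, Fintype.card_fin]
    field_simp
  · obtain ⟨i, hi⟩ : ∃ i, ¬ (gridSize N : ℤ) ∣ l i - κ i := by
      by_contra hc
      push Not at hc
      exact h (eq_aliasFreq hκ hc)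
    rw [Finset.prod_eq_zero (Finset.mem_univ i) (if_neg hi), mul_zero]

theorem gridInterp_mFourier (N : ℕ) (l : Fin 2 → ℤ) (x : Torus) :
    gridInterp N (UnitAddTorus.mFourier l) x = UnitAddTorus.mFourier (aliasFreq N l) x := by
  rw [gridInterp, Finset.sum_eq_single_of_mem _ (aliasFreq_mem N l)]
  · rw [gridCoef_mFourier _ _ _ (aliasFreq_mem N l), if_pos rfl, one_mul]
  · intro κ hκ h
    rw [gridCoef_mFourier _ _ _ hκ, if_neg h, zero_mul]

/-- On the grid a mode cannot be told from its alias, so interpolation only replaces each mode of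
the series by its alias. -/
theorem hasSum_gridInterp {f : Torus → ℂ} (hf : Continuous f) (hs : Summable (torusCoef f)) (N : ℕ) (x : Torus) :
    HasSum (fun l => torusCoef f l * UnitAddTorus.mFourier (aliasFreq N l) x) (gridInterp N f x) := by
  have hp : ∀ y, HasSum (fun l => torusCoef f l * UnitAddTorus.mFourier l y) (f y) := fun y => by
    have := (ContinuousMap.evalCLM ℂ y).hasSum (hasSum_torusCoef hf hs)
    simpa using this
  have : HasSum (fun l => gridInterp N (fun y => torusCoef f l * UnitAddTorus.mFourier l y) x)
      (gridInterp N f x) := by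
    unfold gridInterp gridCoef
    exact hasSum_sum fun κ _ => (((hasSum_sum fun g _ => (hp _).mul_right _)).mul_left _).mul_right _
  have h2 : ∀ l, gridInterp N (fun y => torusCoef f l * UnitAddTorus.mFourier l y) x
      = torusCoef f l * UnitAddTorus.mFourier (aliasFreq N l) x := fun l => by
    rw [← gridInterp_mFourier]
    simp only [gridInterp, gridCoef, Finset.mul_sum, Finset.sum_mul]
    exact Finset.sum_congr rfl fun κ _ => Finset.sum_congr rfl fun g _ => by ring
  simpa only [h2] using this

/-- The part of the series `∑ (1 + ‖l‖)⁻³` outside of a box. -/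
def tailTerm (N : ℕ) (l : Fin 2 → ℤ) : ℝ :=
  Set.indicator {l | l ∉ freqBox N} (fun l => ((1 + ‖l‖) ^ 3)⁻¹) l

theorem summable_tailTerm (N : ℕ) : Summable (tailTerm N) := summable_one_add_norm_inv.indicator _

theorem tendsto_tsum_tailTerm : Tendsto (fun N => ∑' l, tailTerm N l) atTop (𝓝 0) := by
  have h : Tendsto freqBox atTop atTop := by
    refine tendsto_atTop_finset_of_monotone (fun N N' h κ hκ => ?_) fun κ => ?_
    · rw [mem_freqBox_iff_norm] at hκ ⊢
      exact hκ.trans (by exact_mod_cast h)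
    · obtain ⟨N, hN⟩ := exists_nat_ge ‖κ‖
      exact ⟨N, mem_freqBox_iff_norm.2 hN⟩
  refine ((tendsto_tsum_compl_atTop_zero fun l : Fin 2 → ℤ => ((1 + ‖l‖) ^ 3)⁻¹).comp h).congr
    fun N => ?_
  exact tsum_subtype {l | l ∉ freqBox N} fun l : Fin 2 → ℤ => ((1 + ‖l‖) ^ 3)⁻¹

theorem norm_iteratedFDeriv_mFourier_sub_le {N : ℕ} (l : Fin 2 → ℤ) {j : ℕ} (hj : j ≤ 3) (y : Plane) :
    ‖iteratedFDeriv ℝ j (fun y : Plane => UnitAddTorus.mFourier (aliasFreq N l) (proj y) -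
      UnitAddTorus.mFourier l (proj y)) y‖ ≤ 2 * (4 * Real.pi) ^ 3 * (1 + ‖l‖) ^ 3 := by
  have hpi : 1 ≤ 4 * Real.pi := by linarith [Real.pi_gt_three]
  have hb : ∀ m : Fin 2 → ℤ, ‖m‖ ≤ ‖l‖ →
      ‖iteratedFDeriv ℝ j (fun y : Plane => UnitAddTorus.mFourier m (proj y)) y‖ ≤
        (4 * Real.pi) ^ 3 * (1 + ‖l‖) ^ 3 := fun m hm => by
    refine (norm_iteratedFDeriv_mFourier_le m j y).trans ?_
    rw [← mul_pow]
    refine (pow_le_pow_left₀ (by positivity) (b := 4 * Real.pi * (1 + ‖l‖)) ?_ j).trans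
      (pow_le_pow_right₀ ?_ hj)
    · gcongr; linarith
    · nlinarith [norm_nonneg l]
  have h := iteratedFDeriv_sub_apply
    (((contDiff_mFourier_proj (aliasFreq N l)).of_le (natCast_le_infty j)).contDiffAt (x := y))
    (((contDiff_mFourier_proj l).of_le (natCast_le_infty j)).contDiffAt (x := y))
  have h' : iteratedFDeriv ℝ j (fun y : Plane => UnitAddTorus.mFourier (aliasFreq N l) (proj y) -
      UnitAddTorus.mFourier l (proj y)) y = _ := h
  rw [h']
  refine (norm_sub_le _ _).trans ?_
  linarith [hb _ (norm_aliasFreq_le N l), hb l le_rfl]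

/-- Modes in the box are reproduced exactly, so the error is a tail of the Fourier series. Six
derivatives are used: three for the `C³` norm and three for the convergence of the tail. -/
theorem norm_iteratedFDeriv_gridInterp_sub_le {f : Torus → ℂ} (hf : TorusSmooth f) {M : ℝ}
    (h0 : ∀ x, ‖f x‖ ≤ M)
    (hM : ∀ y, ‖iteratedFDeriv ℝ 6 (fun y : Plane => f (proj y)) y‖ ≤ M) (N : ℕ) {j : ℕ} (hj : j ≤ 3)
    (y : Plane) :
    ‖iteratedFDeriv ℝ j (fun y : Plane => gridInterp N f (proj y) - f (proj y)) y‖ ≤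
      M * 2 ^ 6 * (2 * (4 * Real.pi) ^ 3) * ∑' l, tailTerm N l := by
  have hM0 : 0 ≤ M := (norm_nonneg _).trans (h0 0)
  have hs : Summable (torusCoef f) :=
    (summable_norm_of_weighted (TorusSmooth.summable_torusCoef hf)).of_norm
  set F : (Fin 2 → ℤ) → Plane → ℂ := fun l y =>
    torusCoef f l • (UnitAddTorus.mFourier (aliasFreq N l) (proj y) - UnitAddTorus.mFourier l (proj y))
  have hF : ∀ l, ContDiff ℝ (3 : ℕ∞) (F l) := fun l => ContDiff.const_smul _
    (((contDiff_mFourier_proj _).sub (contDiff_mFourier_proj _)).of_le (natCast_le_infty 3))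
  have hsum : (fun y : Plane => gridInterp N f (proj y) - f (proj y)) = fun y => ∑' l, F l y := by
    funext y
    have h1 := hasSum_gridInterp hf.continuous hs N (proj y)
    have h2 : HasSum (fun l => torusCoef f l * UnitAddTorus.mFourier l (proj y)) (f (proj y)) := by
      have := (ContinuousMap.evalCLM ℂ (proj y)).hasSum (hasSum_torusCoef hf.continuous hs)
      simpa using this
    refine ((h1.sub h2).congr_fun fun l => ?_).tsum_eq.symm
    simp only [F, smul_eq_mul, mul_sub]
  set u : ℝ := M * 2 ^ 6 * (2 * (4 * Real.pi) ^ 3) with hu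
  have hb : ∀ (i : ℕ) (l : Fin 2 → ℤ) (y : Plane), (i : ℕ∞) ≤ (3 : ℕ∞) →
      ‖iteratedFDeriv ℝ i (F l) y‖ ≤ u * tailTerm N l := by
    intro i l y hi
    by_cases hl : l ∈ freqBox N
    · have : F l = fun _ => 0 := by
        funext y; simp [F, aliasFreq_of_mem hl]
      rw [this, iteratedFDeriv_fun_zero]
      simp [tailTerm, hl]
    · have h1 : ‖iteratedFDeriv ℝ i (F l) y‖ ≤ ‖torusCoef f l‖ * (2 * (4 * Real.pi) ^ 3 * (1 + ‖l‖) ^ 3) := by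
        rw [iteratedFDeriv_const_smul_apply' (((contDiff_mFourier_proj _).sub
          (contDiff_mFourier_proj _)).of_le (natCast_le_infty i)).contDiffAt, norm_smul]
        exact mul_le_mul_of_nonneg_left
          (norm_iteratedFDeriv_mFourier_sub_le l (by exact_mod_cast hi) y) (norm_nonneg _)
      refine h1.trans ?_
      have h2 := norm_torusCoef_mul_pow_le hf 6 h0 hM l
      have h3 : tailTerm N l = ((1 + ‖l‖) ^ 3)⁻¹ := Set.indicator_of_mem (s := {l | l ∉ freqBox N}) hl _
      rw [h3, ← div_eq_mul_inv, le_div_iff₀ (by positivity), hu]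
      calc _ = ‖torusCoef f l‖ * (1 + ‖l‖) ^ 6 * (2 * (4 * Real.pi) ^ 3) := by ring
        _ ≤ _ := by gcongr
  rw [hsum, iteratedFDeriv_tsum_apply (N := 3) hF
    (v := fun _ l => u * tailTerm N l) (fun _ _ => (summable_tailTerm N).mul_left u) hb
    (by exact_mod_cast hj)]
  refine (tsum_of_norm_bounded ((summable_tailTerm N).mul_left u).hasSum
    fun l => hb j l y (by exact_mod_cast hj)).trans_eq tsum_mul_left

/-! ### Interpolation of symbols -/

def interp (N : ℕ) (a : Phase → ℂ) (p : Phase) : ℂ := gridInterp N (fun x => a (x, p.2)) p.1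

/-- The symbol `b(ξ, η) e_κ(x)`. -/
def modeSymbol (κ : Fin 2 → ℤ) (b : Plane × EReal → ℂ) (p : Phase) : ℂ :=
  b p.2 * UnitAddTorus.mFourier κ p.1

theorem modeSymbol_mem {b : Plane × EReal → ℂ} (hb : (fun p : Phase => b p.2) ∈ symbols) (κ : Fin 2 → ℤ) :
    modeSymbol κ b ∈ symbols :=
  symbols_mul hb (smoothPhase_of_torus (torusSmooth_mFourier κ))

def interpCoef (N : ℕ) (a : Phase → ℂ) (κ : Fin 2 → ℤ) (q : Plane × EReal) : ℂ :=
  gridCoef N (fun x => a (x, q)) κ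

theorem interpCoef_mem {a : Phase → ℂ} (ha : a ∈ symbols) (N : ℕ) (κ : Fin 2 → ℤ) :
    (fun p : Phase => interpCoef N a κ p.2) ∈ symbols := by
  have h : (fun p : Phase => interpCoef N a κ p.2) = ((gridSize N : ℂ) ^ 2)⁻¹ •
      ∑ g, UnitAddTorus.mFourier (-κ) (gridPoint N g) • fun p : Phase => a (gridPoint N g, p.2) := by
    funext p
    simp only [interpCoef, gridCoef, Pi.smul_apply, Finset.sum_apply, smul_eq_mul, mul_comm]
  rw [h]
  exact symbols.smul_mem _ (symbols.sum_mem fun g _ => symbols.smul_mem _ (symbols_sample ha _))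

theorem interp_eq_sum (N : ℕ) (a : Phase → ℂ) :
    interp N a = ∑ κ ∈ freqBox N, modeSymbol κ (interpCoef N a κ) := by
  funext p
  simp only [interp, gridInterp, Finset.sum_apply, modeSymbol, interpCoef]

theorem interp_mem {a : Phase → ℂ} (ha : a ∈ symbols) (N : ℕ) : interp N a ∈ symbols := by
  rw [interp_eq_sum]
  exact symbols.sum_mem fun κ _ => modeSymbol_mem (interpCoef_mem ha N κ) κ

theorem interp_sub (N : ℕ) (a d : Phase → ℂ) : interp N (a - d) = interp N a - interp N d := by
  funext p
  simp only [interp, gridInterp, gridCoef, Pi.sub_apply, sub_mul, Finset.sum_sub_distrib, mul_sub]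

theorem bnormLE_interp_sub {a : Phase → ℂ} (ha : a ∈ symbols) :
    ∃ r : ℕ → ℝ, Tendsto r atTop (𝓝 0) ∧ ∀ N, BNormLE (interp N a - a) (r N) := by
  obtain ⟨B, hB0, hB⟩ := symbols_bounded ha
  obtain ⟨M, hM⟩ := exists_bound_iteratedFDeriv ha 6
  refine ⟨fun N => max B M * 2 ^ 6 * (2 * (4 * Real.pi) ^ 3) * ∑' l, tailTerm N l, ?_, fun N j hj ξ η y => ?_⟩
  · simpa using tendsto_tsum_tailTerm.const_mul (max B M * 2 ^ 6 * (2 * (4 * Real.pi) ^ 3))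
  · exact norm_iteratedFDeriv_gridInterp_sub_le (symbols_torusSmooth ha ξ η)
      (fun x => (hB _).trans (le_max_left _ _)) (fun y => (hM ξ η y).trans (le_max_right _ _)) N hj y

theorem norm_gridCoef_le {f : Torus → ℂ} {s : ℝ} (h : ∀ x, ‖f x‖ ≤ s) (N : ℕ) (κ : Fin 2 → ℤ) :
    ‖gridCoef N f κ‖ ≤ s := by
  have hM : (0 : ℝ) < gridSize N := by exact_mod_cast gridSize_pos N
  rw [gridCoef, norm_mul, norm_inv, norm_pow, Complex.norm_natCast, inv_mul_le_iff₀ (by positivity)]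
  refine (norm_sum_le_of_le _ (fun g _ => (norm_mul_le _ _).trans
    (by rw [norm_mFourier_apply, mul_one]; exact h _ : _ ≤ s))).trans_eq ?_
  simp

/-- For fixed `N` the interpolant has bounded degree in `x`, so its `C³` norm is controlled by a
uniform norm. This compensates for a density that is only uniform; the dependence of the constant on
`N` is harmless. -/
theorem bnormLE_interp (N : ℕ) : ∃ C : ℝ, 0 ≤ C ∧ ∀ (a : Phase → ℂ) (s : ℝ), (∀ p, ‖a p‖ ≤ s) →
    BNormLE (interp N a) (C * s) := by
  refine ⟨∑ κ ∈ freqBox N, (1 + 4 * Real.pi * ‖κ‖) ^ 3, by positivity, fun a s ha j hj ξ η y => ?_⟩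
  have h : (fun y' : Plane => interp N a (proj y', ξ, η)) =
      fun y' => ∑ κ ∈ freqBox N, interpCoef N a κ (ξ, η) • UnitAddTorus.mFourier κ (proj y') := by
    funext y'
    simp only [interp_eq_sum, Finset.sum_apply, modeSymbol, smul_eq_mul]
  have hc : ∀ κ, ContDiff ℝ j fun y' : Plane => UnitAddTorus.mFourier κ (proj y') := fun κ =>
    (contDiff_mFourier_proj κ).of_le (natCast_le_infty j)
  rw [h, iteratedFDeriv_fun_sum_apply fun κ _ => ((hc κ).const_smul _).contDiffAt, Finset.sum_mul]
  refine norm_sum_le_of_le _ fun κ _ => ?_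
  rw [iteratedFDeriv_const_smul_apply' (hc κ).contDiffAt, norm_smul, mul_comm]
  have h1 : ‖interpCoef N a κ (ξ, η)‖ ≤ s := norm_gridCoef_le (fun x => ha _) N κ
  have h2 := norm_iteratedFDeriv_mFourier_le κ j y
  have h3 : (4 * Real.pi * ‖κ‖) ^ j ≤ (1 + 4 * Real.pi * ‖κ‖) ^ 3 := by
    refine (pow_le_pow_left₀ (by positivity) (le_add_of_nonneg_left zero_le_one) j).trans
      (pow_le_pow_right₀ ?_ hj)
    have : 0 ≤ 4 * Real.pi * ‖κ‖ := by positivity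
    linarith
  exact mul_le_mul (h2.trans h3) h1 (norm_nonneg _) (by positivity)

/-! ### Symbols independent of the position -/

def fiberSymbols : Submodule ℂ (Plane × EReal → ℂ) where
  carrier := {b | (fun p : Phase => b p.2) ∈ symbols}
  add_mem' := fun ha hb => symbols.add_mem ha hb
  zero_mem' := symbols.zero_mem
  smul_mem' := fun c _ ha => symbols.smul_mem c ha

def modeMap (k : Fin 2 → ℤ) : fiberSymbols →ₗ[ℂ] symbols where
  toFun b := ⟨modeSymbol k b, modeSymbol_mem b.2 k⟩
  map_add' _ _ := Subtype.ext <| funext fun _ => add_mul _ _ _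
  map_smul' _ _ := Subtype.ext <| funext fun _ => mul_assoc _ _ _

/-- The function `b(ξ, H_Λ(ξ) / ε)`. -/
def sampled (e : Fin 2 → ℤ) (ε : ℝ) (b : Plane × EReal → ℂ) (ξ : Plane) : ℂ :=
  b (ξ, ((hamiltonian e ξ / ε : ℝ) : EReal))

theorem contDiff_hamiltonian (e : Fin 2 → ℤ) : ContDiff ℝ ∞ (hamiltonian e) :=
  (contDiff_id.inner ℝ contDiff_const).div_const _

theorem abs_hamiltonian_sub_le (e : Fin 2 → ℤ) (ξ ξ' : Plane) :
    |hamiltonian e ξ - hamiltonian e ξ'| ≤ ‖ξ - ξ'‖ := by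
  rw [hamiltonian, hamiltonian, ← sub_div, ← inner_sub_left, abs_div, abs_norm]
  rcases eq_or_ne ‖latticeVec e‖ 0 with h | h
  · rw [h, div_zero]; positivity
  · rw [div_le_iff₀ (lt_of_le_of_ne (norm_nonneg _) h.symm)]
    exact abs_real_inner_le_norm _ _

theorem sampled_contDiff (e : Fin 2 → ℤ) (ε : ℝ) {b : Plane × EReal → ℂ} (hb : b ∈ fiberSymbols) :
    ContDiff ℝ ∞ (sampled e ε b) :=
  (mem_symbols_iff.1 hb).2.finite.comp (f := fun ξ : Plane => ((0 : Plane), ξ, hamiltonian e ξ / ε))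
    (contDiff_const.prodMk (contDiff_id.prodMk ((contDiff_hamiltonian e).div_const _)))

theorem fiber_exists_radius {b : Plane × EReal → ℂ} (hb : b ∈ fiberSymbols) :
    ∃ R : ℝ, 0 < R ∧ ∀ q, R < ‖q.1‖ → b q = 0 := by
  obtain ⟨R, hR, h⟩ := exists_radius hb
  exact ⟨R, hR, fun q hq => h 0 q.1 q.2 hq⟩

theorem fiber_bounded {b : Plane × EReal → ℂ} (hb : b ∈ fiberSymbols) :
    ∃ B : ℝ, 0 ≤ B ∧ ∀ q, ‖b q‖ ≤ B := by
  obtain ⟨B, hB, h⟩ := symbols_bounded hb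
  exact ⟨B, hB, fun q => h (0, q)⟩

theorem sampled_hasCompactSupport (e : Fin 2 → ℤ) (ε : ℝ) {b : Plane × EReal → ℂ}
    (hb : b ∈ fiberSymbols) : HasCompactSupport (sampled e ε b) := by
  obtain ⟨R, -, h⟩ := fiber_exists_radius hb
  refine HasCompactSupport.intro (isCompact_closedBall 0 R) fun ξ hξ => h _ ?_
  simpa using hξ

/-- The loss `ε⁻¹` is the price of the second scale. Combined with the step `ħ` it gives `ħ/ε → 0`
for positivity, and combined with the potential `ε²` it leaves a remainder of order `ε`. -/
theorem sampled_lipschitz (e : Fin 2 → ℤ) {ε : ℝ} (hε : 0 < ε) {b : Plane × EReal → ℂ} {C : ℝ}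
    (hC : 0 ≤ C) (hb : LipOver b C Set.univ) (ξ ξ' : Plane) :
    ‖sampled e ε b ξ - sampled e ε b ξ'‖ ≤ C * (1 + ε⁻¹) * ‖ξ - ξ'‖ := by
  refine (hb ξ ξ' _ _ trivial trivial).trans ?_
  rw [mul_assoc, ← sub_div, abs_div, abs_of_pos hε]
  refine mul_le_mul_of_nonneg_left ?_ hC
  rw [add_mul, one_mul, div_eq_inv_mul]
  gcongr
  exact abs_hamiltonian_sub_le e ξ ξ'

theorem norm_le_norm_latticeVec (k : Fin 2 → ℤ) : ‖k‖ ≤ ‖latticeVec k‖ := by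
  refine (pi_norm_le_iff_of_nonneg (norm_nonneg _)).2 fun i => ?_
  have := PiLp.norm_apply_le (latticeVec k) i
  simpa [latticeVec, Int.norm_eq_abs] using this

theorem finite_support_midFreq {ħ : ℝ} (hħ : 0 < ħ) (k : Fin 2 → ℤ) {β : Plane → ℂ}
    (hβ : HasCompactSupport β) : (Function.support fun j => β (midFreq ħ k j)).Finite := by
  obtain ⟨R, hR⟩ := hβ.isCompact.isBounded.subset_closedBall 0
  refine finite_support_of_bounded (N := R / (2 * Real.pi * ħ) + ‖latticeVec k‖ + 1) fun j hj => ?_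
  by_contra hne
  have h1 : ‖midFreq ħ k j‖ ≤ R := by simpa using hR (subset_tsupport _ hne)
  have hp : 0 < 2 * Real.pi * ħ := by positivity
  rw [midFreq, norm_smul, Real.norm_of_nonneg hp.le, mul_comm, ← le_div_iff₀ hp] at h1
  have h2 := norm_sub_norm_le (latticeVec j) (-((1 / 2 : ℝ) • latticeVec k))
  rw [sub_neg_eq_add, norm_neg, norm_smul] at h2
  have h3 := norm_le_norm_latticeVec j
  norm_num at h2
  linarith [norm_nonneg (latticeVec k)]

theorem midFreq_sub (ħ : ℝ) (k j l : Fin 2 → ℤ) :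
    midFreq ħ k j - midFreq ħ k (j - l) = (2 * Real.pi * ħ) • latticeVec l := by
  rw [midFreq, midFreq, ← smul_sub, latticeVec_sub]
  congr 1
  abel

theorem norm_midFreq_sub_le {ħ : ℝ} (hħ : 0 ≤ ħ) (k j l : Fin 2 → ℤ) :
    ‖midFreq ħ k j - midFreq ħ k (j - l)‖ ≤ 4 * Real.pi * ħ * ‖l‖ := by
  rw [midFreq_sub, norm_smul, Real.norm_of_nonneg (by positivity)]
  calc _ ≤ 2 * Real.pi * ħ * (2 * ‖l‖) := by gcongr; exact norm_latticeVec_le l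
    _ = _ := by ring

/-- `|j|² - |j + k|² = -2 k·(j + k/2)`: with the Weyl midpoint the transport by the geodesic flow
has no remainder. -/
theorem kinetic_sub (ħ : ℝ) (k j : Fin 2 → ℤ) :
    kinetic ħ j - kinetic ħ (j + k) = -(2 * Real.pi * ħ) * inner ℝ (midFreq ħ k j) (latticeVec k) := by
  rw [kinetic, kinetic, midFreq, latticeVec_add, norm_add_sq_real, inner_smul_left, inner_add_left,
    inner_smul_left, real_inner_self_eq_norm_sq]
  simp
  ring

/-! ### Transport of the modes -/

theorem continuous_commForm {w : (Fin 2 → ℤ) → ℂ} (k : Fin 2 → ℤ) {β : (Fin 2 → ℤ) → ℂ}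
    (hβ : (Function.support β).Finite) : Continuous (commForm w k β) := by
  have h : commForm w k β = fun v => ∑ j ∈ hβ.toFinset, β j * (starRingEnd ℂ (coef v (j + k)) *
      potCoef w j v - starRingEnd ℂ (potCoef w (j + k) v) * coef v j) := by
    funext v
    refine tsum_eq_sum fun j hj => ?_
    have : β j = 0 := by simpa using hj
    rw [this, zero_mul]
  rw [h]
  refine continuous_finsetSum _ fun j _ => continuous_const.mul (Continuous.sub ?_ ?_)
  · exact (RCLike.continuous_conj.comp (continuous_coef _)).mul (potCoef w j).continuous
  · exact (RCLike.continuous_conj.comp (potCoef w (j + k)).continuous).mul (continuous_coef _)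

/-- The kinetic part is exact by `kinetic_sub`. In the potential part, neighbouring values of the
symbol are `O(ħ)` apart in frequency, which cancels the prefactor `1/ħ` and leaves `ε²` times the
Lipschitz constant. -/
theorem IsModeSolution.hasDerivAt_transport {w : (Fin 2 → ℤ) → ℂ}
    (hw : Summable fun l => ‖w l‖ * (1 + ‖l‖)) (hconj : ∀ l, w (-l) = starRingEnd ℂ (w l))
    {ħ ε : ℝ} (hħ : 0 < ħ) {v : ℝ → L2} (hv : IsModeSolution w ħ ε v) (h1 : ∀ t, ‖v t‖ = 1)
    (k : Fin 2 → ℤ) {β : Plane → ℂ} (hβ : HasCompactSupport β) {C : ℝ}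
    (hC : ∀ ξ ξ', ‖β ξ - β ξ'‖ ≤ C * ‖ξ - ξ'‖) (hC0 : 0 ≤ C) :
    ∃ r : ℝ → ℂ, Continuous r ∧ (∀ t, ‖r t‖ ≤ 4 * Real.pi * ε ^ 2 * C * ∑' l, ‖w l‖ * (1 + ‖l‖)) ∧
    ∀ t, HasDerivAt (fun s => shiftForm k 0 (fun j => β (midFreq ħ k j)) (v s))
      (2 * Real.pi * Complex.I * shiftForm k 0
        (fun j => (inner ℝ (midFreq ħ k j) (latticeVec k) : ℂ) * β (midFreq ħ k j)) (v t) + r t) t := by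
  have hfin := finite_support_midFreq hħ k hβ
  refine ⟨fun t => -(Complex.I / ħ) * ((ε : ℂ) ^ 2 * commForm w k (fun j => β (midFreq ħ k j)) (v t)),
    ?_, fun t => ?_, fun t => ?_⟩
  · exact continuous_const.mul (continuous_const.mul
      ((continuous_commForm k hfin).comp hv.continuous))
  · have hΛ : ∀ j l, ‖β (midFreq ħ k j) - β (midFreq ħ k (j - l))‖ ≤ C * (4 * Real.pi * ħ) * ‖l‖ := by
      intro j l
      refine (hC _ _).trans ?_
      rw [mul_assoc]
      exact mul_le_mul_of_nonneg_left (norm_midFreq_sub_le hħ.le k j l) hC0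
    have h := norm_commForm_le hw hconj k hfin hΛ (v t)
    rw [h1 t, one_pow, mul_one] at h
    rw [norm_mul, norm_mul, norm_neg, norm_div, Complex.norm_I, norm_pow, Complex.norm_real,
      Complex.norm_real, Real.norm_of_nonneg hħ.le, Real.norm_eq_abs, sq_abs]
    refine (mul_le_mul_of_nonneg_left (mul_le_mul_of_nonneg_left h (by positivity))
      (by positivity)).trans_eq ?_
    field_simp
  · convert hv.hasDerivAt_shiftForm k hfin t using 1
    have h2 : (fun j => ((kinetic ħ j - kinetic ħ (j + k) : ℝ) : ℂ) * β (midFreq ħ k j)) =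
        fun j => (-(2 * Real.pi * ħ : ℝ) : ℂ) *
          ((inner ℝ (midFreq ħ k j) (latticeVec k) : ℂ) * β (midFreq ħ k j)) := by
      funext j
      rw [kinetic_sub]
      push_cast
      ring
    have hħ' : (ħ : ℂ) ≠ 0 := by exact_mod_cast hħ.ne'
    rw [h2, shiftForm_const_mul]
    push_cast
    field_simp
    ring

/-- Integration by parts in the rescaled time: the derivative moves to `θ` at the price of `1/τ`,
and only the remainder due to the potential is left. -/
theorem IsModeSolution.norm_integral_transport_le {w : (Fin 2 → ℤ) → ℂ}
    (hw : Summable fun l => ‖w l‖ * (1 + ‖l‖)) (hconj : ∀ l, w (-l) = starRingEnd ℂ (w l))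
    {ħ ε τ : ℝ} (hħ : 0 < ħ) (hτ : 0 < τ) {v : ℝ → L2} (hv : IsModeSolution w ħ ε v)
    (h1 : ∀ t, ‖v t‖ = 1)
    (k : Fin 2 → ℤ) {β : Plane → ℂ} (hβ : HasCompactSupport β) {B C : ℝ} (hB : ∀ ξ, ‖β ξ‖ ≤ B)
    (hC : ∀ ξ ξ', ‖β ξ - β ξ'‖ ≤ C * ‖ξ - ξ'‖) (hC0 : 0 ≤ C) {θ : ℝ → ℝ} (hθ : ContDiff ℝ ∞ θ)
    (hθc : HasCompactSupport θ) :
    ‖∫ t, (θ t : ℂ) * shiftForm k 0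
        (fun j => (inner ℝ (midFreq ħ k j) (latticeVec k) : ℂ) * β (midFreq ħ k j)) (v (t * τ))‖ ≤
      4 * Real.pi * ε ^ 2 * C * (∑' l, ‖w l‖ * (1 + ‖l‖)) * (∫ t, |θ t|) + B / τ * ∫ t, |deriv θ t| := by
  obtain ⟨r, hrc, hr, hd⟩ := hv.hasDerivAt_transport hw hconj hħ h1 k hβ hC hC0
  set A : ℝ → ℂ := fun t => shiftForm k 0
    (fun j => (inner ℝ (midFreq ħ k j) (latticeVec k) : ℂ) * β (midFreq ħ k j)) (v t) with hA
  set E : ℝ → ℂ := fun t => shiftForm k 0 (fun j => β (midFreq ħ k j)) (v t) with hE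
  set S : ℝ := ∑' l, ‖w l‖ * (1 + ‖l‖) with hS
  have hfin := finite_support_midFreq hħ k hβ
  have hAc : Continuous A := (continuous_shiftForm (hfin.subset fun j hj =>
    right_ne_zero_of_mul hj) k 0).comp hv.continuous
  have hEc : Continuous E := (continuous_shiftForm hfin k 0).comp hv.continuous
  have hmul : Continuous fun t : ℝ => t * τ := continuous_id.mul continuous_const
  have hθC : Continuous fun t => (θ t : ℂ) := Complex.continuous_ofReal.comp hθ.continuous
  have hθCc : HasCompactSupport fun t => (θ t : ℂ) := hθc.comp_left (g := ((↑) : ℝ → ℂ)) rfl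
  have hθ' : Continuous fun t => ((deriv θ t : ℝ) : ℂ) :=
    Complex.continuous_ofReal.comp (hθ.continuous_deriv (by simp))
  have hθc' : HasCompactSupport fun t => ((deriv θ t : ℝ) : ℂ) := hθc.deriv.comp_left (g := ((↑) : ℝ → ℂ)) rfl
  have hint : ∀ {f g : ℝ → ℂ}, Continuous f → HasCompactSupport f → Continuous g →
      Integrable (fun t => f t * g t) := fun hf hfc hg =>
    (hf.mul hg).integrable_of_hasCompactSupport hfc.mul_right
  have hEd : ∀ t : ℝ, HasDerivAt (fun t => E (t * τ))
      ((τ : ℂ) * (2 * Real.pi * Complex.I * A (t * τ) + r (t * τ))) t := fun t => by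
    exact ((hd (t * τ)).scomp t ((hasDerivAt_id t).mul_const τ)).congr_deriv
      (by rw [one_mul, Complex.real_smul])
  have hparts := integral_mul_deriv_eq_deriv_mul_of_integrable (u := fun t => (θ t : ℂ))
    (u' := fun t => ((deriv θ t : ℝ) : ℂ)) (v := fun t => E (t * τ))
    (fun t _ => ((hθ.differentiable (by simp)) t).hasDerivAt.ofReal_comp) (fun t _ => hEd t)
    (hint hθC hθCc (continuous_const.mul ((continuous_const.mul (hAc.comp hmul)).add (hrc.comp hmul))))
    (hint hθ' hθc' (hEc.comp hmul)) (hint hθC hθCc (hEc.comp hmul))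
  have hτ0 : (τ : ℂ) ≠ 0 := by exact_mod_cast hτ.ne'
  have hsplit : ∫ t, (θ t : ℂ) * ((τ : ℂ) * (2 * Real.pi * Complex.I * A (t * τ) + r (t * τ))) =
      τ * (2 * Real.pi * Complex.I * (∫ t, (θ t : ℂ) * A (t * τ)) + ∫ t, (θ t : ℂ) * r (t * τ)) := by
    have hi₁ : Integrable fun t => (θ t : ℂ) * A (t * τ) := hint hθC hθCc (hAc.comp hmul)
    have hi₂ : Integrable fun t => (θ t : ℂ) * r (t * τ) := hint hθC hθCc (hrc.comp hmul)
    rw [← integral_const_mul, ← integral_add (hi₁.const_mul _) hi₂, ← integral_const_mul]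
    exact integral_congr_ae (ae_of_all _ fun t => by ring)
  rw [hsplit] at hparts
  have hfinal : 2 * Real.pi * Complex.I * (∫ t, (θ t : ℂ) * A (t * τ)) =
      -((τ : ℂ)⁻¹ * ∫ t, ((deriv θ t : ℝ) : ℂ) * E (t * τ)) - ∫ t, (θ t : ℂ) * r (t * τ) := by
    generalize (∫ t, (θ t : ℂ) * A (t * τ)) = X at hparts ⊢
    generalize (∫ t, (θ t : ℂ) * r (t * τ)) = Y at hparts ⊢
    generalize (∫ t, ((deriv θ t : ℝ) : ℂ) * E (t * τ)) = Z at hparts ⊢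
    field_simp
    linear_combination hparts
  have hb1 : ‖∫ t, (θ t : ℂ) * r (t * τ)‖ ≤ 4 * Real.pi * ε ^ 2 * C * S * ∫ t, |θ t| := by
    rw [← integral_const_mul]
    refine norm_integral_le_of_norm_le
      ((hθ.continuous.abs.integrable_of_hasCompactSupport hθc.norm).const_mul _) (ae_of_all _ fun t => ?_)
    rw [norm_mul, Complex.norm_real, Real.norm_eq_abs, mul_comm]
    exact mul_le_mul_of_nonneg_right (hr _) (abs_nonneg _)
  have hb2 : ‖∫ t, ((deriv θ t : ℝ) : ℂ) * E (t * τ)‖ ≤ B * ∫ t, |deriv θ t| := by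
    rw [← integral_const_mul]
    refine norm_integral_le_of_norm_le
      (((hθ.continuous_deriv (by simp)).abs.integrable_of_hasCompactSupport hθc.deriv.norm).const_mul _)
      (ae_of_all _ fun t => ?_)
    rw [norm_mul, Complex.norm_real, Real.norm_eq_abs, mul_comm]
    refine mul_le_mul_of_nonneg_right ?_ (abs_nonneg _)
    have := norm_shiftForm_le (fun j => hB (midFreq ħ k j)) (v (t * τ)) k 0
    rwa [h1, one_pow, mul_one] at this
  have hnorm : ‖∫ t, (θ t : ℂ) * A (t * τ)‖ ≤ ‖2 * Real.pi * Complex.I * (∫ t, (θ t : ℂ) * A (t * τ))‖ := by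
    rw [norm_mul]
    refine le_mul_of_one_le_left (norm_nonneg _) ?_
    simp only [norm_mul, Complex.norm_I, Complex.norm_real, Real.norm_of_nonneg Real.pi_pos.le]
    norm_num
    linarith [Real.pi_gt_three]
  refine hnorm.trans ?_
  rw [hfinal]
  refine (norm_sub_le _ _).trans ?_
  rw [norm_neg, norm_mul, norm_inv, Complex.norm_real, Real.norm_of_nonneg hτ.le, add_comm]
  refine add_le_add hb1 ?_
  rw [div_mul_eq_mul_div, div_eq_inv_mul]
  gcongr

/-! ### Sequences of solutions with a two-microlocal limit -/

/-- A sequence of normalized solutions of the Schrödinger equation, in Fourier variables, whose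
two-microlocal Wigner distributions converge to `μ`. -/
structure IsTwoMicrolocalLimit (w : (Fin 2 → ℤ) → ℂ) (e : Fin 2 → ℤ) (ħ ε τ : ℕ → ℝ)
    (v : ℕ → ℝ → L2) (μ : ℝ → symbols →ₗ[ℂ] ℂ) : Prop where
  summable : Summable fun l => ‖w l‖ * (1 + ‖l‖)
  conj : ∀ l, w (-l) = starRingEnd ℂ (w l)
  hbar_pos : ∀ n, 0 < ħ n
  hbar_tendsto : Tendsto ħ atTop (𝓝 0)
  eps_pos : ∀ᶠ n in atTop, 0 < ε n
  eps_tendsto : Tendsto ε atTop (𝓝 0)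
  strong : Tendsto (fun n => ħ n / ε n) atTop (𝓝 0)
  tau_tendsto : Tendsto τ atTop atTop
  solution : ∀ n, IsModeSolution w (ħ n) (ε n) (v n)
  normalized : ∀ n t, ‖v n t‖ = 1
  low : ∀ δ > 0, ∃ ρ > 0, ∀ᶠ n in atTop, ∀ F : Finset (Fin 2 → ℤ),
    (∀ j ∈ F, kinetic (ħ n) j ≤ ρ) → ‖modeSum F (coef (v n 0))‖ ≤ δ
  dual : IsDualFamily μ
  limit : ∀ θ : ℝ → ℂ, Integrable θ → ∀ (b : fiberSymbols) (k : Fin 2 → ℤ),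
    Tendsto (fun n => ∫ t, θ t * shiftForm k 0 (fun j => sampled e (ε n) b (midFreq (ħ n) k j))
      (v n (t * τ n))) atTop (𝓝 (∫ t, θ t * μ t (modeMap k b)))

/-! ### From accumulation points to sequences of solutions in Fourier variables -/

/-- The truncated coefficients are square summable, so the series defining the cutoff converges and
its `tsum` is not the default value zero. -/
theorem coef_spectralCutoff (I : Set ℝ) (ħ : ℝ) (u : L2) (j : Fin 2 → ℤ) :
    coef (spectralCutoff I ħ u) j = Set.indicator {k | 4 * Real.pi ^ 2 * ħ ^ 2 * ‖latticeVec k‖ ^ 2 ∈ I}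
      (coef u) j := by
  set S : Set (Fin 2 → ℤ) := {k | 4 * Real.pi ^ 2 * ħ ^ 2 * ‖latticeVec k‖ ^ 2 ∈ I} with hS
  have hmem : Memℓp (S.indicator (coef u)) 2 := by
    refine (memℓp_gen_iff (by norm_num)).2 ?_
    refine (summable_coef_sq u).of_nonneg_of_le (fun k => by positivity) fun k => ?_
    simp only [ENNReal.toReal_ofNat, Real.rpow_ofNat]
    gcongr
    exact norm_indicator_le_norm_self _ _
  set f : lp (fun _ : Fin 2 → ℤ => ℂ) 2 := ⟨S.indicator (coef u), hmem⟩ with hf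
  have h1 := modeBasis.hasSum_repr_symm f
  have h2 : (fun i => f i • modeBasis i) =
      fun k => S.indicator (fun k => (inner ℂ (expMode k) u : ℂ) • expMode k) k := by
    funext k
    rw [modeBasis_apply, hf]
    by_cases hk : k ∈ S <;> simp [hk, coef]
  rw [h2] at h1
  have h3 : spectralCutoff I ħ u = modeBasis.repr.symm f := h1.tsum_eq
  rw [h3, ← modeBasis_repr, LinearIsometryEquiv.apply_symm_apply]

theorem norm_spectralCutoff_le (I : Set ℝ) (ħ : ℝ) (u : L2) : ‖spectralCutoff I ħ u‖ ≤ ‖u‖ := by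
  refine (sq_le_sq₀ (norm_nonneg _) (norm_nonneg _)).1 ?_
  refine hasSum_le (fun j => ?_) (hasSum_coef_sq _) (hasSum_coef_sq u)
  rw [coef_spectralCutoff]
  gcongr
  exact norm_indicator_le_norm_self _ _

theorem norm_modeSum_le_spectralCutoff (I : Set ℝ) (ħ : ℝ) (u : L2) (F : Finset (Fin 2 → ℤ))
    (hF : ∀ j ∈ F, 4 * Real.pi ^ 2 * ħ ^ 2 * ‖latticeVec j‖ ^ 2 ∈ I) :
    ‖modeSum F (coef u)‖ ≤ ‖spectralCutoff I ħ u‖ := by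
  refine (sq_le_sq₀ (norm_nonneg _) (norm_nonneg _)).1 ?_
  rw [norm_modeSum_sq, ← (hasSum_coef_sq (spectralCutoff I ħ u)).tsum_eq]
  refine le_trans (Finset.sum_le_sum fun j hj => ?_)
    ((summable_coef_sq (spectralCutoff I ħ u)).sum_le_tsum F fun j _ => by positivity)
  rw [coef_spectralCutoff, Set.indicator_of_mem (by exact hF j hj)]

theorem NoLowFrequency.low {ħ : ℕ → ℝ} {u : ℕ → L2} (hu : ∀ n, ‖u n‖ = 1) (h : NoLowFrequency ħ u)
    {δ : ℝ} (hδ : 0 < δ) : ∃ ρ > 0, ∀ᶠ n in atTop, ∀ F : Finset (Fin 2 → ℤ),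
      (∀ j ∈ F, kinetic (ħ n) j ≤ ρ) → ‖modeSum F (coef (u n))‖ ≤ δ := by
  obtain ⟨δ', h1, h2⟩ := ((h.eventually (gt_mem_nhds hδ)).and self_mem_nhdsWithin).exists
  -- `kinetic` is half the eigenvalue of `-ħ²Δ`, hence the factor `1/2`.
  refine ⟨δ' / 2, half_pos h2, ?_⟩
  -- A real `limsup` controls the sequence only once boundedness is known.
  have hb : IsBoundedUnder (· ≤ ·) atTop fun n => ‖spectralCutoff (Set.Icc 0 δ') (ħ n) (u n)‖ :=
    isBoundedUnder_of ⟨1, fun n => (norm_spectralCutoff_le _ _ _).trans (hu n).le⟩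
  filter_upwards [eventually_lt_of_limsup_lt h1 hb] with n hn F hF
  refine (norm_modeSum_le_spectralCutoff _ _ _ F fun j hj => ?_).trans hn.le
  have := hF j hj
  unfold kinetic at this
  exact ⟨by positivity, by linarith⟩

/-- The property `P` carries any condition valid for small `ħ`, such as `1 ≤ τε`, over to the
extracted sequence. -/
theorem exists_isTwoMicrolocalLimit {V : Torus → ℝ} (hV : TorusSmooth V) {ε τ : ℝ → ℝ}
    (hscales : AdmissibleScales ε τ) {e : Fin 2 → ℤ} {μ : ℝ → symbols →ₗ[ℂ] ℂ}
    (hμ : μ ∈ accumulationPoints V ε τ e) {P : ℝ → Prop} (hP : ∀ᶠ h in 𝓝[>] (0 : ℝ), P h) :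
    ∃ (w : (Fin 2 → ℤ) → ℂ) (ħ : ℕ → ℝ) (v : ℕ → ℝ → L2), (∀ᶠ n in atTop, P (ħ n)) ∧
      IsTwoMicrolocalLimit w e ħ (fun n => ε (ħ n)) (fun n => τ (ħ n)) v μ := by
  obtain ⟨hd, ħ, u, v, hpos, h0, hu, -, hlow, hsol, hlim⟩ := hμ
  have hħ : Tendsto ħ atTop (𝓝[>] 0) :=
    tendsto_nhdsWithin_iff.2 ⟨h0, Eventually.of_forall fun n => hpos n⟩
  set w := torusCoef fun x => (V x : ℂ) with hw
  have hsum : Summable fun l => ‖w l‖ * (1 + ‖l‖) := hV.ofReal.summable_torusCoef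
  have hms : ∀ n, IsModeSolution w (ħ n) (ε (ħ n)) (v n) := fun n =>
    (hsol n).isModeSolution hV (hpos n).ne'
  refine ⟨w, ħ, v, hħ.eventually hP, hsum, torusCoef_conj V, hpos, h0, hħ.eventually hscales.eps_pos,
    hscales.eps_tendsto.comp hħ, hscales.strong.comp hħ, hscales.tau_tendsto.comp hħ, hms, fun n t => ?_,
    fun δ hδ => ?_, hd, fun θ hθ b k => ?_⟩
  · rw [(hms n).norm_eq hsum (torusCoef_conj V), (hsol n).initial, hu]
  · obtain ⟨ρ, hρ, h⟩ := hlow.low hu hδ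
    refine ⟨ρ, hρ, h.mono fun n hn F hF => ?_⟩
    rw [(hsol n).initial]
    exact hn F hF
  · refine (hlim θ hθ (modeMap k b)).congr fun n => ?_
    refine integral_congr_ae (ae_of_all _ fun t => ?_)
    have := pairing_weylOp_mode (hpos n) (v n (t * τ (ħ n))) k (sampled_contDiff e (ε (ħ n)) b.2)
      (sampled_hasCompactSupport e (ε (ħ n)) b.2)
    simp only [← this]
    rfl

/-! ### Multipliers in the variable at infinity -/

/-- The extension of a function on `ℝ` to `[-∞, +∞]`. -/
def extend (g : ℝ → ℝ) (top bot : ℝ) (η : EReal) : ℝ :=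
  if η = ⊤ then top else if η = ⊥ then bot else g η.toReal

@[simp] theorem extend_coe (g : ℝ → ℝ) (top bot s : ℝ) : extend g top bot (s : EReal) = g s := by
  simp [extend]

@[simp] theorem extend_top (g : ℝ → ℝ) (top bot : ℝ) : extend g top bot ⊤ = top := by simp [extend]

@[simp] theorem extend_bot (g : ℝ → ℝ) (top bot : ℝ) : extend g top bot ⊥ = bot := by simp [extend]

theorem smoothPhase_extend {g g₁ g₂ : ℝ → ℝ} (h₀ : ContDiff ℝ ∞ g)
    (h₁ : ContDiff ℝ ∞ g₁) (h₂ : ContDiff ℝ ∞ g₂)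
    (e₁ : ∀ s, 0 < s → g s⁻¹ = g₁ s) (e₂ : ∀ s, 0 < s → g (-s⁻¹) = g₂ s) :
    SmoothPhase (fun p => (extend g (g₁ 0) (g₂ 0) p.2.2 : ℂ)) := by
  refine smoothPhase_of_ereal (g := fun η => (extend g (g₁ 0) (g₂ 0) η : ℂ))
    (Complex.ofRealCLM.contDiff.comp h₀) (Complex.ofRealCLM.contDiff.comp h₁)
    (Complex.ofRealCLM.contDiff.comp h₂) (fun s => by simp) (fun s hs => ?_) fun s hs => ?_
  · rcases hs.eq_or_lt with rfl | hs
    · simp [chartTop]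
    · simp [chartTop, hs.ne', e₁ s hs]
  · rcases hs.eq_or_lt with rfl | hs
    · simp [chartBot]
    · rw [show chartBot s = ((-s⁻¹ : ℝ) : EReal) from if_neg hs.ne', extend_coe, e₂ s hs]
      rfl

/-- The function `η / (R² + η²)`. -/
def damping (R : ℝ) : EReal → ℝ := extend (fun s => s / (R ^ 2 + s ^ 2)) 0 0

/-- The function `η² / (R² + η²)`. -/
def highPass (R : ℝ) : EReal → ℝ := extend (fun s => s ^ 2 / (R ^ 2 + s ^ 2)) 1 1

/-- The function `η / √(1 + η²)`. -/
def endSign : EReal → ℝ := extend (fun s => s / √(1 + s ^ 2)) 1 (-1)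

theorem smoothPhase_damping {R : ℝ} (hR : 0 < R) : SmoothPhase (fun p => (damping R p.2.2 : ℂ)) := by
  have h : ContDiff ℝ ∞ fun s : ℝ => s / (R ^ 2 + s ^ 2) :=
    contDiff_id.div (contDiff_const.add (contDiff_id.pow 2)) fun s => by positivity
  have h' : ContDiff ℝ ∞ fun s : ℝ => s / (R ^ 2 * s ^ 2 + 1) :=
    contDiff_id.div ((contDiff_const.mul (contDiff_id.pow 2)).add contDiff_const) fun s => by positivity
  have := smoothPhase_extend (g₂ := fun s => -(s / (R ^ 2 * s ^ 2 + 1))) h h' h'.neg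
    (fun s hs => by field_simp) (fun s hs => by field_simp)
  simpa [damping] using this

theorem smoothPhase_highPass {R : ℝ} (hR : 0 < R) : SmoothPhase (fun p => (highPass R p.2.2 : ℂ)) := by
  have h : ContDiff ℝ ∞ fun s : ℝ => s ^ 2 / (R ^ 2 + s ^ 2) :=
    (contDiff_id.pow 2).div (contDiff_const.add (contDiff_id.pow 2)) fun s => by positivity
  have h' : ContDiff ℝ ∞ fun s : ℝ => 1 / (R ^ 2 * s ^ 2 + 1) :=
    contDiff_const.div ((contDiff_const.mul (contDiff_id.pow 2)).add contDiff_const) fun s => by positivity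
  have := smoothPhase_extend h h' h' (fun s hs => by field_simp) (fun s hs => by field_simp)
  simpa [highPass] using this

theorem smoothPhase_endSign : SmoothPhase (fun p => (endSign p.2.2 : ℂ)) := by
  have hs : ContDiff ℝ ∞ fun s : ℝ => √(1 + s ^ 2) :=
    (contDiff_const.add (contDiff_id.pow 2)).sqrt fun s => by positivity
  have h : ContDiff ℝ ∞ fun s : ℝ => s / √(1 + s ^ 2) := contDiff_id.div hs fun s => by positivity
  have h' : ContDiff ℝ ∞ fun s : ℝ => 1 / √(1 + s ^ 2) := contDiff_const.div hs fun s => by positivity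
  have hk : ∀ s : ℝ, 0 < s → √(1 + s⁻¹ ^ 2) = s⁻¹ * √(1 + s ^ 2) := fun s hs => by
    rw [← Real.sqrt_sq (inv_pos.2 hs).le, ← Real.sqrt_mul (by positivity), Real.sqrt_sq (inv_pos.2 hs).le]
    congr 1
    field_simp
    ring
  have := smoothPhase_extend (g₂ := fun s => -(1 / √(1 + s ^ 2))) h h' h'.neg
    (fun s hs => by rw [hk s hs]; field_simp)
    (fun s hs => by rw [neg_sq, hk s hs]; field_simp)
  simpa [endSign] using this

theorem fiber_mul {b g : Plane × EReal → ℂ} (hb : b ∈ fiberSymbols)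
    (hg : SmoothPhase fun p => g p.2) : (fun q => b q * g q) ∈ fiberSymbols :=
  symbols_mul hb hg

/-- `b(ξ, η) η / (R² + η²)`. -/
def damped (R : ℝ) (b : Plane × EReal → ℂ) (q : Plane × EReal) : ℂ := b q * damping R q.2

/-- `b(ξ, η) η² / (R² + η²)`. -/
def filtered (R : ℝ) (b : Plane × EReal → ℂ) (q : Plane × EReal) : ℂ := b q * highPass R q.2

/-- `(k · ξ) b(ξ, η)`. -/
def flowed (k : Fin 2 → ℤ) (b : Plane × EReal → ℂ) (q : Plane × EReal) : ℂ :=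
  b q * (inner ℝ q.1 (latticeVec k) : ℂ)

theorem damped_mem {R : ℝ} (hR : 0 < R) {b : Plane × EReal → ℂ} (hb : b ∈ fiberSymbols) :
    damped R b ∈ fiberSymbols := fiber_mul hb (smoothPhase_damping hR)

theorem filtered_mem {R : ℝ} (hR : 0 < R) {b : Plane × EReal → ℂ} (hb : b ∈ fiberSymbols) :
    filtered R b ∈ fiberSymbols := fiber_mul hb (smoothPhase_highPass hR)

theorem flowed_mem (k : Fin 2 → ℤ) {b : Plane × EReal → ℂ} (hb : b ∈ fiberSymbols) :
    flowed k b ∈ fiberSymbols :=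
  fiber_mul hb (smoothPhase_of_plane (f := fun ξ : Plane => ((inner ℝ ξ (latticeVec k) : ℝ) : ℂ))
    (Complex.ofRealCLM.contDiff.comp (contDiff_id.inner ℝ contDiff_const)))

theorem abs_damping_coe_le {R : ℝ} (hR : 1 ≤ R) (s : ℝ) : |damping R s| ≤ R⁻¹ := by
  rw [damping, extend_coe, abs_div, abs_of_pos (by positivity : 0 < R ^ 2 + s ^ 2),
    div_le_iff₀ (by positivity), inv_mul_eq_div, le_div_iff₀ (by positivity)]
  nlinarith [sq_nonneg (|s| - R), sq_abs s]

theorem abs_damping_sub_le {R : ℝ} (hR : 1 ≤ R) (s s' : ℝ) :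
    |damping R s - damping R s'| ≤ R⁻¹ * |s - s'| := by
  have hR0 : 0 < R := by linarith
  have h1 : 0 < R ^ 2 + s ^ 2 := by positivity
  have h2 : 0 < R ^ 2 + s' ^ 2 := by positivity
  have h3 : damping R s - damping R s' = (s - s') * ((R ^ 2 - s * s') / ((R ^ 2 + s ^ 2) * (R ^ 2 + s' ^ 2))) := by
    simp only [damping, extend_coe]
    field_simp
    ring
  rw [h3, abs_mul, mul_comm]
  refine mul_le_mul_of_nonneg_right ?_ (abs_nonneg _)
  rw [abs_div, abs_of_pos (mul_pos h1 h2), div_le_iff₀ (mul_pos h1 h2), inv_mul_eq_div,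
    le_div_iff₀ hR0]
  have h4 : |R ^ 2 - s * s'| ≤ R ^ 2 + (s ^ 2 + s' ^ 2) / 2 := by
    rw [abs_le]; constructor <;> nlinarith [sq_nonneg (s - s'), sq_nonneg (s + s')]
  have h5 : 0 ≤ R ^ 3 * (R - 1) := mul_nonneg (by positivity) (by linarith)
  have h6 : 0 ≤ R * (R - 1) * (s ^ 2 + s' ^ 2) :=
    mul_nonneg (mul_nonneg hR0.le (by linarith)) (by positivity)
  have h7 := mul_le_mul_of_nonneg_right h4 hR0.le
  have h8 : 0 ≤ R * (s ^ 2 + s' ^ 2) := by positivity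
  nlinarith [mul_nonneg (sq_nonneg s) (sq_nonneg s')]

/-- For `R ≥ 1` both the size and the slope of `η/(R² + η²)` are at most `1/R`, hence so is, up to a
constant, the Lipschitz constant of the product. All the decay in `R` comes from here. -/
theorem damped_lipschitz {R : ℝ} (hR : 1 ≤ R) {b : Plane × EReal → ℂ} {B C : ℝ} (hB : ∀ q, ‖b q‖ ≤ B)
    (hC : LipOver b C Set.univ) : LipOver (damped R b) ((B + C) / R) Set.univ := by
  intro ξ ξ' η η' _ _
  have h1 : damped R b (ξ, (η : EReal)) - damped R b (ξ', (η' : EReal)) =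
      (b (ξ, (η : EReal)) - b (ξ', (η' : EReal))) * (damping R η : ℂ) +
        b (ξ', (η' : EReal)) * ((damping R η - damping R η' : ℝ) : ℂ) := by
    simp only [damped]; push_cast; ring
  rw [h1]
  refine (norm_add_le _ _).trans ?_
  rw [norm_mul, norm_mul, Complex.norm_real, Complex.norm_real, Real.norm_eq_abs, Real.norm_eq_abs]
  have hB0 : 0 ≤ B := (norm_nonneg _).trans (hB 0)
  have hR0 : 0 < R := by linarith
  have h2 := mul_le_mul (hC ξ ξ' η η' trivial trivial) (abs_damping_coe_le hR η) (abs_nonneg _)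
    ((norm_nonneg _).trans (hC ξ ξ' η η' trivial trivial))
  have h3 := mul_le_mul (hB (ξ', (η' : EReal))) (abs_damping_sub_le hR η η') (abs_nonneg _) hB0
  have h4 : B * (R⁻¹ * |η - η'|) ≤ B * (R⁻¹ * (‖ξ - ξ'‖ + |η - η'|)) := by
    gcongr; exact le_add_of_nonneg_left (norm_nonneg _)
  calc _ ≤ _ := add_le_add h2 (h3.trans h4)
    _ = _ := by rw [div_eq_mul_inv]; ring

/-! ### Bounds for the limit -/

theorem symbols_exists_bnormLE {a : Phase → ℂ} (ha : a ∈ symbols) : ∃ M, BNormLE a M := by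
  choose M hM using exists_bound_iteratedFDeriv ha
  refine ⟨∑ j ∈ Finset.range 4, |M j|, fun j hj ξ η y => (hM j ξ η y).trans ((le_abs_self _).trans ?_)⟩
  exact Finset.single_le_sum (f := fun j => |M j|) (fun i _ => abs_nonneg _) (Finset.mem_range.2 (by omega))

theorem BNormLE.norm_le {a : Phase → ℂ} {M : ℝ} (h : BNormLE a M) (p : Phase) : ‖a p‖ ≤ M := by
  obtain ⟨y, hy⟩ := proj_surjective p.1
  have := h 0 (by omega) p.2.1 p.2.2 y
  rwa [norm_iteratedFDeriv_zero, hy] at this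

theorem BNormLE.mono {a : Phase → ℂ} {M M' : ℝ} (h : BNormLE a M) (hM : M ≤ M') : BNormLE a M' :=
  fun j hj ξ η y => (h j hj ξ η y).trans hM

theorem IsDualFamily.exists_bound {μ : ℝ → symbols →ₗ[ℂ] ℂ} (hμ : IsDualFamily μ) :
    ∃ C : ℝ, 0 ≤ C ∧ ∀ᵐ t : ℝ, ∀ (a : symbols) (M : ℝ), BNormLE a M → ‖μ t a‖ ≤ C * M := by
  obtain ⟨C, hC⟩ := hμ.2
  refine ⟨max C 0, le_max_right _ _, hC.mono fun t ht a M hM => (ht a M hM).trans ?_⟩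
  exact mul_le_mul_of_nonneg_right (le_max_left _ _) ((norm_nonneg _).trans (hM.norm_le 0))

theorem IsDualFamily.ae_norm_le {μ : ℝ → symbols →ₗ[ℂ] ℂ} (hμ : IsDualFamily μ) (a : symbols) :
    ∃ M : ℝ, ∀ᵐ t : ℝ, ‖μ t a‖ ≤ M := by
  obtain ⟨C, -, hC⟩ := hμ.exists_bound
  obtain ⟨M, hM⟩ := symbols_exists_bnormLE a.2
  exact ⟨C * M, hC.mono fun t ht => ht a M hM⟩

theorem IsDualFamily.locallyIntegrable {μ : ℝ → symbols →ₗ[ℂ] ℂ} (hμ : IsDualFamily μ) (a : symbols) :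
    LocallyIntegrable (fun t => μ t a) := by
  obtain ⟨M, hM⟩ := hμ.ae_norm_le a
  intro t
  refine ⟨Metric.ball t 1, Metric.ball_mem_nhds t one_pos, ?_⟩
  exact Measure.integrableOn_of_bounded (M := M) measure_ball_lt_top.ne (hμ.1 a)
    (ae_restrict_of_ae hM)

theorem IsDualFamily.integrableOn {μ : ℝ → symbols →ₗ[ℂ] ℂ} (hμ : IsDualFamily μ) (a : symbols)
    {s : Set ℝ} (hs : volume s < ⊤) : IntegrableOn (fun t => μ t a) s := by
  obtain ⟨M, hM⟩ := hμ.ae_norm_le a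
  exact Measure.integrableOn_of_bounded (M := M) hs.ne (hμ.1 a) (ae_restrict_of_ae hM)

namespace IsTwoMicrolocalLimit

variable {w : (Fin 2 → ℤ) → ℂ} {e : Fin 2 → ℤ} {ħ ε τ : ℕ → ℝ} {v : ℕ → ℝ → L2}
  {μ : ℝ → symbols →ₗ[ℂ] ℂ}

/-! ### Transport by the geodesic flow -/

/-- With the Lipschitz constant `C(1 + ε⁻¹)` the potential term is `O(ε² + ε)` and the boundary term
is `O(1/τ)`; both tend to zero without any relation between `τ` and `ε`. -/
theorem integral_flowed_eq_zero (h : IsTwoMicrolocalLimit w e ħ ε τ v μ) (k : Fin 2 → ℤ)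
    {b : Plane × EReal → ℂ} (hb : b ∈ fiberSymbols) {θ : ℝ → ℝ} (hθ : ContDiff ℝ ∞ θ)
    (hθc : HasCompactSupport θ) :
    ∫ t, (θ t : ℂ) * μ t (modeMap k ⟨flowed k b, flowed_mem k hb⟩) = 0 := by
  obtain ⟨C, hC0, hC⟩ := fiber_symbol_lipschitz hb
  obtain ⟨B, hB0, hB⟩ := fiber_bounded hb
  have hlim := h.limit (fun t => (θ t : ℂ)) (hθ.continuous.integrable_of_hasCompactSupport hθc).ofReal
    ⟨flowed k b, flowed_mem k hb⟩ k
  set S := ∑' l, ‖w l‖ * (1 + ‖l‖) with hS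
  refine tendsto_nhds_unique hlim (squeeze_zero_norm' (a := fun n =>
    4 * Real.pi * ((ε n) ^ 2 + ε n) * C * S * (∫ t, |θ t|) + B * (τ n)⁻¹ * ∫ t, |deriv θ t|) ?_ ?_)
  · filter_upwards [h.eps_pos, h.tau_tendsto.eventually_gt_atTop 0] with n hε hτ
    have := (h.solution n).norm_integral_transport_le h.summable h.conj (h.hbar_pos n) hτ
      (h.normalized n) k (sampled_hasCompactSupport e (ε n) hb) (fun ξ => hB _)
      (sampled_lipschitz e hε hC0 hC) (by positivity) hθ hθc
    refine (le_of_eq ?_).trans (this.trans_eq ?_)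
    · congr 1
      refine integral_congr_ae (ae_of_all _ fun t => ?_)
      simp only [flowed, sampled, mul_comm]
    · rw [← hS]
      field_simp
  · have h1 := h.eps_tendsto
    have h2 := tendsto_inv_atTop_zero.comp h.tau_tendsto
    have h3 := ((((((h1.pow 2).add h1).const_mul (4 * Real.pi)).mul_const C).mul_const S).mul_const
      (∫ t, |θ t|)).add ((h2.const_mul B).mul_const (∫ t, |deriv θ t|))
    simpa using h3

theorem ae_flowed_eq_zero (h : IsTwoMicrolocalLimit w e ħ ε τ v μ) (k : Fin 2 → ℤ)
    {b : Plane × EReal → ℂ} (hb : b ∈ fiberSymbols) :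
    ∀ᵐ t, μ t (modeMap k ⟨flowed k b, flowed_mem k hb⟩) = 0 := by
  refine ae_eq_zero_of_integral_contDiff_smul_eq_zero (h.dual.locallyIntegrable _) fun θ hθ hθc => ?_
  simpa only [Complex.real_smul] using h.integral_flowed_eq_zero k hb hθ hθc

/-! ### Transport by the average flow -/

/-- For `k = m𝔢_Λ` one has `k·ξ = m‖𝔢_Λ‖ ε η` at `η = H_Λ(ξ)/ε`. The damping is designed so that
multiplication by `η` produces a bounded symbol equal to `b` at `±∞`, with a factor `ε` in front. -/
theorem inner_mul_damped (e : Fin 2 → ℤ) {δ : ℝ} (hδ : 0 < δ) (m : ℤ) (R : ℝ) (hR : 0 < R)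
    (b : Plane × EReal → ℂ) (ξ : Plane) :
    (inner ℝ ξ (latticeVec (m • e)) : ℂ) * sampled e δ (damped R b) ξ =
      ((m * ‖latticeVec e‖ * δ : ℝ) : ℂ) * sampled e δ (filtered R b) ξ := by
  have h1 : inner ℝ ξ (latticeVec (m • e)) = m * ‖latticeVec e‖ * δ * (hamiltonian e ξ / δ) := by
    have h2 : latticeVec (m • e) = (m : ℝ) • latticeVec e := by
      ext i; simp [latticeVec]
    rw [h2, inner_smul_right, hamiltonian]
    rcases eq_or_ne ‖latticeVec e‖ 0 with h | h
    · rw [norm_eq_zero.1 h]; simp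
    · field_simp
  rw [h1]
  simp only [sampled, damped, filtered, damping, highPass, extend_coe]
  push_cast
  have h3 : (R : ℂ) ^ 2 + ((hamiltonian e ξ : ℂ) / δ) ^ 2 ≠ 0 := by
    have : R ^ 2 + (hamiltonian e ξ / δ) ^ 2 ≠ 0 := by positivity
    exact_mod_cast this
  field_simp

/-- The transport estimate for the damped symbol is divided by the factor `ε` of `inner_mul_damped`.
The potential term becomes `ε²(1 + ε⁻¹)/(εR) ≤ 2/R` for `ε ≤ 1`, and the boundary term `1/(τεR) ≤
1/R`. These bounds are uniform in `n` and pass to the limit. -/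
theorem norm_integral_filtered_le (h : IsTwoMicrolocalLimit w e ħ ε τ v μ)
    (hτε : ∀ᶠ n in atTop, 1 ≤ τ n * ε n) {m : ℤ} (hm : m ≠ 0) (he : e ≠ 0)
    {b : Plane × EReal → ℂ} (hb : b ∈ fiberSymbols) {θ : ℝ → ℝ} (hθ : ContDiff ℝ ∞ θ)
    (hθc : HasCompactSupport θ) :
    ∃ K : ℝ, ∀ (R : ℝ) (hR : 1 ≤ R),
      ‖∫ t, (θ t : ℂ) * μ t (modeMap (m • e) ⟨filtered R b, filtered_mem (by linarith) hb⟩)‖ ≤ K / R := by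
  obtain ⟨C, hC0, hC⟩ := fiber_symbol_lipschitz hb
  obtain ⟨B, hB0, hB⟩ := fiber_bounded hb
  set S := ∑' l, ‖w l‖ * (1 + ‖l‖) with hS
  have hS0 : 0 ≤ S := tsum_nonneg fun l => by positivity
  have hL : 0 < |(m : ℝ)| * ‖latticeVec e‖ := by
    refine mul_pos (by simpa using hm) ?_
    exact (norm_pos_iff.2 he).trans_le (norm_le_norm_latticeVec e)
  refine ⟨(4 * Real.pi * 2 * (B + C) * S * (∫ t, |θ t|) + B * ∫ t, |deriv θ t|) /
    (|(m : ℝ)| * ‖latticeVec e‖), fun R hR => ?_⟩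
  have hR0 : 0 < R := by linarith
  have hlim := h.limit (fun t => (θ t : ℂ)) (hθ.continuous.integrable_of_hasCompactSupport hθc).ofReal
    ⟨filtered R b, filtered_mem hR0 hb⟩ (m • e)
  refine le_of_tendsto hlim.norm ?_
  filter_upwards [h.eps_pos, h.tau_tendsto.eventually_gt_atTop 0, hτε,
    h.eps_tendsto.eventually (gt_mem_nhds one_pos)] with n hε hτ hτε hε1
  have hBd : ∀ ξ, ‖sampled e (ε n) (damped R b) ξ‖ ≤ B / R := fun ξ => by
    rw [sampled, damped, norm_mul, Complex.norm_real, div_eq_mul_inv]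
    exact mul_le_mul (hB _) (abs_damping_coe_le hR _) (norm_nonneg _) hB0
  have hBC : 0 ≤ (B + C) / R := by positivity
  have := (h.solution n).norm_integral_transport_le h.summable h.conj (h.hbar_pos n) hτ
    (h.normalized n) (m • e) (sampled_hasCompactSupport e (ε n) (damped_mem hR0 hb)) hBd
    (sampled_lipschitz e hε hBC (damped_lipschitz hR hB hC)) (by positivity) hθ hθc
  simp only [inner_mul_damped e hε m R hR0, shiftForm_const_mul, mul_left_comm _ (((m * _ * ε n : ℝ) : ℂ))] at this
  rw [integral_const_mul, norm_mul, Complex.norm_real, Real.norm_eq_abs, abs_mul, abs_mul, abs_norm,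
    abs_of_pos hε] at this
  rw [div_div, le_div_iff₀ (by positivity)]
  have hX : 0 ≤ ∫ t, |θ t| := integral_nonneg fun t => abs_nonneg _
  have hY : 0 ≤ ∫ t, |deriv θ t| := integral_nonneg fun t => abs_nonneg _
  refine le_of_mul_le_mul_right ?_ hε
  have h5 : 4 * Real.pi * ε n ^ 2 * ((B + C) / R * (1 + (ε n)⁻¹)) * S * (∫ t, |θ t|) * R ≤
      4 * Real.pi * 2 * (B + C) * S * (∫ t, |θ t|) * ε n := by
    have : 4 * Real.pi * ε n ^ 2 * ((B + C) / R * (1 + (ε n)⁻¹)) * S * (∫ t, |θ t|) * R =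
      4 * Real.pi * (1 + ε n) * (B + C) * S * (∫ t, |θ t|) * ε n := by field_simp; ring
    rw [this]
    gcongr
    linarith
  have h6 : B / R / τ n * (∫ t, |deriv θ t|) * R ≤ B * (∫ t, |deriv θ t|) * ε n := by
    have : B / R / τ n * (∫ t, |deriv θ t|) * R = B * (∫ t, |deriv θ t|) * (τ n)⁻¹ := by field_simp
    rw [this]
    gcongr
    rw [inv_le_iff_one_le_mul₀ hτ]; linarith
  have h7 := mul_le_mul_of_nonneg_right this hR0.le
  rw [add_mul] at h7
  calc _ = _ := by ring
    _ ≤ _ := h7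
    _ ≤ _ := add_le_add h5 h6
    _ = _ := by ring

end IsTwoMicrolocalLimit

theorem continuous_sampled_form (e : Fin 2 → ℤ) (ε : ℝ) {ħ : ℝ} (hħ : 0 < ħ) (k : Fin 2 → ℤ)
    (b : fiberSymbols) : Continuous (shiftForm k 0 (fun j => sampled e ε b (midFreq ħ k j))) :=
  continuous_shiftForm (finite_support_midFreq hħ k (sampled_hasCompactSupport e ε b.2)) k 0

namespace IsTwoMicrolocalLimit

variable {w : (Fin 2 → ℤ) → ℂ} {e : Fin 2 → ℤ} {ħ ε τ : ℕ → ℝ} {v : ℕ → ℝ → L2}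
  {μ : ℝ → symbols →ₗ[ℂ] ℂ}

/-! ### Positivity of the limit -/

/-- Two successive limits: with `M` fixed, `n → ∞` removes the error `M(ħ + ħ/ε)` of freezing the
symbol, and then `M → ∞` removes the boundary error `‖k‖/M`. Integrals over `s` are limits by
testing against its indicator function. -/
theorem setIntegral_ge (h : IsTwoMicrolocalLimit w e ħ ε τ v μ) (K : Finset (Fin 2 → ℤ))
    (b : (Fin 2 → ℤ) → fiberSymbols) {δ : ℝ}
    (hb : ∀ p : Phase, -δ ≤ (∑ k ∈ K, modeSymbol k (b k) p).re) {s : Set ℝ} (hs : MeasurableSet s)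
    (hs' : volume s < ⊤) :
    -δ * volume.real s ≤ (∫ t in s, ∑ k ∈ K, μ t (modeMap k (b k))).re := by
  choose B₀ hB₀ hB using fun k => fiber_bounded (b k).2
  choose C₀ hC₀ hC using fun k => fiber_symbol_lipschitz (b k).2
  set B := ∑ k ∈ K, B₀ k with hBdef
  set C := ∑ k ∈ K, C₀ k with hCdef
  have hBK : ∀ k ∈ K, B₀ k ≤ B := fun k hk => Finset.single_le_sum (fun i _ => hB₀ i) hk
  have hCK : ∀ k ∈ K, C₀ k ≤ C := fun k hk => Finset.single_le_sum (fun i _ => hC₀ i) hk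
  have hC0 : 0 ≤ C := Finset.sum_nonneg fun i _ => hC₀ i
  set q : ℕ → (Fin 2 → ℤ) → L2 → ℂ := fun n k =>
    shiftForm k 0 (fun j => sampled e (ε n) (b k) (midFreq (ħ n) k j)) with hq
  have hqc : ∀ n k, Continuous fun t => q n k (v n (t * τ n)) := fun n k =>
    (continuous_sampled_form e (ε n) (h.hbar_pos n) k (b k)).comp
      ((h.solution n).continuous.comp (continuous_id.mul continuous_const))
  have hqi : ∀ n k, IntegrableOn (fun t => q n k (v n (t * τ n))) s := fun n k => by
    refine Measure.integrableOn_of_bounded (M := B₀ k) hs'.ne (hqc n k).aestronglyMeasurable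
      (ae_of_all _ fun t => ?_)
    have := norm_shiftForm_le (fun j => hB k _ : ∀ j, ‖sampled e (ε n) (b k) (midFreq (ħ n) k j)‖ ≤ B₀ k)
      (v n (t * τ n)) k 0
    rwa [h.normalized, one_pow, mul_one] at this
  have hlim : Tendsto (fun n => (∫ t in s, ∑ k ∈ K, q n k (v n (t * τ n))).re) atTop
      (𝓝 (∫ t in s, ∑ k ∈ K, μ t (modeMap k (b k))).re) := by
    refine (Complex.continuous_re.tendsto _).comp ?_
    rw [integral_finsetSum _ fun k _ => h.dual.integrableOn _ hs']
    simp_rw [integral_finsetSum _ fun k _ => hqi _ k]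
    refine tendsto_finsetSum _ fun k _ => ?_
    have hind : Integrable (s.indicator fun _ : ℝ => (1 : ℂ)) :=
      (integrable_indicator_iff hs).2 (integrableOn_const hs'.ne)
    have := h.limit _ hind (b k) k
    have hconv : ∀ f : ℝ → ℂ, ∫ t, s.indicator (fun _ : ℝ => (1 : ℂ)) t * f t = ∫ t in s, f t := fun f => by
      rw [← integral_indicator hs]
      refine integral_congr_ae (ae_of_all _ fun t => ?_)
      by_cases ht : t ∈ s <;> simp [ht]
    simpa only [hconv] using this
  have hM : ∀ M : ℕ, 0 < M → -(δ + ∑ k ∈ K, B * (2 * ‖k‖ / M)) * volume.real s ≤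
      (∫ t in s, ∑ k ∈ K, μ t (modeMap k (b k))).re := by
    intro M hM
    have herr : Tendsto (fun n => -(δ + ∑ k ∈ K, (C * ((ħ n + ħ n / ε n) * (2 * Real.pi * (2 * M + ‖k‖))) +
        B * (2 * ‖k‖ / M))) * volume.real s) atTop
        (𝓝 (-(δ + ∑ k ∈ K, (C * ((0 + 0) * (2 * Real.pi * (2 * M + ‖k‖))) + B * (2 * ‖k‖ / M))) *
          volume.real s)) := by
      refine ((tendsto_const_nhds.add (tendsto_finsetSum _ fun k _ => ?_)).neg).mul_const _
      exact (((h.hbar_tendsto.add h.strong).mul_const _).const_mul C).add_const _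
    simp only [add_zero, zero_mul, mul_zero, zero_add] at herr
    refine le_of_tendsto_of_tendsto herr hlim ?_
    filter_upwards [h.eps_pos] with n hε
    have hpt : ∀ t, -(δ + ∑ k ∈ K, (C * ((ħ n + ħ n / ε n) * (2 * Real.pi * (2 * M + ‖k‖))) +
        B * (2 * ‖k‖ / M))) ≤ (∑ k ∈ K, q n k (v n (t * τ n))).re := by
      intro t
      have := re_sum_shiftForm_ge K (fun k => sampled e (ε n) (b k)) (B := B)
        (Λ := C * (1 + (ε n)⁻¹)) (δ := δ) (h.hbar_pos n).le
        (fun k hk ξ => (hB k _).trans (hBK k hk))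
        (fun k hk ξ ξ' => (sampled_lipschitz e hε (hC₀ k) (hC k) ξ ξ').trans (by
          gcongr; exact hCK k hk)) (by positivity)
        (fun ξ x => hb (x, ξ, _)) hM (v n (t * τ n))
      rw [h.normalized, one_pow, mul_one] at this
      refine (le_of_eq ?_).trans this
      congr 2
      refine Finset.sum_congr rfl fun k _ => ?_
      field_simp
    have h2 := setIntegral_mono_on (μ := volume) (s := s) (f := fun _ => -(δ + ∑ k ∈ K, (C * ((ħ n + ħ n / ε n) *
      (2 * Real.pi * (2 * M + ‖k‖))) + B * (2 * ‖k‖ / M)))) (integrableOn_const hs'.ne)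
      (g := fun t => (∑ k ∈ K, q n k (v n (t * τ n))).re)
      (Integrable.re (integrable_finsetSum _ fun k _ => hqi n k)) hs fun t _ => hpt t
    rw [setIntegral_const, smul_eq_mul, mul_comm] at h2
    refine h2.trans_eq ?_
    exact integral_re (𝕜 := ℂ) (integrable_finsetSum _ fun k _ => hqi n k)
  have hlimM : Tendsto (fun M : ℕ => -(δ + ∑ k ∈ K, B * (2 * ‖k‖ / M)) * volume.real s) atTop
      (𝓝 (-(δ + ∑ k ∈ K, B * 0) * volume.real s)) := by
    refine ((tendsto_const_nhds.add (tendsto_finsetSum _ fun k _ => ?_)).neg).mul_const _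
    exact (tendsto_const_div_atTop_nhds_zero_nat _).const_mul B
  simp only [mul_zero, Finset.sum_const_zero, add_zero] at hlimM
  exact le_of_tendsto hlimM ((eventually_gt_atTop 0).mono hM)

theorem ae_sum_ge (h : IsTwoMicrolocalLimit w e ħ ε τ v μ) (K : Finset (Fin 2 → ℤ))
    (b : (Fin 2 → ℤ) → fiberSymbols) {δ : ℝ}
    (hb : ∀ p : Phase, -δ ≤ (∑ k ∈ K, modeSymbol k (b k) p).re) :
    ∀ᵐ t, -δ ≤ (∑ k ∈ K, μ t (modeMap k (b k))).re := by
  have hi : ∀ s, volume s < ⊤ → IntegrableOn (fun t => ∑ k ∈ K, μ t (modeMap k (b k))) s := fun s hs =>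
    integrable_finsetSum _ fun k _ => h.dual.integrableOn _ hs
  have := ae_nonneg_of_forall_setIntegral_nonneg_of_sigmaFinite (μ := (volume : Measure ℝ))
    (f := fun t => (∑ k ∈ K, μ t (modeMap k (b k))).re + δ)
    (fun s _ hs => (Integrable.re (hi s hs)).add (integrableOn_const hs.ne)) fun s hs hs' => by
      have h1 := h.setIntegral_ge K b hb hs hs'
      have hre : Integrable (fun t => (∑ k ∈ K, μ t (modeMap k (b k))).re) (volume.restrict s) :=
        Integrable.re (hi s hs')
      rw [integral_add hre (integrableOn_const hs'.ne), setIntegral_const,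
        smul_eq_mul]
      have h2 : ∫ t in s, (∑ k ∈ K, μ t (modeMap k (b k))).re = (∫ t in s, ∑ k ∈ K, μ t (modeMap k (b k))).re :=
        integral_re (𝕜 := ℂ) (hi s hs')
      rw [h2]
      linarith
  filter_upwards [this] with t ht
  have : 0 ≤ (∑ k ∈ K, μ t (modeMap k (b k))).re + δ := ht
  linarith

theorem ae_interp_ge (h : IsTwoMicrolocalLimit w e ħ ε τ v μ) (N : ℕ) (a : symbols) {δ : ℝ}
    (ha : ∀ p, -δ ≤ (interp N a p).re) : ∀ᵐ t, -δ ≤ (μ t ⟨interp N a, interp_mem a.2 N⟩).re := by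
  have heq : (⟨interp N a, interp_mem a.2 N⟩ : symbols) =
      ∑ k ∈ freqBox N, modeMap k ⟨interpCoef N a k, interpCoef_mem a.2 N k⟩ := by
    refine Subtype.ext ?_
    rw [AddSubmonoidClass.coe_finsetSum]
    exact interp_eq_sum N a
  have := h.ae_sum_ge (freqBox N) (fun k => ⟨interpCoef N a k, interpCoef_mem a.2 N k⟩) (δ := δ) fun p => by
    have := ha p
    rwa [interp_eq_sum, Finset.sum_apply] at this
  filter_upwards [this] with t ht
  rwa [heq, map_sum]

/-- The exceptional set of times must not depend on `a`, so only countably many inequalities are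
used: a dense family of symbols `d`, all degrees `N`, and rational thresholds. A general `a` is
`interp N d + interp N (a - d) - (interp N a - a)`, where the last two terms are small in the norm
of `𝓑`: `N` is chosen for the last one, then `d` for the other. -/
theorem ae_re_ge (h : IsTwoMicrolocalLimit w e ħ ε τ v μ) :
    ∀ᵐ t, ∀ (a : symbols) (δ : ℝ), (∀ p, -δ ≤ ((a : Phase → ℂ) p).re) → -δ ≤ (μ t a).re := by
  obtain ⟨D, hDs, hDc, hD⟩ := exists_countable_dense_symbols (symbols : Set (Phase → ℂ)) subset_rfl
  obtain ⟨C, hC0, hC⟩ := h.dual.exists_bound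
  have : Countable D := hDc.to_subtype
  have hall : ∀ᵐ t, ∀ (d : D) (N : ℕ) (q : ℚ), (∀ p, -(q : ℝ) ≤ (interp N d.1 p).re) →
      -(q : ℝ) ≤ (μ t ⟨interp N d.1, interp_mem (hDs d.2) N⟩).re := by
    simp only [ae_all_iff]
    intro d N q hq
    exact h.ae_interp_ge N ⟨d.1, hDs d.2⟩ hq
  filter_upwards [hall, hC] with t ht hCt a δ ha
  refine le_of_forall_pos_le_add fun κ hκ => ?_
  -- The threshold `q` costs less than `3σ`, and each of the two error terms costs `Cσ` under `μ t`;
  -- together this is `κ`.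
  set σ := κ / (3 + 2 * C) with hσ
  have hσ0 : 0 < σ := by positivity
  obtain ⟨r, hr, hrN⟩ := bnormLE_interp_sub a.2
  obtain ⟨N, hN⟩ := (hr.eventually (gt_mem_nhds hσ0)).exists
  obtain ⟨CN, hCN0, hCN⟩ := bnormLE_interp N
  obtain ⟨d, hd, hda⟩ := hD a a.2 (σ / (CN + 1)) (by positivity)
  have h1 : BNormLE (interp N (a : Phase → ℂ) - a) σ := (hrN N).mono hN.le
  have h2 : BNormLE (interp N ((a : Phase → ℂ) - d)) σ := (hCN _ _ hda).mono (by
    rw [mul_div_assoc', div_le_iff₀ (by positivity)]; nlinarith)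
  have heq : (a : symbols) = ⟨interp N d, interp_mem (hDs hd) N⟩ +
      ⟨interp N ((a : Phase → ℂ) - d), interp_mem (symbols.sub_mem a.2 (hDs hd)) N⟩ -
      ⟨interp N (a : Phase → ℂ) - a, symbols.sub_mem (interp_mem a.2 N) a.2⟩ := by
    refine Subtype.ext ?_
    change (a : Phase → ℂ) = interp N d + interp N ((a : Phase → ℂ) - d) - (interp N (a : Phase → ℂ) - a)
    rw [interp_sub]; abel
  obtain ⟨q, hq1, hq2⟩ := exists_rat_btwn (show δ + 2 * σ < δ + 3 * σ by linarith)
  have h3 := ht ⟨d, hd⟩ N q fun p => by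
    have e1 := (Complex.abs_re_le_norm _).trans (h1.norm_le p)
    have e2 := (Complex.abs_re_le_norm _).trans (h2.norm_le p)
    have e3 := ha p
    rw [interp_sub] at e2
    simp only [Pi.sub_apply, Complex.sub_re] at e1 e2
    rw [abs_le] at e1 e2
    change -(q : ℝ) ≤ (interp N d p).re
    linarith [e1.1, e2.2]
  have h4 := (Complex.abs_re_le_norm _).trans
    (hCt ⟨_, symbols.sub_mem (interp_mem a.2 N) a.2⟩ σ h1)
  have h5 := (Complex.abs_re_le_norm _).trans
    (hCt ⟨_, interp_mem (symbols.sub_mem a.2 (hDs hd)) N⟩ σ h2)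
  rw [abs_le] at h4 h5
  rw [heq, map_sub, map_add, Complex.sub_re, Complex.add_re]
  have h6 : κ = 3 * σ + 2 * (C * σ) := by rw [hσ]; field_simp
  linarith [h4.2, h5.1]

end IsTwoMicrolocalLimit

open scoped CompactlySupported

/-! ### Representation of positive forms by measures -/

/-- A smooth cutoff in `ξ`, equal to one on the ball of radius `n + 1`. -/
def cutoff (n : ℕ) : ContDiffBump (0 : Plane) := ⟨n + 1, n + 2, by positivity, by linarith⟩

theorem cutoff_mem (n : ℕ) : (fun p : Phase => ((cutoff n p.2.1 : ℝ) : ℂ)) ∈ symbols :=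
  symbols_of_plane (f := fun ξ => ((cutoff n ξ : ℝ) : ℂ))
    (Complex.ofRealCLM.contDiff.comp (cutoff n).contDiff)
    ((cutoff n).hasCompactSupport.comp_left (g := ((↑) : ℝ → ℂ)) rfl)

theorem cutoff_eq_one {n : ℕ} {ξ : Plane} (h : ‖ξ‖ ≤ n) : cutoff n ξ = 1 :=
  (cutoff n).one_of_mem_closedBall (by
    change ξ ∈ Metric.closedBall 0 ((n : ℝ) + 1); simp; linarith)

theorem cutoff_nonneg (n : ℕ) (ξ : Plane) : 0 ≤ cutoff n ξ := (cutoff n).nonneg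

theorem cutoff_le_one (n : ℕ) (ξ : Plane) : cutoff n ξ ≤ 1 := (cutoff n).le_one

/-- The cutoff as a continuous function with compact support on the phase space. -/
def cutoffC (n : ℕ) : C_c(Phase, ℝ) where
  toFun p := cutoff n p.2.1
  continuous_toFun := (cutoff n).continuous.comp (continuous_fst.comp continuous_snd)
  hasCompactSupport' := by
    have h := (mem_symbols_iff.1 (cutoff_mem n)).1.comp_left (g := Complex.re) rfl
    exact h

/-- The real symbols, as a subspace of the continuous functions with compact support. -/
def realSymbols : Submodule ℝ C_c(Phase, ℝ) where
  carrier := {f | (fun p => ((f p : ℝ) : ℂ)) ∈ symbols}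
  add_mem' := fun {f g} hf hg => by
    have := symbols.add_mem hf hg
    simpa only [Set.mem_ofPred_eq, CompactlySupportedContinuousMap.coe_add, Pi.add_apply,
      Complex.ofReal_add] using! this
  zero_mem' := by
    have h : (fun p => (((0 : C_c(Phase, ℝ)) p : ℝ) : ℂ)) = 0 := by ext p; simp
    change (fun p => (((0 : C_c(Phase, ℝ)) p : ℝ) : ℂ)) ∈ symbols
    rw [h]
    exact symbols.zero_mem
  smul_mem' := fun c f hf => by
    have := symbols.smul_mem (c : ℂ) hf
    simpa only [Set.mem_ofPred_eq, CompactlySupportedContinuousMap.coe_smul, Pi.smul_apply, smul_eq_mul,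
      Complex.ofReal_mul] using! this

def nonnegCone : PointedCone ℝ C_c(Phase, ℝ) where
  carrier := {f | ∀ p, 0 ≤ f p}
  add_mem' := fun hf hg p => add_nonneg (hf p) (hg p)
  zero_mem' := fun _ => le_rfl
  smul_mem' := fun c _ hf p => mul_nonneg c.2 (hf p)

def realForm (L : symbols →ₗ[ℂ] ℂ) : C_c(Phase, ℝ) →ₗ.[ℝ] ℝ where
  domain := realSymbols
  toFun :=
    { toFun := fun f => (L ⟨fun p => ((f.1 p : ℝ) : ℂ), f.2⟩).re
      map_add' := fun f g => by
        rw [← Complex.add_re, ← map_add]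
        congr 2
        ext p
        simp
      map_smul' := fun c f => by
        have : (⟨fun p => (((c • f).1 p : ℝ) : ℂ), (c • f).2⟩ : symbols) =
            (c : ℂ) • ⟨fun p => ((f.1 p : ℝ) : ℂ), f.2⟩ := by
          ext p
          simp
        rw [this, map_smul, smul_eq_mul, Complex.re_ofReal_mul]
        rfl }

/-- M. Riesz extension yields a positive form on all of `C_c`, since each function is dominated by a
multiple of a cutoff in `ξ`, which is a symbol. The Riesz–Markov–Kakutani theorem then gives the
measure. Its mass is at most one because the cutoffs are at most one. -/
theorem exists_measure {L : symbols →ₗ[ℂ] ℂ}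
    (hL : ∀ (a : symbols) (δ : ℝ), (∀ p, -δ ≤ ((a : Phase → ℂ) p).re) → -δ ≤ (L a).re) :
    ∃ m : Measure Phase, m Set.univ ≤ 1 ∧ ∀ a : symbols, L a = ∫ p, (a : Phase → ℂ) p ∂m := by
  obtain ⟨g, hg, hgpos⟩ := riesz_extension nonnegCone (realForm L)
    (fun f hf => by
      have := hL ⟨fun p => ((f.1 p : ℝ) : ℂ), f.2⟩ 0 fun p => by simpa using hf p
      rw [neg_zero] at this
      exact this)
    (fun y => by
      obtain ⟨B, hB⟩ := y.hasCompactSupport.exists_bound_of_continuous y.continuous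
      have hB0 : 0 ≤ B := (norm_nonneg _).trans (hB 0)
      obtain ⟨R, hR⟩ := ((y.hasCompactSupport.isCompact.image
        (continuous_fst.comp continuous_snd)).isBounded.subset_closedBall (0 : Plane))
      obtain ⟨n, hn⟩ := exists_nat_ge R
      refine ⟨⟨B • cutoffC n, realSymbols.smul_mem B (cutoff_mem n)⟩, ?_⟩
      intro p
      change 0 ≤ B * cutoff n p.2.1 + y p
      by_cases hp : p ∈ tsupport y
      · have : ‖p.2.1‖ ≤ n := by
          have := hR ⟨p, hp, rfl⟩
          simp at this
          exact this.trans hn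
        rw [cutoff_eq_one this]
        have := (abs_le.1 (hB p)).1
        linarith
      · rw [image_eq_zero_of_notMem_tsupport hp, add_zero]
        exact mul_nonneg hB0 (cutoff_nonneg _ _))
  set Λ : C_c(Phase, ℝ) →ₚ[ℝ] ℝ := PositiveLinearMap.mk₀ g fun f hf =>
    hgpos f fun p => hf p with hΛ
  set m := RealRMK.rieszMeasure Λ with hm
  have hmass : m Set.univ ≤ 1 := by
    have hn : ∀ n : ℕ, m (Set.univ ×ˢ (Metric.closedBall (0 : Plane) n ×ˢ Set.univ)) ≤ 1 := fun n => by
      refine (RealRMK.rieszMeasure_le_of_eq_one (f := cutoffC n) Λ (fun p => cutoff_nonneg n _)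
        (isCompact_univ.prod ((isCompact_closedBall _ _).prod isCompact_univ)) fun p hp => ?_).trans ?_
      · exact cutoff_eq_one (by simpa using hp.2.1)
      · rw [← ENNReal.ofReal_one]
        refine ENNReal.ofReal_le_ofReal ?_
        have h1 : Λ (cutoffC n) = (L ⟨_, cutoff_mem n⟩).re := hg ⟨cutoffC n, cutoff_mem n⟩
        have h2 := hL (-⟨_, cutoff_mem n⟩) 1 fun p => by
          have := cutoff_le_one n p.2.1
          simpa using this
        rw [map_neg, Complex.neg_re] at h2
        rw [h1]; linarith
    have hu : (Set.univ : Set Phase) = ⋃ n : ℕ, Set.univ ×ˢ (Metric.closedBall (0 : Plane) n ×ˢ Set.univ) := by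
      symm
      rw [Set.eq_univ_iff_forall]
      intro p
      obtain ⟨n, hn⟩ := exists_nat_ge ‖p.2.1‖
      exact Set.mem_iUnion.2 ⟨n, trivial, by simpa using hn, trivial⟩
    rw [hu, Directed.measure_iUnion]
    · exact iSup_le hn
    · refine (monotone_nat_of_le_succ fun n => ?_).directed_le
      refine Set.prod_mono_right (Set.prod_mono_left (Metric.closedBall_subset_closedBall ?_))
      push_cast; linarith
  have hreal : ∀ (f : Phase → ℝ) (hf : (fun p => ((f p : ℝ) : ℂ)) ∈ symbols),
      L ⟨_, hf⟩ = ((∫ p, f p ∂m : ℝ) : ℂ) := by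
    intro f hf
    have hfc : Continuous f := Complex.continuous_re.comp (symbols_continuous hf)
    have hfs : HasCompactSupport f := (mem_symbols_iff.1 hf).1.comp_left (g := Complex.re) rfl
    set F : C_c(Phase, ℝ) := ⟨⟨f, hfc⟩, hfs⟩ with hF
    have h1 : ∫ p, f p ∂m = (L ⟨_, hf⟩).re := by
      have := RealRMK.integral_rieszMeasure Λ F
      exact this.trans (hg ⟨F, hf⟩)
    -- For real `f` the symbols `±i f` have zero real part, so `hL` with `δ = 0` applies to both
    -- signs and makes `L f` real.
    have h2 := hL (Complex.I • ⟨_, hf⟩) 0 fun p => by simp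
    have h3 := hL (-(Complex.I • ⟨_, hf⟩)) 0 fun p => by simp
    refine Complex.ext (by simp [h1]) ?_
    simp only [map_neg, map_smul, smul_eq_mul, Complex.neg_re, Complex.mul_re, Complex.I_re, Complex.I_im,
      zero_mul, one_mul, zero_sub, neg_neg, neg_zero] at h2 h3
    simp only [Complex.ofReal_im]
    linarith
  refine ⟨m, hmass, fun a => ?_⟩
  have : IsFiniteMeasure m := ⟨hmass.trans_lt ENNReal.one_lt_top⟩
  have hre : (fun p => ((((a : Phase → ℂ) p).re : ℝ) : ℂ)) ∈ symbols :=
    symbols_postcomp a.2 (Complex.ofRealCLM.comp Complex.reCLM)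
  have him : (fun p => ((((a : Phase → ℂ) p).im : ℝ) : ℂ)) ∈ symbols :=
    symbols_postcomp a.2 (Complex.ofRealCLM.comp Complex.imCLM)
  have hsum : a = ⟨_, hre⟩ + Complex.I • ⟨_, him⟩ := by
    ext p
    simp only [Submodule.coe_add, Submodule.coe_smul, Pi.add_apply, Pi.smul_apply, smul_eq_mul]
    rw [mul_comm, Complex.re_add_im]
  have hint : Integrable (a : Phase → ℂ) m :=
    (symbols_continuous a.2).integrable_of_hasCompactSupport (mem_symbols_iff.1 a.2).1
  conv_lhs => rw [hsum, map_add, map_smul, hreal, hreal]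
  rw [← integral_re_add_im hint, smul_eq_mul, mul_comm]
  rfl

/-! ### The part at infinity of the limit measure -/

theorem measurableSet_infinityPart : MeasurableSet infinityPart :=
  ((measurableSet_singleton (⊤ : EReal)).preimage (measurable_snd.comp measurable_snd)).union
    ((measurableSet_singleton (⊥ : EReal)).preimage (measurable_snd.comp measurable_snd))

theorem highPass_mem (R : ℝ) (η : EReal) : 0 ≤ highPass R η ∧ highPass R η ≤ 1 := by
  unfold highPass extend
  split_ifs
  · simp
  · simp
  · exact ⟨by positivity, div_le_one_of_le₀ (by nlinarith [sq_nonneg R]) (by positivity)⟩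

theorem tendsto_highPass (η : EReal) : Tendsto (fun n : ℕ => highPass ((n : ℝ) + 1) η) atTop
    (𝓝 (if η = ⊤ ∨ η = ⊥ then 1 else 0)) := by
  induction η using EReal.rec with
  | bot => simp [highPass]
  | top => simp [highPass]
  | coe s =>
    simp only [highPass, extend_coe, EReal.coe_ne_top, EReal.coe_ne_bot, or_self, if_false]
    refine Tendsto.const_div_atTop ?_ _
    refine tendsto_atTop_add_const_right _ _ ((tendsto_pow_atTop two_ne_zero).comp ?_)
    exact tendsto_atTop_add_const_right _ _ tendsto_natCast_atTop_atTop

theorem norm_modeSymbol (k : Fin 2 → ℤ) (b : Plane × EReal → ℂ) (p : Phase) :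
    ‖modeSymbol k b p‖ = ‖b p.2‖ := by
  rw [modeSymbol, norm_mul, norm_mFourier_apply, mul_one]

theorem norm_filtered_le (R : ℝ) (b : Plane × EReal → ℂ) (q : Plane × EReal) :
    ‖filtered R b q‖ ≤ ‖b q‖ := by
  rw [filtered, norm_mul, Complex.norm_real, Real.norm_of_nonneg (highPass_mem R _).1]
  exact mul_le_of_le_one_right (norm_nonneg _) (highPass_mem R _).2

theorem integrable_symbol {a : Phase → ℂ} (ha : a ∈ symbols) (m : Measure Phase) [IsFiniteMeasure m] :
    Integrable a m :=
  (symbols_continuous ha).integrable_of_hasCompactSupport (mem_symbols_iff.1 ha).1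

theorem succ_pos' (n : ℕ) : (0 : ℝ) < (n : ℝ) + 1 := by positivity

theorem tendsto_integral_filtered (m : Measure Phase) [IsFiniteMeasure m] (k : Fin 2 → ℤ)
    {b : Plane × EReal → ℂ} (hb : b ∈ fiberSymbols) :
    Tendsto (fun n : ℕ => ∫ p, modeSymbol k (filtered ((n : ℝ) + 1) b) p ∂m) atTop
      (𝓝 (∫ p in infinityPart, modeSymbol k b p ∂m)) := by
  rw [← integral_indicator measurableSet_infinityPart]
  refine tendsto_integral_of_dominated_convergence (fun p => ‖modeSymbol k b p‖)
    (fun n => ((symbols_continuous (modeSymbol_mem (filtered_mem (succ_pos' n) hb) k))).aestronglyMeasurable)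
    (integrable_symbol (modeSymbol_mem hb k) m).norm (fun n => ae_of_all _ fun p => ?_)
    (ae_of_all _ fun p => ?_)
  · rw [norm_modeSymbol, norm_modeSymbol]
    exact norm_filtered_le _ _ _
  · have h := ((Complex.continuous_ofReal.tendsto _).comp (tendsto_highPass p.2.2)).const_mul
      (modeSymbol k b p)
    refine (h.congr fun n => ?_).trans_eq ?_
    · simp only [modeSymbol, filtered, Function.comp_apply]; ring
    · congr 1
      by_cases hp : p ∈ infinityPart
      · have : p.2.2 = ⊤ ∨ p.2.2 = ⊥ := hp
        simp [hp, this]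
      · have : ¬ (p.2.2 = ⊤ ∨ p.2.2 = ⊥) := hp
        simp [hp, this]

/-- A family of measures representing a family of linear forms. -/
def Represents (m : ℝ → Measure Phase) (μ : ℝ → symbols →ₗ[ℂ] ℂ) : Prop :=
  ∀ᵐ t, m t Set.univ ≤ 1 ∧ ∀ a : symbols, μ t a = ∫ p, (a : Phase → ℂ) p ∂(m t)

namespace IsTwoMicrolocalLimit

variable {w : (Fin 2 → ℤ) → ℂ} {e : Fin 2 → ℤ} {ħ ε τ : ℕ → ℝ} {v : ℕ → ℝ → L2}
  {μ : ℝ → symbols →ₗ[ℂ] ℂ} {m : ℝ → Measure Phase}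

/-- The measures are chosen time by time, arbitrarily at exceptional times. No measurability in `t`
is required of the family: integrals of symbols inherit it from `μ`. -/
theorem exists_represents (h : IsTwoMicrolocalLimit w e ħ ε τ v μ) :
    ∃ m : ℝ → Measure Phase, Represents m μ := by
  classical
  have hex : ∀ t, ∃ m : Measure Phase,
      (∀ (a : symbols) (δ : ℝ), (∀ p, -δ ≤ ((a : Phase → ℂ) p).re) → -δ ≤ (μ t a).re) →
      m Set.univ ≤ 1 ∧ ∀ a : symbols, μ t a = ∫ p, (a : Phase → ℂ) p ∂m := fun t => by
    by_cases ht : ∀ (a : symbols) (δ : ℝ), (∀ p, -δ ≤ ((a : Phase → ℂ) p).re) → -δ ≤ (μ t a).re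
    · obtain ⟨m, hm⟩ := exists_measure ht
      exact ⟨m, fun _ => hm⟩
    · exact ⟨0, fun h => absurd h ht⟩
  choose m hm using hex
  exact ⟨m, h.ae_re_ge.mono fun t ht => hm t ht⟩

/-- With `R = n + 1`, dominated convergence in phase space and then in time identifies the limit of
the filtered integrals with the integral at infinity, while the bound `K/R` sends it to zero for
every test function `θ`. -/
theorem ae_integral_infinityPart_eq_zero (h : IsTwoMicrolocalLimit w e ħ ε τ v μ)
    (hm : Represents m μ) (hτε : ∀ᶠ n in atTop, 1 ≤ τ n * ε n) {l : ℤ} (hl : l ≠ 0) (he : e ≠ 0)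
    {b : Plane × EReal → ℂ} (hb : b ∈ fiberSymbols) :
    ∀ᵐ t, ∫ p in infinityPart, modeSymbol (l • e) b p ∂(m t) = 0 := by
  obtain ⟨B, hB0, hB⟩ := fiber_bounded hb
  set F : ℕ → ℝ → ℂ := fun n t => μ t (modeMap (l • e) ⟨filtered ((n : ℝ) + 1) b, filtered_mem (succ_pos' n) hb⟩)
    with hF
  set f : ℝ → ℂ := fun t => ∫ p in infinityPart, modeSymbol (l • e) b p ∂(m t) with hf
  have hFf : ∀ᵐ t, Tendsto (fun n => F n t) atTop (𝓝 (f t)) := by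
    filter_upwards [hm] with t ht
    have : IsFiniteMeasure (m t) := ⟨ht.1.trans_lt ENNReal.one_lt_top⟩
    refine (tendsto_integral_filtered (m t) (l • e) hb).congr fun n => ?_
    exact (ht.2 (modeMap (l • e) ⟨filtered ((n : ℝ) + 1) b, filtered_mem (succ_pos' n) hb⟩)).symm
  have hbound : ∀ᵐ t, ∀ n, ‖F n t‖ ≤ B := by
    filter_upwards [hm] with t ht n
    have : IsFiniteMeasure (m t) := ⟨ht.1.trans_lt ENNReal.one_lt_top⟩
    change ‖μ t _‖ ≤ B
    rw [ht.2]
    refine (norm_integral_le_of_norm_le_const (C := B) (ae_of_all _ fun p => ?_)).trans ?_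
    · exact (norm_modeSymbol _ _ _).trans_le ((norm_filtered_le _ _ _).trans (hB _))
    · refine mul_le_of_le_one_right hB0 ?_
      exact ENNReal.toReal_le_of_le_ofReal zero_le_one (by simpa using ht.1)
  -- The restriction to infinity is not a symbol, so measurability in time comes from its
  -- approximation by symbols.
  have hfm : AEStronglyMeasurable f volume :=
    aestronglyMeasurable_of_tendsto_ae atTop (fun n => h.dual.1 _) hFf
  have hfb : ∀ᵐ t, ‖f t‖ ≤ B := by
    filter_upwards [hFf, hbound] with t h1 h2
    exact le_of_tendsto h1.norm (Eventually.of_forall h2)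
  refine ae_eq_zero_of_integral_contDiff_smul_eq_zero ?_ fun θ hθ hθc => ?_
  · intro t
    exact ⟨Metric.ball t 1, Metric.ball_mem_nhds t one_pos,
      Measure.integrableOn_of_bounded (M := B) measure_ball_lt_top.ne hfm (ae_restrict_of_ae hfb)⟩
  · obtain ⟨K, hK⟩ := h.norm_integral_filtered_le hτε hl he hb hθ hθc
    have hθi := hθ.continuous.integrable_of_hasCompactSupport (μ := volume) hθc
    have h1 : Tendsto (fun n => ∫ t, θ t • F n t) atTop (𝓝 (∫ t, θ t • f t)) := by
      refine tendsto_integral_of_dominated_convergence (fun t => ‖θ t‖ * B)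
        (fun n => hθ.continuous.aestronglyMeasurable.smul (h.dual.1 _)) (hθi.norm.mul_const B)
        (fun n => ?_) ?_
      · filter_upwards [hbound] with t ht
        rw [norm_smul]
        exact mul_le_mul_of_nonneg_left (ht n) (norm_nonneg _)
      · filter_upwards [hFf] with t ht
        exact ht.const_smul _
    refine tendsto_nhds_unique h1 (squeeze_zero_norm (a := fun n : ℕ => K / ((n : ℝ) + 1)) (fun n => ?_) ?_)
    · simpa only [Complex.real_smul] using hK ((n : ℝ) + 1) (by simp)
    · exact tendsto_const_nhds.div_atTop (tendsto_atTop_add_const_right _ _ tendsto_natCast_atTop_atTop)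

/-- The weight `k·ξ` commutes with the filter in `η`, so the integrals vanish exactly before the
passage to infinity. -/
theorem ae_integral_infinityPart_flowed (h : IsTwoMicrolocalLimit w e ħ ε τ v μ)
    (hm : Represents m μ) (k : Fin 2 → ℤ) {b : Plane × EReal → ℂ} (hb : b ∈ fiberSymbols) :
    ∀ᵐ t, ∫ p in infinityPart, modeSymbol k (flowed k b) p ∂(m t) = 0 := by
  have h0 : ∀ᵐ t, ∀ n : ℕ, μ t (modeMap k ⟨flowed k (filtered ((n : ℝ) + 1) b),
      flowed_mem k (filtered_mem (succ_pos' n) hb)⟩) = 0 :=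
    ae_all_iff.2 fun n => h.ae_flowed_eq_zero k (filtered_mem (succ_pos' n) hb)
  filter_upwards [h0, hm] with t h1 ht
  have : IsFiniteMeasure (m t) := ⟨ht.1.trans_lt ENNReal.one_lt_top⟩
  refine tendsto_nhds_unique (tendsto_integral_filtered (m t) k (flowed_mem k hb))
    (tendsto_const_nhds.congr fun n => ?_)
  rw [← h1 n, ht.2]
  refine integral_congr_ae (ae_of_all _ fun p => ?_)
  simp only [modeMap, LinearMap.coe_mk, AddHom.coe_mk, modeSymbol, flowed, filtered]
  ring

end IsTwoMicrolocalLimit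

/-- A null integral at almost every time for each symbol is so for all symbols at once. -/
theorem Represents.ae_forall_integral_eq_zero {μ : ℝ → symbols →ₗ[ℂ] ℂ} {m : ℝ → Measure Phase}
    (hm : Represents m μ) {S : Set (Phase → ℂ)} (hS : S ⊆ symbols) {E : Set Phase}
    (h : ∀ a ∈ S, ∀ᵐ t, ∫ p in E, a p ∂(m t) = 0) :
    ∀ᵐ t, ∀ a ∈ S, ∫ p in E, a p ∂(m t) = 0 := by
  obtain ⟨D, hDS, hDc, hD⟩ := exists_countable_dense_symbols S hS
  have hall : ∀ᵐ t, ∀ d ∈ D, ∫ p in E, d p ∂(m t) = 0 :=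
    (ae_ball_iff hDc).2 fun d hd => h d (hDS hd)
  filter_upwards [hall, hm] with t ht hmt a ha
  have : IsFiniteMeasure (m t) := ⟨hmt.1.trans_lt ENNReal.one_lt_top⟩
  refine norm_le_zero_iff.1 (le_of_forall_pos_le_add fun δ hδ => ?_)
  obtain ⟨d, hd, hda⟩ := hD a ha δ hδ
  have h1 : ∫ p in E, a p ∂(m t) = ∫ p in E, (a p - d p) ∂(m t) := by
    rw [integral_sub (integrable_symbol (hS ha) _) (integrable_symbol (hS (hDS hd)) _), ht d hd, sub_zero]
  rw [h1, zero_add]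
  refine (norm_integral_le_of_norm_le_const (C := δ) (ae_of_all _ hda)).trans ?_
  refine mul_le_of_le_one_right hδ.le ?_
  refine ENNReal.toReal_le_of_le_ofReal zero_le_one ?_
  rw [ENNReal.ofReal_one]
  exact (Measure.restrict_apply_univ E).trans_le ((measure_mono (Set.subset_univ _)).trans hmt.1)

/-! ### Tools for the zero frequency. -/

theorem modeSymbol_zero (b : Plane × EReal → ℂ) (p : Phase) : modeSymbol 0 b p = b p.2 := by
  simp [modeSymbol, UnitAddTorus.mFourier_zero]

theorem latticeVec_zero : latticeVec 0 = 0 := by ext i; simp [latticeVec]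

theorem kinetic_eq_midFreq (ħ : ℝ) (j : Fin 2 → ℤ) : kinetic ħ j = ‖midFreq ħ 0 j‖ ^ 2 / 2 := by
  rw [midFreq, latticeVec_zero, smul_zero, add_zero, norm_smul, mul_pow, Real.norm_eq_abs, sq_abs, kinetic]
  ring

/-- A smooth cutoff in `ξ` near the origin, at the scale `1 / (n + 1)`. -/
def originBump (n : ℕ) : ContDiffBump (0 : Plane) :=
  ⟨((n : ℝ) + 1)⁻¹, 2 * ((n : ℝ) + 1)⁻¹, by positivity, by
    have : (0 : ℝ) < ((n : ℝ) + 1)⁻¹ := by positivity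
    linarith⟩

theorem originBump_mem (n : ℕ) : (fun q : Plane × EReal => ((originBump n q.1 : ℝ) : ℂ)) ∈ fiberSymbols :=
  symbols_of_plane (f := fun ξ => ((originBump n ξ : ℝ) : ℂ))
    (Complex.ofRealCLM.contDiff.comp (originBump n).contDiff)
    ((originBump n).hasCompactSupport.comp_left (g := ((↑) : ℝ → ℂ)) rfl)

namespace IsTwoMicrolocalLimit

variable {w : (Fin 2 → ℤ) → ℂ} {e : Fin 2 → ℤ} {ħ ε τ : ℕ → ℝ} {v : ℕ → ℝ → L2}
  {μ : ℝ → symbols →ₗ[ℂ] ℂ} {m : ℝ → Measure Phase}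

/-! ### Absence of mass at the origin -/

theorem low_frequency (h : IsTwoMicrolocalLimit w e ħ ε τ v μ) {δ : ℝ} (hδ : 0 < δ) :
    ∃ T > 0, ∀ᶠ n in atTop, ∀ F : Finset (Fin 2 → ℤ), (∀ j ∈ F, kinetic (ħ n) j * T ≤ 1 / 2) →
      ∀ t, ‖modeSum F (coef (v n t))‖ ≤ δ := by
  obtain ⟨ρ, hρ, hlow⟩ := h.low (δ / 8) (by positivity)
  -- This `T` makes `2/(ρT) = δ/8`. It does not depend on `n`, so `ε²T → 0`; the bound becomes at
  -- most `2(δ/8 + δ/8 + 2δ/8) = δ`.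
  have hT : 0 < 16 / (ρ * δ) := by positivity
  refine ⟨16 / (ρ * δ), hT, ?_⟩
  have hlim : Tendsto (fun n => ε n ^ 2 * (16 / (ρ * δ)) * ∑' l, ‖w l‖) atTop (𝓝 0) := by
    simpa using ((h.eps_tendsto.pow 2).mul_const (16 / (ρ * δ))).mul_const (∑' l, ‖w l‖)
  filter_upwards [hlow, hlim.eventually (gt_mem_nhds (by positivity : 0 < δ / 8))] with n h1 h2 F hF t
  have h3 := (h.solution n).low_frequency_le h.summable h.conj (h.hbar_pos n) hT hρ (h.normalized n 0)
    h1 F hF t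
  refine h3.trans ?_
  have h4 : 2 / (ρ * (16 / (ρ * δ))) = δ / 8 := by field_simp; norm_num
  rw [h4]
  linarith

theorem ae_re_le (h : IsTwoMicrolocalLimit w e ħ ε τ v μ) (k : Fin 2 → ℤ) (b : fiberSymbols) {κ : ℝ}
    (hκ : ∀ᶠ n in atTop, ∀ t,
      (shiftForm k 0 (fun j => sampled e (ε n) b (midFreq (ħ n) k j)) (v n t)).re ≤ κ) :
    ∀ᵐ t, (μ t (modeMap k b)).re ≤ κ := by
  obtain ⟨B, hB0, hB⟩ := fiber_bounded b.2
  have hre : ∀ s, volume s < ⊤ → Integrable (fun t => (μ t (modeMap k b)).re) (volume.restrict s) :=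
    fun s hs => Integrable.re (h.dual.integrableOn _ hs)
  have := ae_nonneg_of_forall_setIntegral_nonneg_of_sigmaFinite (μ := (volume : Measure ℝ))
    (f := fun t => κ - (μ t (modeMap k b)).re)
    (fun s _ hs => (integrableOn_const hs.ne).sub (hre s hs)) fun s hs hs' => by
      have hconst : Integrable (fun _ : ℝ => κ) (volume.restrict s) := integrableOn_const hs'.ne
      rw [integral_sub hconst (hre s hs'), sub_nonneg]
      have hind : Integrable (s.indicator fun _ : ℝ => (1 : ℂ)) :=
        (integrable_indicator_iff hs).2 (integrableOn_const hs'.ne)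
      have hlim := (Complex.continuous_re.tendsto _).comp (h.limit _ hind b k)
      have hconv : ∀ f : ℝ → ℂ, ∫ t, s.indicator (fun _ : ℝ => (1 : ℂ)) t * f t = ∫ t in s, f t := fun f => by
        rw [← integral_indicator hs]
        refine integral_congr_ae (ae_of_all _ fun t => ?_)
        by_cases ht : t ∈ s <;> simp [ht]
      simp only [hconv] at hlim
      have hq : ∫ t in s, (μ t (modeMap k b)).re = (∫ t in s, μ t (modeMap k b)).re :=
        integral_re (𝕜 := ℂ) (h.dual.integrableOn _ hs')
      rw [hq]
      refine le_of_tendsto hlim (hκ.mono fun n hn => ?_)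
      have hi : IntegrableOn (fun t => shiftForm k 0 (fun j => sampled e (ε n) b (midFreq (ħ n) k j))
          (v n (t * τ n))) s := by
        refine Measure.integrableOn_of_bounded (M := B) hs'.ne
          ((continuous_sampled_form e (ε n) (h.hbar_pos n) k b).comp ((h.solution n).continuous.comp
            (continuous_id.mul continuous_const))).aestronglyMeasurable (ae_of_all _ fun t => ?_)
        have := norm_shiftForm_le (fun j => hB _ : ∀ j, ‖sampled e (ε n) b (midFreq (ħ n) k j)‖ ≤ B)
          (v n (t * τ n)) k 0
        rwa [h.normalized, one_pow, mul_one] at this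
      have h1 : (∫ t in s, shiftForm k 0 (fun j => sampled e (ε n) b (midFreq (ħ n) k j))
          (v n (t * τ n))).re = ∫ t in s, (shiftForm k 0 (fun j => sampled e (ε n) b (midFreq (ħ n) k j))
          (v n (t * τ n))).re := (integral_re (𝕜 := ℂ) hi).symm
      refine h1.trans_le (setIntegral_mono_on (Integrable.re hi) (integrableOn_const hs'.ne) hs
        fun t _ => hn _)
  filter_upwards [this] with t ht
  have : 0 ≤ κ - (μ t (modeMap k b)).re := ht
  linarith

theorem exists_originBump_le (h : IsTwoMicrolocalLimit w e ħ ε τ v μ) {δ : ℝ} (hδ : 0 < δ) :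
    ∃ i : ℕ, ∀ᵐ t, (μ t (modeMap 0 ⟨_, originBump_mem i⟩)).re ≤ δ ^ 2 := by
  obtain ⟨T, hT, hlow⟩ := h.low_frequency hδ
  -- On the support of the bump `‖ξ‖ < 2/(i + 1)`, so the kinetic energy `‖ξ‖²/2` is at most `2/(i +
  -- 1)`, and its product with `T` at most `1/2`.
  obtain ⟨i, hi⟩ := exists_nat_ge (4 * T)
  refine ⟨i, h.ae_re_le 0 _ (hlow.mono fun n hn t => ?_)⟩
  have hfin := finite_support_midFreq (h.hbar_pos n) 0
    (sampled_hasCompactSupport e (ε n) (originBump_mem i))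
  refine (Complex.re_le_norm _).trans ?_
  rw [shiftForm_eq_sum hfin]
  have h1 := hn hfin.toFinset (fun j hj => ?_) t
  · refine le_trans ?_ (pow_le_pow_left₀ (norm_nonneg _) h1 2)
    rw [norm_modeSum_sq]
    refine norm_sum_le_of_le _ fun j _ => ?_
    rw [add_zero, norm_mul, norm_mul, RCLike.norm_conj, mul_right_comm, ← sq]
    refine mul_le_of_le_one_right (by positivity) ?_
    rw [sampled, Complex.norm_real, Real.norm_of_nonneg (originBump i).nonneg]
    exact (originBump i).le_one
  · have hj' : originBump i (midFreq (ħ n) 0 j) ≠ 0 := by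
      have := (Set.Finite.mem_toFinset hfin).1 hj
      simpa [sampled] using this
    have h2 : midFreq (ħ n) 0 j ∈ Function.support (originBump i) := hj'
    rw [ContDiffBump.support_eq, mem_ball_zero_iff] at h2
    have h3 : ‖midFreq (ħ n) 0 j‖ < 2 * ((i : ℝ) + 1)⁻¹ := h2
    have h4 : ‖midFreq (ħ n) 0 j‖ ^ 2 ≤ 4 * ((i : ℝ) + 1)⁻¹ := by
      have h5 : ((i : ℝ) + 1)⁻¹ ≤ 1 := inv_le_one_of_one_le₀ (by simp)
      have h6 : 0 < ((i : ℝ) + 1)⁻¹ := by positivity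
      nlinarith [norm_nonneg (midFreq (ħ n) 0 j)]
    have h7 : ((i : ℝ) + 1)⁻¹ * (4 * T) ≤ 1 := by
      rw [inv_mul_le_iff₀ (by positivity)]; linarith
    rw [kinetic_eq_midFreq]
    nlinarith

/-- Each bump equals one at `ξ = 0`, so the mass there is bounded by arbitrarily small integrals of
bumps. -/
theorem ae_measure_origin_eq_zero (h : IsTwoMicrolocalLimit w e ħ ε τ v μ) (hm : Represents m μ) :
    ∀ᵐ t, m t {p | p.2.1 = 0} = 0 := by
  have hex : ∀ n : ℕ, ∃ i : ℕ, ∀ᵐ t, (μ t (modeMap 0 ⟨_, originBump_mem i⟩)).re ≤ (((n : ℝ) + 1)⁻¹) ^ 2 :=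
    fun n => h.exists_originBump_le (by positivity)
  choose i hi using hex
  filter_upwards [ae_all_iff.2 hi, hm] with t ht hmt
  have : IsFiniteMeasure (m t) := ⟨hmt.1.trans_lt ENNReal.one_lt_top⟩
  have hmeas : MeasurableSet {p : Phase | p.2.1 = 0} :=
    (measurableSet_singleton (0 : Plane)).preimage (measurable_fst.comp measurable_snd)
  have hle : ∀ n : ℕ, (m t).real {p | p.2.1 = 0} ≤ (((n : ℝ) + 1)⁻¹) ^ 2 := by
    intro n
    refine le_trans ?_ (ht n)
    rw [hmt.2]
    have hint := integrable_symbol (modeMap 0 ⟨_, originBump_mem (i n)⟩).2 (m t)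
    have hre : (∫ p, (modeMap 0 ⟨_, originBump_mem (i n)⟩ : Phase → ℂ) p ∂(m t)).re =
        ∫ p, originBump (i n) p.2.1 ∂(m t) := by
      rw [← RCLike.re_eq_complex_re, ← integral_re hint]
      refine integral_congr_ae (ae_of_all _ fun p => ?_)
      simp [modeMap, modeSymbol_zero]
    rw [hre, ← integral_indicator_one hmeas]
    refine integral_mono ((integrable_indicator_iff hmeas).2 (integrable_const _).integrableOn) ?_ fun p => ?_
    · have := Integrable.re hint
      refine this.congr (ae_of_all _ fun p => ?_)
      simp [modeMap, modeSymbol_zero]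
    · by_cases hp : p.2.1 = 0
      · have h1 : originBump (i n) p.2.1 = 1 := by
          rw [hp]
          exact (originBump (i n)).one_of_mem_closedBall (by simp [(originBump (i n)).rIn_pos.le])
        rw [h1]
        exact Set.indicator_le_self' (fun _ _ => zero_le_one) _
      · simp [hp, (originBump (i n)).nonneg]
  have hlim : Tendsto (fun n : ℕ => (((n : ℝ) + 1)⁻¹) ^ 2) atTop (𝓝 (0 ^ 2)) :=
    (tendsto_inv_atTop_zero.comp
      (tendsto_atTop_add_const_right _ _ tendsto_natCast_atTop_atTop)).pow 2
  have h0 := ge_of_tendsto' hlim hle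
  rw [zero_pow two_ne_zero] at h0
  exact (measureReal_eq_zero_iff).1 (le_antisymm h0 measureReal_nonneg)

end IsTwoMicrolocalLimit

/-! ### From smooth to bounded multipliers -/

/-- Test functions are dense in `L¹` of the image of `M` in the variable `ξ`. This admits indicator
functions of `Λ^⊥`, which are not symbols. -/
theorem integral_eq_zero_of_smooth {M : Measure Phase} [IsFiniteMeasure M] {F : Phase → ℂ}
    (hF : Measurable F) {B : ℝ} (hB : ∀ p, ‖F p‖ ≤ B)
    (h : ∀ f : Plane → ℂ, ContDiff ℝ ∞ f → HasCompactSupport f → ∫ p, f p.2.1 * F p ∂M = 0)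
    {g : Plane → ℂ} (hg : Measurable g) {C : ℝ} (hC : ∀ ξ, ‖g ξ‖ ≤ C) :
    ∫ p, g p.2.1 * F p ∂M = 0 := by
  have hπ : Measurable fun p : Phase => p.2.1 := measurable_fst.comp measurable_snd
  set ρ := M.map fun p => p.2.1 with hρ
  have hg1 : MemLp g 1 ρ := MemLp.of_bound hg.aestronglyMeasurable C (ae_of_all _ hC)
  have hB0 : 0 ≤ B := (norm_nonneg _).trans (hB 0)
  refine norm_le_zero_iff.1 (le_of_forall_pos_le_add fun δ hδ => ?_)
  obtain ⟨f, hfc, hfs, hfg⟩ := hg1.exist_eLpNorm_sub_le ENNReal.one_ne_top le_rfl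
    (show 0 < δ / (B + 1) by positivity)
  have hfi : Integrable f ρ := hfs.continuous.integrable_of_hasCompactSupport hfc
  have hgi : Integrable g ρ := memLp_one_iff_integrable.1 hg1
  have hsub : Integrable (fun p : Phase => g p.2.1 - f p.2.1) M :=
    (hgi.sub hfi).comp_measurable hπ
  have hmulF : ∀ {q : Plane → ℂ}, Integrable q ρ → Integrable (fun p : Phase => q p.2.1 * F p) M :=
    fun hq => (hq.comp_measurable hπ).mul_bdd (c := B) hF.aestronglyMeasurable (ae_of_all _ hB)
  have h1 : ∫ p, g p.2.1 * F p ∂M = ∫ p, (g p.2.1 - f p.2.1) * F p ∂M := by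
    simp only [sub_mul]
    rw [integral_sub (hmulF hgi) (hmulF hfi), h f hfs hfc, sub_zero]
  have h2 : ∫ p, ‖g p.2.1 - f p.2.1‖ ∂M ≤ δ / (B + 1) := by
    have h3 : ∫ p, ‖g p.2.1 - f p.2.1‖ ∂M = ∫ ξ, ‖(g - f) ξ‖ ∂ρ :=
      (integral_map hπ.aemeasurable (hgi.sub hfi).1.norm).symm
    rw [h3, integral_norm_eq_lintegral_enorm (hgi.sub hfi).1, ← eLpNorm_one_eq_lintegral_enorm]
    exact ENNReal.toReal_le_of_le_ofReal (by positivity) hfg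
  rw [h1, zero_add]
  calc ‖∫ p, (g p.2.1 - f p.2.1) * F p ∂M‖ ≤ ∫ p, ‖g p.2.1 - f p.2.1‖ * B ∂M := by
        refine norm_integral_le_of_norm_le (hsub.norm.mul_const B) (ae_of_all _ fun p => ?_)
        rw [norm_mul]
        exact mul_le_mul_of_nonneg_left (hB p) (norm_nonneg _)
    _ = (∫ p, ‖g p.2.1 - f p.2.1‖ ∂M) * B := integral_mul_const _ _
    _ ≤ δ / (B + 1) * B := mul_le_mul_of_nonneg_right h2 hB0
    _ ≤ δ := by
        rw [div_mul_eq_mul_div, div_le_iff₀ (by positivity)]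
        nlinarith

/-! ### Fourier modes at infinity over `Λ^⊥` -/

/-- The measure has the invariances of a two-microlocal limit at infinity. -/
structure InvariantAtInfinity (e : Fin 2 → ℤ) (m : Measure Phase) : Prop where
  direction : ∀ l : ℤ, l ≠ 0 → ∀ b ∈ fiberSymbols, ∫ p in infinityPart, modeSymbol (l • e) b p ∂m = 0
  flow : ∀ k, ∀ b ∈ fiberSymbols, ∫ p in infinityPart, modeSymbol k (flowed k b) p ∂m = 0
  origin : m {p | p.2.1 = 0} = 0

theorem measurableSet_perpPart (e : Fin 2 → ℤ) : MeasurableSet (perpPart e) :=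
  measurableSet_eq_fun ((continuous_fst.comp continuous_snd).inner continuous_const).measurable
    measurable_const

theorem measurable_of_smoothPhase_ereal {s : EReal → ℂ} (hs : SmoothPhase fun p => s p.2.2) :
    Measurable s := by
  have h : s = (fun p : Phase => s p.2.2) ∘ fun η : EReal => ((0, 0, η) : Phase) := rfl
  rw [h]
  exact hs.continuous.measurable.comp (measurable_const.prodMk (measurable_const.prodMk measurable_id))

/-- If `k ∈ Λ`, the invariance in the direction of `Λ` suffices. Otherwise `k·ξ` vanishes on `Λ^⊥`
only at the origin, which has no mass, so the flow identity can be divided by `k·ξ`. -/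
theorem InvariantAtInfinity.integral_eq_zero {e : Fin 2 → ℤ} {m : Measure Phase} [IsFiniteMeasure m]
    (h : InvariantAtInfinity e m) {k : Fin 2 → ℤ}
    (hk : (∃ l : ℤ, l ≠ 0 ∧ k = l • e) ∨ ∀ ξ : Plane, inner ℝ ξ (latticeVec e) = 0 →
      inner ℝ ξ (latticeVec k) = 0 → ξ = 0)
    {s : EReal → ℂ} (hs : SmoothPhase fun p => s p.2.2) (hs1 : ∀ η, ‖s η‖ ≤ 1)
    {g : Plane → ℂ} (hg : Measurable g) {C : ℝ} (hC : ∀ ξ, ‖g ξ‖ ≤ C) :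
    ∫ p, g p.2.1 * (s p.2.2 * UnitAddTorus.mFourier k p.1) ∂((m.restrict infinityPart).restrict (perpPart e)) = 0 := by
  have hπ : Measurable fun p : Phase => p.2.1 := measurable_fst.comp measurable_snd
  have hsm := measurable_of_smoothPhase_ereal hs
  set F : Phase → ℂ := fun p => s p.2.2 * UnitAddTorus.mFourier k p.1 with hF
  have hFm : Measurable F := (hsm.comp (measurable_snd.comp measurable_snd)).mul
    ((map_continuous (UnitAddTorus.mFourier k)).measurable.comp measurable_fst)
  have hF1 : ∀ p, ‖F p‖ ≤ 1 := fun p => by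
    rw [hF, norm_mul, norm_mFourier_apply, mul_one]; exact hs1 _
  set P : Set Plane := {ξ | inner ℝ ξ (latticeVec e) = 0} with hP
  have hPm : MeasurableSet P :=
    measurableSet_eq_fun (continuous_id.inner continuous_const).measurable measurable_const
  set M := m.restrict infinityPart with hM
  have hrest : ∫ p, g p.2.1 * F p ∂(M.restrict (perpPart e)) = ∫ p, P.indicator g p.2.1 * F p ∂M := by
    rw [← integral_indicator (measurableSet_perpPart e)]
    refine integral_congr_ae (ae_of_all _ fun p => ?_)
    by_cases hp : p ∈ perpPart e
    · have : p.2.1 ∈ P := hp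
      simp [hp, this]
    · have : p.2.1 ∉ P := hp
      simp [hp, this]
  rw [hrest]
  have hC0 : 0 ≤ C := (norm_nonneg _).trans (hC 0)
  have hfs : ∀ f : Plane → ℂ, ContDiff ℝ ∞ f → HasCompactSupport f →
      (fun q : Plane × EReal => f q.1 * s q.2) ∈ fiberSymbols := fun f hf hfc =>
    fiber_mul (symbols_of_plane hf hfc : (fun q : Plane × EReal => f q.1) ∈ fiberSymbols) hs
  rcases hk with ⟨l, hl, rfl⟩ | hk
  · refine integral_eq_zero_of_smooth hFm hF1 (fun f hf hfc => ?_) (hg.indicator hPm)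
      (fun ξ => (norm_indicator_le_norm_self _ _).trans (hC ξ))
    rw [← h.direction l hl _ (hfs f hf hfc)]
    refine integral_congr_ae (ae_of_all _ fun p => ?_)
    simp only [modeSymbol, hF, mul_assoc]
  · set ℓ : Plane → ℝ := fun ξ => inner ℝ ξ (latticeVec k) with hℓ
    have hℓr : Continuous ℓ := continuous_id.inner continuous_const
    have hℓs : ContDiff ℝ ∞ fun ξ => (ℓ ξ : ℂ) :=
      Complex.ofRealCLM.contDiff.comp (contDiff_id.inner ℝ contDiff_const)
    have hℓm : Measurable fun ξ => (ℓ ξ : ℂ) := hℓs.continuous.measurable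
    -- On `A n` the quotient by `k·ξ` is bounded and the cutoff equals one. These sets exhaust `{k·ξ
    -- ≠ 0}`, hence almost all of `Λ^⊥`.
    set A : ℕ → Set Plane := fun n => {ξ | ‖ξ‖ ≤ n ∧ ((n : ℝ) + 1)⁻¹ ≤ |ℓ ξ|} with hA
    have hAm : ∀ n, MeasurableSet (A n) := fun n =>
      (measurableSet_le measurable_norm measurable_const).inter (measurableSet_le measurable_const hℓr.abs.measurable)
    have hzero : ∀ n, ∫ p, (A n).indicator (P.indicator g) p.2.1 * F p ∂M = 0 := by
      intro n
      have hχ : ContDiff ℝ ∞ fun ξ => ((cutoff n ξ : ℝ) : ℂ) :=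
        Complex.ofRealCLM.contDiff.comp (cutoff n).contDiff
      have hχc : HasCompactSupport fun ξ => ((cutoff n ξ : ℝ) : ℂ) :=
        (cutoff n).hasCompactSupport.comp_left (g := ((↑) : ℝ → ℂ)) rfl
      obtain ⟨B, hB⟩ := (hχc.mul_right (f' := fun ξ => (ℓ ξ : ℂ))).exists_bound_of_continuous
        (hχ.mul hℓs).continuous
      have hB0 : 0 ≤ B := (norm_nonneg _).trans (hB 0)
      have := integral_eq_zero_of_smooth (M := M)
        (F := fun p => ((cutoff n p.2.1 : ℝ) : ℂ) * (ℓ p.2.1 : ℂ) * F p)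
        (((hχ.mul hℓs).continuous.measurable.comp hπ).mul hFm) (B := B)
        (fun p => by
          rw [norm_mul]
          exact (mul_le_mul (hB _) (hF1 p) (norm_nonneg _) hB0).trans_eq (mul_one B))
        (fun f hf hfc => by
          rw [← h.flow k _ (hfs _ (hf.mul hχ) hfc.mul_right)]
          refine integral_congr_ae (ae_of_all _ fun p => ?_)
          simp only [modeSymbol, flowed, hF, hℓ]
          ring)
        (g := (A n).indicator fun ξ => P.indicator g ξ * (ℓ ξ : ℂ)⁻¹)
        (((hg.indicator hPm).mul hℓm.inv).indicator (hAm n)) (C := C * (n + 1))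
        (fun ξ => by
          by_cases hξ : ξ ∈ A n
          · rw [Set.indicator_of_mem hξ, norm_mul, norm_inv, Complex.norm_real, Real.norm_eq_abs]
            refine mul_le_mul ((norm_indicator_le_norm_self _ _).trans (hC ξ)) ?_ (by positivity) hC0
            exact inv_le_of_inv_le₀ (by positivity) hξ.2
          · rw [Set.indicator_of_notMem hξ, norm_zero]; positivity)
      rw [← this]
      refine integral_congr_ae (ae_of_all _ fun p => ?_)
      by_cases hξ : p.2.1 ∈ A n
      · have hne : (ℓ p.2.1 : ℂ) ≠ 0 := by
          have : 0 < |ℓ p.2.1| := lt_of_lt_of_le (by positivity) hξ.2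
          exact_mod_cast abs_pos.1 this
        simp only [Set.indicator_of_mem hξ, cutoff_eq_one hξ.1]
        field_simp
        simp
      · simp only [Set.indicator_of_notMem hξ, zero_mul]
    have hlim : Tendsto (fun n => ∫ p, (A n).indicator (P.indicator g) p.2.1 * F p ∂M) atTop
        (𝓝 (∫ p, P.indicator g p.2.1 * F p ∂M)) := by
      refine tendsto_integral_of_dominated_convergence (fun _ => C)
        (fun n => ((((hg.indicator hPm).indicator (hAm n)).comp hπ).mul hFm).aestronglyMeasurable)
        (integrable_const C) (fun n => ae_of_all _ fun p => ?_) ?_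
      · rw [norm_mul]
        exact (mul_le_mul ((norm_indicator_le_norm_self _ _).trans
          ((norm_indicator_le_norm_self _ _).trans (hC _))) (hF1 p) (norm_nonneg _) hC0).trans_eq
          (mul_one C)
      · have h0 : ∀ᵐ p ∂M, p.2.1 ≠ 0 := by
          refine ae_restrict_of_ae ?_
          rw [ae_iff]
          simpa using h.origin
        filter_upwards [h0] with p hp
        refine Tendsto.mul_const _ (tendsto_const_nhds.congr' ?_)
        by_cases hpP : p.2.1 ∈ P
        · have hne : 0 < |ℓ p.2.1| := abs_pos.2 fun h0 => hp (hk _ hpP h0)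
          have h1 : ∀ᶠ n : ℕ in atTop, ((n : ℝ) + 1)⁻¹ ≤ |ℓ p.2.1| := by
            have : Tendsto (fun n : ℕ => ((n : ℝ) + 1)⁻¹) atTop (𝓝 0) := tendsto_inv_atTop_zero.comp
              (tendsto_atTop_add_const_right _ _ tendsto_natCast_atTop_atTop)
            exact (this.eventually (gt_mem_nhds hne)).mono fun n hn => hn.le
          filter_upwards [h1, tendsto_natCast_atTop_atTop.eventually_ge_atTop ‖p.2.1‖] with n h1 h2
          exact (Set.indicator_of_mem (s := A n) ⟨h2, h1⟩ _).symm
        · refine Eventually.of_forall fun n => ?_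
          by_cases hpA : p.2.1 ∈ A n <;> simp [hpP, hpA]
    exact tendsto_nhds_unique hlim (tendsto_const_nhds.congr fun n => (hzero n).symm)

/-! ### Measures on a product with the torus -/

/-- Integration of continuous functions on the torus against a finite complex measure. -/
def pairingL {X : Type*} [MeasurableSpace X] (ν : Measure X) [IsFiniteMeasure ν] {π : X → Torus}
    (hπ : Measurable π) {g : X → ℂ} (hg : Measurable g) {B : ℝ} (hB : ∀ x, ‖g x‖ ≤ B) :
    C(Torus, ℂ) →L[ℂ] ℂ :=
  have hi : ∀ f : C(Torus, ℂ), Integrable (fun x => g x * f (π x)) ν := fun f =>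
    Integrable.of_bound ((hg.mul (f.continuous.measurable.comp hπ)).aestronglyMeasurable) (B * ‖f‖)
      (ae_of_all _ fun x => by
        rw [norm_mul]
        exact mul_le_mul (hB x) (f.norm_coe_le_norm _) (norm_nonneg _) ((norm_nonneg _).trans (hB x)))
  LinearMap.mkContinuous
    { toFun := fun f => ∫ x, g x * f (π x) ∂ν
      map_add' := fun f f' => by
        rw [← integral_add (hi f) (hi f')]
        exact integral_congr_ae (ae_of_all _ fun x => mul_add _ _ _)
      map_smul' := fun c f => by
        rw [RingHom.id_apply, smul_eq_mul, ← integral_const_mul]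
        exact integral_congr_ae (ae_of_all _ fun x => mul_left_comm _ _ _) }
    (B * ν.real Set.univ) fun f => by
      refine (norm_integral_le_of_norm_le_const (C := B * ‖f‖) (ae_of_all _ fun x => ?_)).trans_eq
        (by ring)
      rw [norm_mul]
      exact mul_le_mul (hB x) (f.norm_coe_le_norm _) (norm_nonneg _) ((norm_nonneg _).trans (hB x))

theorem pairingL_apply {X : Type*} [MeasurableSpace X] (ν : Measure X) [IsFiniteMeasure ν]
    {π : X → Torus} (hπ : Measurable π) {g : X → ℂ} (hg : Measurable g) {B : ℝ} (hB : ∀ x, ‖g x‖ ≤ B)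
    (f : C(Torus, ℂ)) : pairingL ν hπ hg hB f = ∫ x, g x * f (π x) ∂ν := rfl

/-- For fixed `g`, the form `f ↦ ∫ f(x) g dM` and a multiple of Lebesgue measure agree on every
`e_k`, hence on all continuous functions by density of trigonometric polynomials. -/
theorem eq_prod_of_fourier {M : Measure Phase} [IsFiniteMeasure M]
    (h : ∀ k : Fin 2 → ℤ, k ≠ 0 → ∀ g : BoundedContinuousFunction (Plane × EReal) ℝ,
      ∫ p, (g p.2 : ℂ) * UnitAddTorus.mFourier k p.1 ∂M = 0) :
    M = torusMeasure.prod (M.map Prod.snd) := by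
  refine Measure.eq_prod_of_integral_mul_boundedContinuousFunction fun f g => ?_
  have hgm : Measurable fun p : Phase => (g p.2 : ℂ) :=
    Complex.measurable_ofReal.comp (g.continuous.measurable.comp measurable_snd)
  have hgb : ∀ p : Phase, ‖(g p.2 : ℂ)‖ ≤ ‖g‖ := fun p => by
    rw [Complex.norm_real]; exact g.norm_coe_le_norm _
  set I : ℂ := ∫ p, (g p.2 : ℂ) ∂M with hI
  have heq : pairingL M measurable_fst hgm hgb =
      I • pairingL torusMeasure measurable_id (g := fun _ => 1) measurable_const (B := 1) (by simp) := by
    refine ContinuousLinearMap.ext_on (s := Set.range UnitAddTorus.mFourier) ?_ ?_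
    · rw [dense_iff_closure_eq, ← Submodule.topologicalClosure_coe,
        UnitAddTorus.span_mFourier_closure_eq_top, Submodule.top_coe]
    · rintro _ ⟨k, rfl⟩
      simp only [smul_apply, pairingL_apply, one_mul, smul_eq_mul, id]
      rw [integral_mFourier]
      split_ifs with hk
      · subst hk
        simp [hI, UnitAddTorus.mFourier_zero]
      · rw [mul_zero]
        exact h k hk g
  set fc : C(Torus, ℂ) := ⟨fun x => (f x : ℂ), Complex.continuous_ofReal.comp f.continuous⟩ with hfc
  have h1 := congrArg (fun L : C(Torus, ℂ) →L[ℂ] ℂ => L fc) heq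
  simp only [smul_apply, pairingL_apply, one_mul, smul_eq_mul, id] at h1
  have h2 : ∫ p, (g p.2 : ℂ) * fc p.1 ∂M = ((∫ p, f p.1 * g p.2 ∂M : ℝ) : ℂ) := by
    rw [← integral_complex_ofReal]
    refine integral_congr_ae (ae_of_all _ fun p => ?_)
    simp [hfc, mul_comm]
  have h3 : ∫ x, fc x ∂torusMeasure = ((∫ x, f x ∂torusMeasure : ℝ) : ℂ) := by
    rw [← integral_complex_ofReal]
    rfl
  have h4 : I = ((∫ y, g y ∂(M.map Prod.snd) : ℝ) : ℂ) := by
    rw [integral_map measurable_snd.aemeasurable g.continuous.aestronglyMeasurable,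
      ← integral_complex_ofReal]
  rw [h2, h3, h4, mul_comm] at h1
  exact_mod_cast h1

/-! ### Rational directions -/

theorem IsPrimitiveRankOne.generator_ne_zero {Λ : AddSubgroup (Fin 2 → ℤ)} (hΛ : IsPrimitiveRankOne Λ)
    {e : Fin 2 → ℤ} (he : AddSubgroup.zmultiples e = Λ) : e ≠ 0 := by
  rintro rfl
  have h := hΛ.1
  have h0 : latticeVec '' (Λ : Set (Fin 2 → ℤ)) = {0} := by
    rw [← he, AddSubgroup.zmultiples_zero_eq_bot]
    simp [latticeVec_zero]
  rw [h0, Submodule.span_singleton_eq_bot.2 rfl] at h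
  simp at h

/-- If the determinant of `e` and `k` vanishes, `k` lies on the line spanned by `Λ`, and primitivity
makes it an integer multiple of `e`. Otherwise the two vectors span the plane, and only zero is
orthogonal to both. -/
theorem IsPrimitiveRankOne.dichotomy {Λ : AddSubgroup (Fin 2 → ℤ)} (hΛ : IsPrimitiveRankOne Λ)
    {e : Fin 2 → ℤ} (he : AddSubgroup.zmultiples e = Λ) {k : Fin 2 → ℤ} (hk : k ≠ 0) :
    (∃ l : ℤ, l ≠ 0 ∧ k = l • e) ∨ ∀ ξ : Plane, inner ℝ ξ (latticeVec e) = 0 →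
      inner ℝ ξ (latticeVec k) = 0 → ξ = 0 := by
  have he0 := hΛ.generator_ne_zero he
  by_cases hD : (e 0 : ℝ) * k 1 - e 1 * k 0 = 0
  · left
    have hmem : k ∈ Λ := by
      refine hΛ.2 k ?_
      have heΛ : latticeVec e ∈ Submodule.span ℝ (latticeVec '' (Λ : Set (Fin 2 → ℤ))) :=
        Submodule.subset_span ⟨e, by rw [← he]; exact AddSubgroup.mem_zmultiples e, rfl⟩
      have hn : (e 0 : ℝ) ^ 2 + (e 1 : ℝ) ^ 2 ≠ 0 := by
        intro h0
        apply he0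
        have h1 : (e 0 : ℝ) = 0 := by nlinarith [sq_nonneg (e 0 : ℝ), sq_nonneg (e 1 : ℝ)]
        have h2 : (e 1 : ℝ) = 0 := by nlinarith [sq_nonneg (e 0 : ℝ), sq_nonneg (e 1 : ℝ)]
        funext i
        fin_cases i
        · exact_mod_cast h1
        · exact_mod_cast h2
      have heq : latticeVec k = (((k 0 : ℝ) * e 0 + k 1 * e 1) / ((e 0 : ℝ) ^ 2 + (e 1 : ℝ) ^ 2)) • latticeVec e := by
        ext i
        fin_cases i
        · simp [latticeVec]
          field_simp
          linear_combination (-(e 1 : ℝ)) * hD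
        · simp [latticeVec]
          field_simp
          linear_combination (e 0 : ℝ) * hD
      rw [heq]
      exact Submodule.smul_mem _ _ heΛ
    rw [← he, AddSubgroup.mem_zmultiples_iff] at hmem
    obtain ⟨l, hl⟩ := hmem
    refine ⟨l, ?_, hl.symm⟩
    rintro rfl
    exact hk (by rw [← hl, zero_smul])
  · right
    intro ξ h1 h2
    simp only [latticeVec, PiLp.inner_apply, Fin.sum_univ_two, RCLike.inner_apply, conj_trivial] at h1 h2
    have e0 : ξ 0 = 0 := by
      refine (mul_eq_zero.1 ?_).resolve_right hD
      linear_combination (k 1 : ℝ) * h1 - (e 1 : ℝ) * h2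
    have e1 : ξ 1 = 0 := by
      refine (mul_eq_zero.1 ?_).resolve_right hD
      linear_combination (e 0 : ℝ) * h2 - (k 0 : ℝ) * h1
    ext i
    fin_cases i
    · exact e0
    · exact e1

/-! ### Independence of the position over `Λ^⊥` -/

theorem abs_endSign_le (η : EReal) : |endSign η| ≤ 1 := by
  unfold endSign extend
  split_ifs
  · simp
  · simp
  · rw [abs_div, abs_of_nonneg (Real.sqrt_nonneg _)]
    refine div_le_one_of_le₀ (Real.abs_le_sqrt ?_) (Real.sqrt_nonneg _)
    linarith

/-- At infinity `η` takes only two values, so `g(ξ, η)` is the half-sum of `g(ξ, ±∞)` plus their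
half-difference times `endSign`. Both terms are products of a function of `ξ` and a smooth function
of `η`, as `integral_eq_zero` requires. -/
theorem InvariantAtInfinity.eq_prod {e : Fin 2 → ℤ} {m : Measure Phase} [IsFiniteMeasure m]
    (h : InvariantAtInfinity e m) {Λ : AddSubgroup (Fin 2 → ℤ)} (hΛ : IsPrimitiveRankOne Λ)
    (he : AddSubgroup.zmultiples e = Λ) :
    (m.restrict infinityPart).restrict (perpPart e) =
      torusMeasure.prod (((m.restrict infinityPart).restrict (perpPart e)).map Prod.snd) := by
  refine eq_prod_of_fourier fun k hk g => ?_
  have hk' := hΛ.dichotomy he hk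
  set M := (m.restrict infinityPart).restrict (perpPart e) with hM
  have hgm : ∀ η : EReal, Measurable fun ξ : Plane => (g (ξ, η) : ℂ) := fun η =>
    Complex.measurable_ofReal.comp (g.continuous.measurable.comp (measurable_id.prodMk measurable_const))
  have hgb : ∀ q, ‖(g q : ℂ)‖ ≤ ‖g‖ := fun q => by rw [Complex.norm_real]; exact g.norm_coe_le_norm q
  have hadd : Measurable fun ξ : Plane => ((g (ξ, ⊤) : ℂ) + g (ξ, ⊥)) / 2 :=
    ((hgm ⊤).add (hgm ⊥)).div_const 2
  have hsub : Measurable fun ξ : Plane => ((g (ξ, ⊤) : ℂ) - g (ξ, ⊥)) / 2 :=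
    ((hgm ⊤).sub (hgm ⊥)).div_const 2
  have haddb : ∀ ξ : Plane, ‖((g (ξ, ⊤) : ℂ) + g (ξ, ⊥)) / 2‖ ≤ ‖g‖ := fun ξ => by
    rw [norm_div, Complex.norm_ofNat, div_le_iff₀ two_pos]
    linarith [norm_add_le (g (ξ, ⊤) : ℂ) (g (ξ, ⊥)), hgb (ξ, ⊤), hgb (ξ, ⊥)]
  have hsubb : ∀ ξ : Plane, ‖((g (ξ, ⊤) : ℂ) - g (ξ, ⊥)) / 2‖ ≤ ‖g‖ := fun ξ => by
    rw [norm_div, Complex.norm_ofNat, div_le_iff₀ two_pos]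
    linarith [norm_sub_le (g (ξ, ⊤) : ℂ) (g (ξ, ⊥)), hgb (ξ, ⊤), hgb (ξ, ⊥)]
  have hone : SmoothPhase fun p => (fun _ : EReal => (1 : ℂ)) p.2.2 :=
    smoothPhase_of_plane (f := fun _ => 1) contDiff_const
  have h1 := h.integral_eq_zero (s := fun _ => 1) hk' hone (fun _ => norm_one.le) hadd haddb
  have h2 := h.integral_eq_zero hk' smoothPhase_endSign
    (fun η => by rw [Complex.norm_real]; exact abs_endSign_le η) hsub hsubb
  have hπ : Measurable fun p : Phase => p.2.1 := measurable_fst.comp measurable_snd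
  have hmode : Measurable fun p : Phase => UnitAddTorus.mFourier k p.1 :=
    (map_continuous (UnitAddTorus.mFourier k)).measurable.comp measurable_fst
  have hsm : Measurable fun p : Phase => (endSign p.2.2 : ℂ) := smoothPhase_endSign.continuous.measurable
  have hi1 : Integrable (fun p : Phase => ((g (p.2.1, ⊤) : ℂ) + g (p.2.1, ⊥)) / 2 *
      (1 * UnitAddTorus.mFourier k p.1)) M :=
    Integrable.of_bound ((hadd.comp hπ).mul (measurable_const.mul hmode)).aestronglyMeasurable ‖g‖
      (ae_of_all _ fun p => by
        rw [norm_mul, one_mul, norm_mFourier_apply, mul_one]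
        exact haddb _)
  have hi2 : Integrable (fun p : Phase => ((g (p.2.1, ⊤) : ℂ) - g (p.2.1, ⊥)) / 2 *
      ((endSign p.2.2 : ℂ) * UnitAddTorus.mFourier k p.1)) M :=
    Integrable.of_bound ((hsub.comp hπ).mul (hsm.mul hmode)).aestronglyMeasurable ‖g‖
      (ae_of_all _ fun p => by
        rw [norm_mul, norm_mul, norm_mFourier_apply, mul_one, Complex.norm_real]
        exact (mul_le_mul (hsubb _) (abs_endSign_le _) (abs_nonneg _) (norm_nonneg _)).trans_eq
          (mul_one _))
  have h3 := (integral_add hi1 hi2).trans (by rw [h1, h2, add_zero])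
  rw [← h3]
  refine integral_congr_ae ?_
  have hinf : ∀ᵐ p ∂M, p ∈ infinityPart :=
    ae_restrict_of_ae (ae_restrict_mem measurableSet_infinityPart)
  filter_upwards [hinf] with p hp
  obtain ⟨x, ξ, η⟩ := p
  rcases hp with hp | hp <;>
  · simp only at hp
    subst hp
    simp only [endSign, extend_top, extend_bot]
    push_cast
    ring

end

end TwoMicrolocal

open TwoMicrolocal
-- The main theorem.
theorem theorem2p3
    (V : Torus → ℝ) (hV : TorusSmooth V)
    (ε τ : ℝ → ℝ) (hscales : AdmissibleScales ε τ)
    (Λ : AddSubgroup (Fin 2 → ℤ)) (hΛ : IsPrimitiveRankOne Λ)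
    (e : Fin 2 → ℤ) (he : AddSubgroup.zmultiples e = Λ)
    (μ : ℝ → symbols →ₗ[ℂ] ℂ) (hμ : μ ∈ accumulationPoints V ε τ e)
    (hτε : ∀ᶠ ħ in 𝓝[>] (0 : ℝ), 1 ≤ τ ħ * ε ħ) :
    ∃ m : ℝ → Measure Phase,
      (∀ᵐ t : ℝ, IsFiniteMeasure (m t) ∧ ∀ a : symbols, μ t a = ∫ p, (a : Phase → ℂ) p ∂(m t)) ∧
      (∀ k ∈ Λ, k ≠ 0 → ∀ a : Plane × EReal → ℂ, (fun p : Phase => a p.2) ∈ symbols →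
        ∀ᵐ t : ℝ,
          ∫ p, a p.2 * UnitAddTorus.mFourier (-k) p.1 ∂((m t).restrict infinityPart) = 0) ∧
      ∀ᵐ t : ℝ,
        ((m t).restrict infinityPart).restrict (perpPart e) =
          torusMeasure.prod
            ((((m t).restrict infinityPart).restrict (perpPart e)).map Prod.snd) := by
  obtain ⟨w, ħ, v, hτε, h⟩ := exists_isTwoMicrolocalLimit hV hscales hμ hτε
  obtain ⟨m, hm⟩ := h.exists_represents
  have he0 := hΛ.generator_ne_zero he
  have hfin : ∀ᵐ t, IsFiniteMeasure (m t) := hm.mono fun t ht => ⟨ht.1.trans_lt ENNReal.one_lt_top⟩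
  refine ⟨m, (hfin.and hm).mono fun t ht => ⟨ht.1, ht.2.2⟩, fun k hk hk0 a ha => ?_, ?_⟩
  · rw [← he, AddSubgroup.mem_zmultiples_iff] at hk
    obtain ⟨l, rfl⟩ := hk
    -- The statement involves `e^{-2iπ k·x}`, so the invariance is used for the multiple `-l` of
    -- `e`.
    have hl : -l ≠ 0 := by
      rintro h0
      rw [neg_eq_zero] at h0
      exact hk0 (by rw [h0, zero_smul])
    have := h.ae_integral_infinityPart_eq_zero hm hτε hl he0 (b := a) ha
    simpa only [neg_smul, modeSymbol] using this
  -- For each fixed symbol the identities hold off a null set of times. Countability of the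
  -- frequencies and separability of the symbols give one null set for all of them.
  · have hdir : ∀ᵐ t, ∀ l : ℤ, l ≠ 0 → ∀ b ∈ fiberSymbols,
        ∫ p in infinityPart, modeSymbol (l • e) b p ∂(m t) = 0 := by
      refine ae_all_iff.2 fun l => ?_
      by_cases hl : l = 0
      · exact Eventually.of_forall fun t h0 => absurd hl h0
      · have := hm.ae_forall_integral_eq_zero (S := modeSymbol (l • e) '' fiberSymbols)
          (by rintro _ ⟨b, hb, rfl⟩; exact modeSymbol_mem hb _) (E := infinityPart)
          (by rintro _ ⟨b, hb, rfl⟩; exact h.ae_integral_infinityPart_eq_zero hm hτε hl he0 hb)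
        filter_upwards [this] with t ht _ b hb
        exact ht _ ⟨b, hb, rfl⟩
    have hflow : ∀ᵐ t, ∀ k, ∀ b ∈ fiberSymbols,
        ∫ p in infinityPart, modeSymbol k (flowed k b) p ∂(m t) = 0 := by
      refine ae_all_iff.2 fun k => ?_
      have := hm.ae_forall_integral_eq_zero (S := (fun b => modeSymbol k (flowed k b)) '' fiberSymbols)
        (by rintro _ ⟨b, hb, rfl⟩; exact modeSymbol_mem (flowed_mem k hb) _) (E := infinityPart)
        (by rintro _ ⟨b, hb, rfl⟩; exact h.ae_integral_infinityPart_flowed hm k hb)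
      filter_upwards [this] with t ht b hb
      exact ht _ ⟨b, hb, rfl⟩
    filter_upwards [hdir, hflow, h.ae_measure_origin_eq_zero hm, hfin] with t h1 h2 h3 h4
    exact InvariantAtInfinity.eq_prod ⟨h1, h2, h3⟩ hΛ he
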